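/- Let $n\in\{3,4\}$, let $k\ge 0$, put $N=nk$, and let $T$ be a standard Young tableau of rectangular shape with $n$ rows and $k$ columns. Let $E(T)$ be its evacuation: $N$ times, remove the entry $a$ of the northwest corner, perform jeu de taquin slides among the entries that are still positive as long as possible, and put $-a$ into the empty cell; finally add $N+1$ to all entries. *The web $w_T$.* For $x=1,\dots,n-1$ read row $x+1$ of $T$ from left to right and pair each entry $j$ with the rightmost entry $i<j$ of row $x$ that has not yet been paired; this gives an arc $(i,j)$ of color $x$. Fix $m>0$ and draw each arc $(i,j)$ as a triangle above the $x$-axis with sides of slopes $m$ and $-m$ starting at $(i,0)$ and $(j,0)$, traversed clockwise from $i$ to $j$. Fix $0<\varepsilon<m/2$. At each boundary point $j$ where one arc ends and another starts, insert a vertical edge from $(j,0)$ to a new vertex $(j,\varepsilon)$, at which the two arcs now end and start. Replace each crossing point $P$ of arcs $(i,j)$, $(i',j')$ with $i<i'<j<j'$ by a vertical edge between the vertices $P\pm(0,\varepsilon)$; the upper vertex is joined to the segments going to $i$ and $j'$, the lower one to the segments going to $i'$ and $j$. An edge that comes from one arc of color $x$ is directed clockwise and has weight $x$; each inserted vertical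 edge carries two arcs, of colors $x<x'$, and is directed along the arc of color $x'$ and has weight $x'-x$. Finally, direct the edge at each boundary vertex $(1,0),\dots,(N,0)$ away from the boundary and give it weight $1$. The resulting drawn graph is $w_T$, and $w_{E(T)}$ is obtained in the same way from $E(T)$. *Usual conventions.* (a) Every boundary vertex is a univalent source and its edge has weight $1$. (b) Every interior vertex is trivalent; the weights of its edges are $1,1,1$ if $n=3$, and $1,1,2$ if $n=4$. (c) Edges of weight $1$ are directed so that, with respect to them, every interior vertex is a source or a sink. (d) If $n=4$, edges of weight $2$ are undirected. Then $w_T$ can be changed in exactly one way into a web graph that obeys (a)–(d), by flipping some of its edges (reversing the direction and replacing the weight $x$ by $n-x$) and, for $n=4$, forgetting the directions of the edges of weight $2$; the same holds for $w_{E(T)}$. If $w_T$ and $w_{E(T)}$ now denote these web graphs with the usual conventions, and $\varphi$ denotes reflection over the vertical line $x=\frac{N+1}{2}$ (which keeps weights and carries directions along), then $$\varphi(w_T)=w_{E(T)}$$ exactly, i.e. as drawn graphs with the same vertices, edges, weights and directions, with no further edge-flips. -/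

import Mathlib

noncomputable section

/-! ### Rectangular tableaux and evacuation -/

/-- A filling of an array of cells by integers; `T (r, c)` is the entry in row `r` and column `c`,
rows being numbered `0, 1, …` from the top and columns `0, 1, …` from the left. For a filling of the
`n × k` rectangle only the cells with `r < n` and `c < k` matter. -/
abbrev Filling : Type := ℕ × ℕ → ℤ

/-- `T` is a standard Young tableau of rectangular shape with `n` rows and `k` columns. -/
structure IsRectSYT (n k : ℕ) (T : Filling) : Prop where
  bijOn : Set.BijOn T {p : ℕ × ℕ | p.1 < n ∧ p.2 < k} (Set.Icc (1 : ℤ) ((n * k : ℕ) : ℤ))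
  row_lt : ∀ r c c' : ℕ, r < n → c < c' → c' < k → T (r, c) < T (r, c')
  col_lt : ∀ r r' c : ℕ, r < r' → r' < n → c < k → T (r, c) < T (r', c)

/-- The cell whose entry slides into the empty cell `p`: among the cell below `p` and the cell to
the right of `p` (those that lie in the `n × k` rectangle and hold a positive, i.e. not yet fixed,
entry) the one with the lesser entry, if there is any. -/
def slideSource (n k : ℕ) (F : Filling) (p : ℕ × ℕ) : Option (ℕ × ℕ) :=
  if (p.1 + 1 < n ∧ 0 < F (p.1 + 1, p.2)) ∧
      ((p.2 + 1 < k ∧ 0 < F (p.1, p.2 + 1)) → F (p.1 + 1, p.2) < F (p.1, p.2 + 1)) then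
    some (p.1 + 1, p.2)
  else if p.2 + 1 < k ∧ 0 < F (p.1, p.2 + 1) then
    some (p.1, p.2 + 1)
  else
    none

/-- Perform jeu de taquin slides into the empty cell `p` until none is possible, but at most as
many as the first argument says. Returns the new filling and the final position of the empty cell
(the value that the filling has at the empty cell is meaningless). -/
def slides (n k : ℕ) : ℕ → Filling → ℕ × ℕ → Filling × (ℕ × ℕ)
  | 0, F, p => (F, p)
  | f + 1, F, p =>
    match slideSource n k F p with
    | none => (F, p)
    | some q => slides n k f (Function.update F p (F q)) q

/-- One round of evacuation: remove the entry of the northwest corner, perform slides as long as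
possible (fewer than `n + k` are), and fill the empty cell with the negative of the removed
entry. -/
def evacStep (n k : ℕ) (F : Filling) : Filling :=
  Function.update (slides n k (n + k) F (0, 0)).1 (slides n k (n + k) F (0, 0)).2 (-F (0, 0))

/-- The evacuation `E(T)` of a rectangular tableau with `n` rows and `k` columns. Each round makes
one more entry negative, so all entries are negative after `n * k` rounds; then `n * k + 1` is
added to all of them. -/
def evacuation (n k : ℕ) (T : Filling) : Filling :=
  fun p => (evacStep n k)^[n * k] T p + ((n * k : ℕ) + 1)

/-! ### The multicolored noncrossing matching of a tableau -/

/-- An arc `(init, term)` with a color. -/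
@[ext] structure ColoredArc where
  init : ℤ
  term : ℤ
  color : ℕ

/-- The pairs `(a, c)` such that the entry in column `a` of row `x` has been paired with the entry
in column `c` of row `x + 1` when the first entries of row `x + 1`, as many as the last argument
says, have been treated from left to right: each is paired with the rightmost smaller entry of
row `x` that has not yet been paired. -/
def rowPairs (T : Filling) (k x : ℕ) : ℕ → Finset (ℕ × ℕ)
  | 0 => ∅
  | c + 1 =>
    match ((Finset.range k).filter
        (fun a => T (x, a) < T (x + 1, c) ∧ ∀ q ∈ rowPairs T k x c, q.1 ≠ a)).max with
    | none => rowPairs T k x c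
    | some a => insert (a, c) (rowPairs T k x c)

/-- The multicolored matching of a filling of the `n × k` rectangle. The arcs between the rows with
indices `x` and `x + 1` (the rows number `x + 1` and `x + 2` from the top) have color `x + 1`. -/
def tableauMatching (n k : ℕ) (T : Filling) : Set ColoredArc :=
  {a | ∃ x : ℕ, x + 1 < n ∧ ∃ p ∈ rowPairs T k x k,
    a = ⟨T (x, p.1), T (x + 1, p.2), x + 1⟩}

/-! ### Weighted graphs drawn in the plane -/

/-- The two ends of an edge, ordered if the edge is directed. -/
inductive EdgeEnds where
  | directed (source target : ℝ × ℝ) : EdgeEnds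
  | undirected (ends : Sym2 (ℝ × ℝ)) : EdgeEnds

/-- The point `v` is one of the ends. -/
def EdgeEnds.Has : EdgeEnds → ℝ × ℝ → Prop
  | .directed a b, v => v = a ∨ v = b
  | .undirected z, v => v ∈ z

/-- Reverse the direction, if there is one. -/
def EdgeEnds.reverse : EdgeEnds → EdgeEnds
  | .directed a b => .directed b a
  | .undirected z => .undirected z

/-- Forget the direction. -/
def EdgeEnds.forget : EdgeEnds → EdgeEnds
  | .directed a b => .undirected s(a, b)
  | .undirected z => .undirected z

def EdgeEnds.map (f : ℝ × ℝ → ℝ × ℝ) : EdgeEnds → EdgeEnds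
  | .directed a b => .directed (f a) (f b)
  | .undirected z => .undirected (z.map f)

/-- An edge of a graph drawn in the plane: the curve along which it is drawn, its ends (with its
direction, if it is directed) and its weight. -/
@[ext] structure PlaneEdge where
  curve : Set (ℝ × ℝ)
  ends : EdgeEnds
  weight : ℕ

/-- A weighted graph with boundary drawn in the plane. -/
@[ext] structure PlaneWeb where
  boundary : Set (ℝ × ℝ)
  interior : Set (ℝ × ℝ)
  edges : Set PlaneEdge

/-- The edges incident to `v`. -/
def PlaneWeb.incident (w : PlaneWeb) (v : ℝ × ℝ) : Set PlaneEdge :=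
  {e | e ∈ w.edges ∧ e.ends.Has v}

/-- The reflection over the vertical line `x = (N + 1) / 2`. -/
def reflectPoint (N : ℕ) (p : ℝ × ℝ) : ℝ × ℝ := ((N : ℝ) + 1 - p.1, p.2)

def PlaneEdge.reflect (N : ℕ) (e : PlaneEdge) : PlaneEdge :=
  ⟨reflectPoint N '' e.curve, e.ends.map (reflectPoint N), e.weight⟩

/-- The reflection `φ(w)` of a web with `N` boundary points. -/
def PlaneWeb.reflect (N : ℕ) (w : PlaneWeb) : PlaneWeb :=
  ⟨reflectPoint N '' w.boundary, reflectPoint N '' w.interior, PlaneEdge.reflect N '' w.edges⟩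

/-- The edge-flip for `𝔰𝔩ₙ`: reverse the direction and replace the weight `x` by `n - x`. -/
def PlaneEdge.flip (n : ℕ) (e : PlaneEdge) : PlaneEdge :=
  ⟨e.curve, e.ends.reverse, n - e.weight⟩

/-- Flip the edges in `S`. -/
def PlaneWeb.flip (n : ℕ) (w : PlaneWeb) (S : Set PlaneEdge) : PlaneWeb :=
  ⟨w.boundary, w.interior, (w.edges \ S) ∪ PlaneEdge.flip n '' S⟩

/-! ### The web of a multicolored matching -/

/-- `a = (i, j)` and `b = (i', j')` cross with `i < i' < j < j'`. -/
def ColoredArc.Crosses (a b : ColoredArc) : Prop :=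
  a.init < b.init ∧ b.init < a.term ∧ a.term < b.term

/-- The boundary point `j` is the end of one arc and the start of another one. -/
def IsYPoint (M : Set ColoredArc) (j : ℤ) : Prop :=
  (∃ a ∈ M, a.term = j) ∧ ∃ b ∈ M, b.init = j

/-- The intersection of the line of slope `m` through `(u, 0)` with the line of slope `-m` through
`(v, 0)`. It is the apex of the triangle of an arc `(u, v)`, and it is the crossing point of two arcs
`(i, j)`, `(i', j')` with `i < i' < j < j'` if `u = i'` and `v = j`. -/
def legPoint (m : ℝ) (u v : ℤ) : ℝ × ℝ := (((u : ℝ) + v) / 2, m * ((v : ℝ) - u) / 2)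

/-- The upper vertex of the dumbbell at the crossing point `legPoint m u v`; the
dumbbell has length `2 * ε`. -/
def dumbbellTop (m ε : ℝ) (u v : ℤ) : ℝ × ℝ := ((legPoint m u v).1, (legPoint m u v).2 + ε)

/-- The lower vertex of the dumbbell at the crossing point `legPoint m u v`. -/
def dumbbellBot (m ε : ℝ) (u v : ℤ) : ℝ × ℝ := ((legPoint m u v).1, (legPoint m u v).2 - ε)

def boundaryVertex (j : ℤ) : ℝ × ℝ := ((j : ℝ), 0)

/-- The interior vertex of the `Y` above the boundary point `j`. -/
def yVertex (ε : ℝ) (j : ℤ) : ℝ × ℝ := ((j : ℝ), ε)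

open Classical in
/-- The vertex where an arc with boundary point `j` starts or ends in the web. -/
def footVertex (ε : ℝ) (M : Set ColoredArc) (j : ℤ) : ℝ × ℝ :=
  if IsYPoint M j then yVertex ε j else boundaryVertex j

/-- Walk clockwise along the triangle of the arc `a = (i, j)`, and let the parameter `t` run from
`i` (at the start) through `j` (at the apex) to `2 * j - i` (at the end). It takes the value `t` at
`legPoint m i t` on the rising leg and at `legPoint m (t - (j - i)) j` on the falling leg.
These are the parameters of the start, of the end, and of all points where `a` crosses another
arc. -/
def arcStops (M : Set ColoredArc) (a : ColoredArc) : Set ℤ :=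
  {a.init, 2 * a.term - a.init} ∪
    {t | ∃ b ∈ M, b.Crosses a ∧ t = b.term} ∪
    {t | ∃ b ∈ M, a.Crosses b ∧ t = b.init + (a.term - a.init)}

/-- The stop `q` is the one that follows the stop `p` along the arc `a`. -/
def NextStop (M : Set ColoredArc) (a : ColoredArc) (p q : ℤ) : Prop :=
  p ∈ arcStops M a ∧ q ∈ arcStops M a ∧ p < q ∧ ∀ t ∈ arcStops M a, ¬(p < t ∧ t < q)

/-- The vertex from which the arc `a` leaves its stop `t`. A rising arc leaves a dumbbell from its
upper vertex, a falling arc from its lower one. -/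
def leaveVertex (m ε : ℝ) (M : Set ColoredArc) (a : ColoredArc) (t : ℤ) : ℝ × ℝ :=
  if t = a.init then footVertex ε M a.init
  else if t < a.term then dumbbellTop m ε a.init t
  else dumbbellBot m ε (t - (a.term - a.init)) a.term

/-- The vertex at which the arc `a` reaches its stop `t`. A rising arc reaches a dumbbell at its
lower vertex, a falling arc at its upper one. -/
def reachVertex (m ε : ℝ) (M : Set ColoredArc) (a : ColoredArc) (t : ℤ) : ℝ × ℝ :=
  if t = 2 * a.term - a.init then footVertex ε M a.term
  else if t < a.term then dumbbellBot m ε a.init t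
  else dumbbellTop m ε (t - (a.term - a.init)) a.term

/-- The edge created from the single arc `a` between two successive stops: directed clockwise and
weighted by the color of `a`. It is drawn as a line segment, or as two line segments that meet in
the apex of `a` if the apex lies between the two stops. -/
def singleArcEdge (m ε : ℝ) (M : Set ColoredArc) (a : ColoredArc) (p q : ℤ) : PlaneEdge where
  curve :=
    if p < a.term ∧ a.term < q then
      segment ℝ (leaveVertex m ε M a p) (legPoint m a.init a.term) ∪
        segment ℝ (legPoint m a.init a.term) (reachVertex m ε M a q)
    else segment ℝ (leaveVertex m ε M a p) (reachVertex m ε M a q)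
  ends := .directed (leaveVertex m ε M a p) (reachVertex m ε M a q)
  weight := a.color

/-- The vertical edge with lower end `lo` and upper end `hi` over which an arc of color `x` runs
downwards and an arc of color `x'` runs upwards: it is directed along the arc with the larger
color and weighted by the difference of the colors. -/
def doubleArcEdge (lo hi : ℝ × ℝ) (x x' : ℕ) : PlaneEdge where
  curve := segment ℝ lo hi
  ends := if x < x' then .directed lo hi else .directed hi lo
  weight := if x < x' then x' - x else x - x'

/-- The web of the multicolored matching `M` on `1, …, N`, with arcs drawn as triangles with sides
of slopes `m` and `-m`, before the edges at the boundary are normalized. The parts of the edge set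
are: the edges created from a single arc, the stems of the `Y`s, the vertical edges of the
dumbbells. For `0 < ε < m / 2` the curves of the edges meet only in common vertices. -/
def rawWeb (m ε : ℝ) (N : ℕ) (M : Set ColoredArc) : PlaneWeb where
  boundary := {v | ∃ j : ℤ, 1 ≤ j ∧ j ≤ N ∧ v = boundaryVertex j}
  interior :=
    {v | ∃ j : ℤ, IsYPoint M j ∧ v = yVertex ε j} ∪
    {v | ∃ a ∈ M, ∃ b ∈ M, a.Crosses b ∧
      (v = dumbbellTop m ε b.init a.term ∨ v = dumbbellBot m ε b.init a.term)}
  edges :=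
    {e | ∃ a ∈ M, ∃ p q : ℤ, NextStop M a p q ∧ e = singleArcEdge m ε M a p q} ∪
    {e | ∃ a ∈ M, ∃ b ∈ M, a.term = b.init ∧
      e = doubleArcEdge (boundaryVertex b.init) (yVertex ε b.init) a.color b.color} ∪
    {e | ∃ a ∈ M, ∃ b ∈ M, a.Crosses b ∧
      e = doubleArcEdge (dumbbellBot m ε b.init a.term) (dumbbellTop m ε b.init a.term)
        a.color b.color}

open Classical in
/-- If the edge has an end `u` in the set `B` of boundary vertices, direct it away from `u` and give
it the weight `1`. -/
def PlaneEdge.normalize (B : Set (ℝ × ℝ)) (e : PlaneEdge) : PlaneEdge :=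
  match e.ends with
  | .directed a b =>
    if a ∈ B then ⟨e.curve, .directed a b, 1⟩
    else if b ∈ B then ⟨e.curve, .directed b a, 1⟩
    else e
  | .undirected _ => e

/-- The web `w_M`: the boundary vertices are sources and the edges at the boundary have weight
`1`. -/
def matchingWeb (m ε : ℝ) (N : ℕ) (M : Set ColoredArc) : PlaneWeb where
  boundary := (rawWeb m ε N M).boundary
  interior := (rawWeb m ε N M).interior
  edges := PlaneEdge.normalize (rawWeb m ε N M).boundary '' (rawWeb m ε N M).edges

/-- The web `w_T` of a rectangular tableau `T` with `n` rows and `k` columns. -/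
def tableauWeb (m ε : ℝ) (n k : ℕ) (T : Filling) : PlaneWeb :=
  matchingWeb m ε (n * k) (tableauMatching n k T)

/-! ### The usual conventions for `𝔰𝔩₃` and `𝔰𝔩₄` webs -/

/-- The usual conventions for directions and weights of `𝔰𝔩ₙ` webs with `n = 3` or `n = 4`. -/
structure UsualConventions (n : ℕ) (w : PlaneWeb) : Prop where
  /-- Boundary vertices are univalent sources, and the incident edge is weighted `1`. -/
  boundary_source : ∀ u ∈ w.boundary, ∃ e : PlaneEdge, w.incident u = {e} ∧
    e.weight = 1 ∧ ∃ v, e.ends = .directed u v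
  /-- Interior vertices are trivalent. -/
  trivalent : ∀ v ∈ w.interior, (w.incident v).ncard = 3
  weights_three : n = 3 → ∀ v ∈ w.interior, ∀ e ∈ w.incident v, e.weight = 1
  weights_four : n = 4 → ∀ v ∈ w.interior,
    {e | e ∈ w.incident v ∧ e.weight = 1}.ncard = 2 ∧
    {e | e ∈ w.incident v ∧ e.weight = 2}.ncard = 1
  /-- With respect to the edges of weight `1`, interior vertices are sources or sinks. -/
  source_or_sink : ∀ v ∈ w.interior,
    (∀ e ∈ w.incident v, e.weight = 1 → ∃ u, e.ends = .directed v u) ∨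
    (∀ e ∈ w.incident v, e.weight = 1 → ∃ u, e.ends = .directed u v)
  undirected_four : n = 4 → ∀ e ∈ w.edges, e.weight = 2 → ∃ z, e.ends = .undirected z

/-- For `n = 4`, forget the directions of the edges of weight `2`. -/
def PlaneWeb.forgetMiddle (n : ℕ) (w : PlaneWeb) : PlaneWeb where
  boundary := w.boundary
  interior := w.interior
  edges := (fun e : PlaneEdge =>
    if n = 4 ∧ e.weight = 2 then ⟨e.curve, e.ends.forget, e.weight⟩ else e) '' w.edges

/-- `W` is the web `w` directed and weighted by the usual conventions: it arises from `w` by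
flipping some edges and (for `n = 4`) forgetting the directions of the edges of weight `2`, and it
obeys the conventions. -/
def IsUsualForm (n : ℕ) (w W : PlaneWeb) : Prop :=
  (∃ S : Set PlaneEdge, S ⊆ w.edges ∧ W = (w.flip n S).forgetMiddle n) ∧ UsualConventions n W

end

/-! For a rectangle, evacuation is rotation by 180 degrees with complemented entries: `E(T)(r, c) =
N + 1 - T(n - 1 - r, k - 1 - c)`. The matching of `E(T)` is therefore the mirror image of that of
`T` with each color `x` replaced by `n - x`. The web drawn from the mirrored matching agrees with
the reflected web up to edge-flips, and the usual form does not see edge-flips.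

Evacuation. The word of a tableau sends `t` to the row of the entry `t`. For each `r`, consider the
largest number of times `t` at which the letter lies in `S t`, where `S` is a componentwise weakly
descending sequence of `r`-sets of rows; these maxima act as Greene-type invariants. A horizontal
slide leaves the word alone. A vertical slide lowers one letter from `x + 1` to `x`, and the maxima
neither drop nor grow (`scoreLE_lower`, `scoreLE_raise`, `IsPartialTab.scoreLE_slide`). After `i`
rounds the positive entries are justified to the northwest, so their word is a lattice word, and its
maxima are the sums of the first `r` row lengths. The entries of `T` above `i` are justified to the
southeast, so their word is reverse lattice, with maxima the sums of the last `r` row lengths. Equal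
maxima force reversed row lengths (`letterCount_eq_of_scoreLE`), so the positive cells are the
rotated cells of the entries of `T` above `i`, and the cell that is fixed in the next round is the
rotated cell of `i + 1`.

Matching. The greedy pairing of two rows is their only noncrossing perfect matching
(`IsNoncrossingMatching.rowPairs_eq`). The rotated pairs are noncrossing again, so they are the
greedy pairs of `E(T)`.

Webs. Mirroring reverses the clockwise direction and complements the color, so an edge from a single
arc becomes the flip of its reflection (`singleArcEdge_mirror`). On a vertical edge the larger and
the smaller color change places together with the arcs, so direction and weight are kept
(`doubleArcEdge_reflect`). Since `PlaneEdge.usual` is invariant under flips, the usual forms match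
exactly. The usual form is unique because the conventions prescribe the weight of every edge at a
vertex. It exists because at each interior vertex one arc arrives, one leaves, their colors differ,
and the vertical edge carries the difference (`usual_trivalent`). The bound `ε < m / 2` keeps
different vertices apart. -/

/-! ### Chains of sets of rows and the words they score -/

/-- The number of elements of `S` that are at least `y`. -/
def upperCard (S : Finset ℕ) (y : ℕ) : ℕ := (S.filter (y ≤ ·)).card

theorem upperCard_succ (S : Finset ℕ) (y : ℕ) :
    upperCard S y = upperCard S (y + 1) + if y ∈ S then 1 else 0 := by
  unfold upperCard
  have : S.filter (y ≤ ·) = S.filter (y + 1 ≤ ·) ∪ S.filter (y = ·) := by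
    ext z; simp only [Finset.mem_filter, Finset.mem_union, ← and_or_left]
    refine and_congr_right fun _ => ?_
    omega
  rw [this, Finset.card_union_of_disjoint]
  · rw [Finset.filter_eq]; split_ifs <;> simp
  · rw [Finset.disjoint_filter]; intro z _ h; omega

theorem upperCard_exchange {S : Finset ℕ} {a b : ℕ} (ha : a ∈ S) (hb : b ∉ S) (y : ℕ) :
    upperCard (insert b (S.erase a)) y + (if y ≤ a then 1 else 0) =
      upperCard S y + if y ≤ b then 1 else 0 := by
  unfold upperCard
  have h1 : ∀ Q : Finset ℕ, ((Q.filter (y ≤ ·)).card : ℕ) = ∑ z ∈ Q, if y ≤ z then 1 else 0 := by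
    intro Q; rw [Finset.card_filter]
  rw [h1, h1, Finset.sum_insert (by simp [hb]), ← Finset.add_sum_erase S _ ha]
  ring

/-- A weakly descending sequence of `r`-element sets of rows out of `n`. -/
structure RowChain (n r : ℕ) (S : ℤ → Finset ℕ) : Prop where
  subset : ∀ t, S t ⊆ Finset.range n
  card : ∀ t, (S t).card = r
  anti : ∀ y, Antitone fun t => upperCard (S t) y

theorem RowChain.const {n r : ℕ} {A : Finset ℕ} (h : A ⊆ Finset.range n) (hr : A.card = r) :
    RowChain n r fun _ => A :=
  ⟨fun _ => h, fun _ => hr, fun _ _ _ _ => le_rfl⟩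

/-- The number of positions in `(s, N]` at which the letter of `ρ` lies in the set of the chain. -/
noncomputable def chainScore (ρ : ℤ → ℕ) (s N : ℤ) (S : ℤ → Finset ℕ) : ℕ :=
  ((Finset.Ioc s N).filter fun t => ρ t ∈ S t).card

/-- The number of positions in `(s, N]` with letter `x`. -/
noncomputable def letterCount (ρ : ℤ → ℕ) (s N : ℤ) (x : ℕ) : ℕ :=
  ((Finset.Ioc s N).filter fun t => ρ t = x).card

/-- Every score of `ρ` is bounded by a score of `ρ'`. -/
def ScoreLE (n : ℕ) (s N : ℤ) (ρ ρ' : ℤ → ℕ) : Prop :=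
  ∀ r S, RowChain n r S → ∃ S', RowChain n r S' ∧ chainScore ρ s N S ≤ chainScore ρ' s N S'

theorem ScoreLE.refl (n : ℕ) (s N : ℤ) (ρ : ℤ → ℕ) : ScoreLE n s N ρ ρ :=
  fun _ S hS => ⟨S, hS, le_rfl⟩

theorem ScoreLE.trans {n : ℕ} {s N : ℤ} {ρ ρ' ρ'' : ℤ → ℕ} (h : ScoreLE n s N ρ ρ')
    (h' : ScoreLE n s N ρ' ρ'') : ScoreLE n s N ρ ρ'' := by
  intro r S hS
  obtain ⟨S', hS', h1⟩ := h r S hS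
  obtain ⟨S'', hS'', h2⟩ := h' r S' hS'
  exact ⟨S'', hS'', h1.trans h2⟩

theorem chainScore_congr {ρ ρ' : ℤ → ℕ} {s N : ℤ} (h : ∀ t, s < t → t ≤ N → ρ t = ρ' t)
    (S : ℤ → Finset ℕ) : chainScore ρ s N S = chainScore ρ' s N S := by
  unfold chainScore
  congr 1
  refine Finset.filter_congr fun t ht => ?_
  rw [Finset.mem_Ioc] at ht
  rw [h t ht.1 ht.2]

open Classical in
/-- Replace the row `a` by the row `b` at the times in `U`. -/
noncomputable def exchangeRow (S : ℤ → Finset ℕ) (U : Set ℤ) (a b : ℕ) (t : ℤ) : Finset ℕ :=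
  if t ∈ U then insert b ((S t).erase a) else S t

theorem exchangeRow_rowChain {n r : ℕ} {S : ℤ → Finset ℕ} {U : Set ℤ} {a b : ℕ}
    (hS : RowChain n r S) (hb : b < n) (hU : ∀ t ∈ U, a ∈ S t ∧ b ∉ S t)
    (h : ∀ t y, upperCard (exchangeRow S U a b (t + 1)) y ≤ upperCard (exchangeRow S U a b t) y) :
    RowChain n r (exchangeRow S U a b) := by
  refine ⟨fun t => ?_, fun t => ?_, fun y => antitone_int_of_succ_le fun t => h t y⟩
  · unfold exchangeRow
    split_ifs
    · exact Finset.insert_subset (Finset.mem_range.2 hb) ((Finset.erase_subset _ _).trans (hS.subset t))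
    · exact hS.subset t
  · unfold exchangeRow
    split_ifs with ht
    · obtain ⟨h1, h2⟩ := hU t ht
      rw [Finset.card_insert_of_notMem (by simp [h2]), Finset.card_erase_of_mem h1, hS.card]
      have := Finset.card_pos.2 ⟨a, h1⟩
      rw [hS.card] at this
      omega
    · exact hS.card t

open Classical in
-- At `j` both words hit their sets. At the other times of `U` the exchange loses the hits by the
-- letter `a` and gains those by `b`, and elsewhere nothing changes; `hc` says that the gain covers
-- the loss.
theorem chainScore_le_exchangeRow {ρ ρ' : ℤ → ℕ} {s N j : ℤ} {S : ℤ → Finset ℕ} {U : Set ℤ}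
    {a b : ℕ} (hab : a ≠ b) (hj : j ∈ U) (hU : ∀ t ∈ U, a ∈ S t ∧ b ∉ S t)
    (hρ : ρ j = a) (hρ' : ρ' j = b) (hne : ∀ t, t ≠ j → ρ' t = ρ t)
    (hc : ((Finset.Ioc s N).filter fun t => (t ∈ U ∧ t ≠ j) ∧ ρ t = a).card ≤
      ((Finset.Ioc s N).filter fun t => (t ∈ U ∧ t ≠ j) ∧ ρ t = b).card) :
    chainScore ρ s N S ≤ chainScore ρ' s N (exchangeRow S U a b) := by
  unfold chainScore
  simp only [Finset.card_filter] at hc ⊢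
  have key : ∑ t ∈ Finset.Ioc s N, (if ρ t ∈ S t then 1 else 0) +
      ∑ t ∈ Finset.Ioc s N, (if (t ∈ U ∧ t ≠ j) ∧ ρ t = b then 1 else 0) =
      ∑ t ∈ Finset.Ioc s N, (if ρ' t ∈ exchangeRow S U a b t then 1 else 0) +
      ∑ t ∈ Finset.Ioc s N, (if (t ∈ U ∧ t ≠ j) ∧ ρ t = a then 1 else 0) := by
    rw [← Finset.sum_add_distrib, ← Finset.sum_add_distrib]
    refine Finset.sum_congr rfl fun t _ => ?_
    unfold exchangeRow
    by_cases htj : t = j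
    · subst htj
      simp [hj, hρ, hρ', (hU t hj).1]
    · rw [hne t htj]
      by_cases htU : t ∈ U
      · obtain ⟨h1, h2⟩ := hU t htU
        by_cases h3 : ρ t = a
        · simp [htU, htj, h3, h1, hab]
        · by_cases h4 : ρ t = b
          · simp [htU, htj, h4, h2, hab.symm]
          · simp [htU, htj, h3, h4]
      · simp [htU]
  omega

/-- Raising a letter: the score does not drop if the letter at `j` goes from `x` to `x + 1` and
there is a surplus of `x + 1` in each interval that ends before `j`. -/
theorem scoreLE_raise {n x : ℕ} {s N j : ℤ} {ρ ρ' : ℤ → ℕ} (hx : x + 1 < n)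
    (hρ : ρ j = x) (hρ' : ρ' j = x + 1) (hne : ∀ t, t ≠ j → ρ' t = ρ t)
    (hc : ∀ q, s ≤ q → q < j → ((Finset.Ioo q j).filter fun t => ρ t = x).card ≤
      ((Finset.Ioo q j).filter fun t => ρ t = x + 1).card) :
    ScoreLE n s N ρ ρ' := by
  classical
  intro r S hS
  by_cases hjr : s < j ∧ j ≤ N
  swap
  · refine ⟨S, hS, (chainScore_congr (fun t h1 h2 => ?_) S).le⟩
    rw [hne t]; rintro rfl; exact hjr ⟨h1, h2⟩
  -- If `S j` misses `x` or contains `x + 1`, raising the letter loses no hit and the same chain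
  -- serves.
  by_cases hSj : x ∈ S j ∧ x + 1 ∉ S j
  swap
  · refine ⟨S, hS, Finset.card_le_card fun t => ?_⟩
    simp only [Finset.mem_filter]
    rintro ⟨h1, h2⟩
    refine ⟨h1, ?_⟩
    by_cases htj : t = j
    · subst htj
      rw [hρ] at h2
      rw [hρ']
      by_contra h3
      exact hSj ⟨h2, h3⟩
    · rwa [hne t htj]
  -- The maximal run of times up to `j` whose sets contain `x` but not `x + 1`. The exchange is made
  -- along the whole run, because a change at `j` alone could break the descent.
  set U : Set ℤ := {t | t ≤ j ∧ ∀ t', t ≤ t' → t' ≤ j → x ∈ S t' ∧ x + 1 ∉ S t'} with hUdef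
  have hjU : j ∈ U := ⟨le_rfl, fun t' h1 h2 => by obtain rfl := le_antisymm h1 h2; exact hSj⟩
  have hU : ∀ t ∈ U, x ∈ S t ∧ x + 1 ∉ S t := fun t ht => ht.2 t le_rfl ht.1
  refine ⟨exchangeRow S U x (x + 1), exchangeRow_rowChain hS hx hU fun t y => ?_,
    chainScore_le_exchangeRow (by omega) hjU hU hρ hρ' hne ?_⟩
  · have hy := hS.anti y (show t ≤ t + 1 by omega)
    have hx0 := hS.anti x (show t ≤ t + 1 by omega)
    have hx2 := hS.anti (x + 1 + 1) (show t ≤ t + 1 by omega)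
    have e1 := upperCard_succ (S t) x
    have e2 := upperCard_succ (S t) (x + 1)
    have e3 := upperCard_succ (S (t + 1)) x
    have e4 := upperCard_succ (S (t + 1)) (x + 1)
    simp only at hy hx0 hx2
    unfold exchangeRow
    by_cases h1 : t ∈ U <;> by_cases h2 : t + 1 ∈ U
    · have a1 := upperCard_exchange (hU _ h1).1 (hU _ h1).2 y
      have a2 := upperCard_exchange (hU _ h2).1 (hU _ h2).2 y
      rw [if_pos h1, if_pos h2]; omega
    · have a1 := upperCard_exchange (hU _ h1).1 (hU _ h1).2 y
      rw [if_pos h1, if_neg h2]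
      split_ifs at a1 <;> omega
    -- The left end of the run is the only place where the descent is in danger, and only at the
    -- threshold `x + 1`. There `S t` contains `x + 1` or misses `x`; comparison at the threshold `x
    -- + 2` or `x`, respectively, shows that one unit is to spare.
    · have a2 := upperCard_exchange (hU _ h2).1 (hU _ h2).2 y
      have h3 : ¬(x ∈ S t ∧ x + 1 ∉ S t) := by
        intro h3
        refine h1 ⟨by have := h2.1; omega, fun t' ht' ht'' => ?_⟩
        rcases ht'.eq_or_lt with rfl | h
        · exact h3
        · exact h2.2 t' (by omega) ht''
      rw [if_neg h1, if_pos h2]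
      have b1 := (hU _ h2).1
      have b2 := (hU _ h2).2
      simp only [b1, b2, if_true, if_false] at e3 e4
      by_cases hyx : y = x + 1
      · subst hyx
        by_cases c1 : x ∈ S t
        · have c2 : x + 1 ∈ S t := by by_contra c; exact h3 ⟨c1, c⟩
          simp only [c1, c2, if_true] at e1 e2
          split_ifs at a2 <;> omega
        · simp only [c1, if_false] at e1
          split_ifs at a2 <;> omega
      · split_ifs at a2 <;> omega
    · rw [if_neg h1, if_neg h2]; exact hy
  -- Within `(s, N]` the run without `j` is the open interval from `t0 - 1` to `j`, so the surplus
  -- hypothesis is used with `q = t0 - 1`.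
  · obtain ⟨t0, ⟨ht0s, ht0U⟩, hmin⟩ := Int.exists_least_of_bdd
      (P := fun t => s < t ∧ t ∈ U) ⟨s, fun z hz => hz.1.le⟩ ⟨j, hjr.1, hjU⟩
    have hset : ∀ c, ((Finset.Ioc s N).filter fun t => (t ∈ U ∧ t ≠ j) ∧ ρ t = c) =
        (Finset.Ioo (t0 - 1) j).filter fun t => ρ t = c := by
      intro c
      ext t
      simp only [Finset.mem_filter, Finset.mem_Ioc, Finset.mem_Ioo]
      constructor
      · rintro ⟨⟨h1, h2⟩, ⟨h3, h4⟩, h5⟩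
        have := hmin t ⟨h1, h3⟩
        have := h3.1
        exact ⟨⟨by omega, by omega⟩, h5⟩
      · rintro ⟨⟨h1, h2⟩, h5⟩
        exact ⟨⟨by omega, by omega⟩, ⟨⟨by omega, fun t' h3 h4 => ht0U.2 t' (by omega) h4⟩, by omega⟩, h5⟩
    have := hc (t0 - 1) (by omega) (by have := ht0U.1; omega)
    rw [← hset, ← hset] at this
    convert this

/-- Lowering a letter: the score does not drop if the letter at `j` goes from `x + 1` to `x` and
there is a surplus of `x` in each interval that starts after `j`. -/
theorem scoreLE_lower {n x : ℕ} {s N j : ℤ} {ρ ρ' : ℤ → ℕ} (hx : x + 1 < n)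
    (hρ : ρ j = x + 1) (hρ' : ρ' j = x) (hne : ∀ t, t ≠ j → ρ' t = ρ t)
    (hc : ∀ q, j < q → q ≤ N + 1 → ((Finset.Ioo j q).filter fun t => ρ t = x + 1).card ≤
      ((Finset.Ioo j q).filter fun t => ρ t = x).card) :
    ScoreLE n s N ρ ρ' := by
  classical
  intro r S hS
  by_cases hjr : s < j ∧ j ≤ N
  swap
  · refine ⟨S, hS, (chainScore_congr (fun t h1 h2 => ?_) S).le⟩
    rw [hne t]; rintro rfl; exact hjr ⟨h1, h2⟩
  by_cases hSj : x + 1 ∈ S j ∧ x ∉ S j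
  swap
  · refine ⟨S, hS, Finset.card_le_card fun t => ?_⟩
    simp only [Finset.mem_filter]
    rintro ⟨h1, h2⟩
    refine ⟨h1, ?_⟩
    by_cases htj : t = j
    · subst htj
      rw [hρ] at h2
      rw [hρ']
      by_contra h3
      exact hSj ⟨h2, h3⟩
    · rwa [hne t htj]
  -- Now the run starts at `j`, and the descent is in danger only at its right end.
  set U : Set ℤ := {t | j ≤ t ∧ ∀ t', j ≤ t' → t' ≤ t → x + 1 ∈ S t' ∧ x ∉ S t'} with hUdef
  have hjU : j ∈ U := ⟨le_rfl, fun t' h1 h2 => by obtain rfl := le_antisymm h1 h2; exact hSj⟩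
  have hU : ∀ t ∈ U, x + 1 ∈ S t ∧ x ∉ S t := fun t ht => ht.2 t ht.1 le_rfl
  refine ⟨exchangeRow S U (x + 1) x, exchangeRow_rowChain hS (by omega) hU fun t y => ?_,
    chainScore_le_exchangeRow (by omega) hjU hU hρ hρ' hne ?_⟩
  · have hy := hS.anti y (show t ≤ t + 1 by omega)
    have hx0 := hS.anti x (show t ≤ t + 1 by omega)
    have hx2 := hS.anti (x + 1 + 1) (show t ≤ t + 1 by omega)
    have e1 := upperCard_succ (S t) x
    have e2 := upperCard_succ (S t) (x + 1)
    have e3 := upperCard_succ (S (t + 1)) x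
    have e4 := upperCard_succ (S (t + 1)) (x + 1)
    simp only at hy hx0 hx2
    unfold exchangeRow
    by_cases h1 : t ∈ U <;> by_cases h2 : t + 1 ∈ U
    · have a1 := upperCard_exchange (hU _ h1).1 (hU _ h1).2 y
      have a2 := upperCard_exchange (hU _ h2).1 (hU _ h2).2 y
      rw [if_pos h1, if_pos h2]; omega
    · have a1 := upperCard_exchange (hU _ h1).1 (hU _ h1).2 y
      have h3 : ¬(x + 1 ∈ S (t + 1) ∧ x ∉ S (t + 1)) := by
        intro h3
        refine h2 ⟨by have := h1.1; omega, fun t' ht' ht'' => ?_⟩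
        rcases ht''.eq_or_lt with rfl | h
        · exact h3
        · exact h1.2 t' ht' (by omega)
      rw [if_pos h1, if_neg h2]
      have b1 := (hU _ h1).1
      have b2 := (hU _ h1).2
      simp only [b1, b2, if_true, if_false] at e1 e2
      by_cases hyx : y = x + 1
      · subst hyx
        by_cases c1 : x + 1 ∈ S (t + 1)
        · have c2 : x ∈ S (t + 1) := by by_contra c; exact h3 ⟨c1, c⟩
          simp only [c1, c2, if_true] at e3 e4
          split_ifs at a1 <;> omega
        · simp only [c1, if_false] at e4
          split_ifs at a1 <;> omega
      · split_ifs at a1 <;> omega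
    · have a2 := upperCard_exchange (hU _ h2).1 (hU _ h2).2 y
      rw [if_neg h1, if_pos h2]
      split_ifs at a2 <;> omega
    · rw [if_neg h1, if_neg h2]; exact hy
  · obtain ⟨t0, ⟨ht0s, ht0U⟩, hmax⟩ := Int.exists_greatest_of_bdd
      (P := fun t => t ≤ N ∧ t ∈ U) ⟨N, fun z hz => hz.1⟩ ⟨j, hjr.2, hjU⟩
    have hset : ∀ c, ((Finset.Ioc s N).filter fun t => (t ∈ U ∧ t ≠ j) ∧ ρ t = c) =
        (Finset.Ioo j (t0 + 1)).filter fun t => ρ t = c := by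
      intro c
      ext t
      simp only [Finset.mem_filter, Finset.mem_Ioc, Finset.mem_Ioo]
      constructor
      · rintro ⟨⟨h1, h2⟩, ⟨h3, h4⟩, h5⟩
        have := hmax t ⟨h2, h3⟩
        have := h3.1
        exact ⟨⟨by omega, by omega⟩, h5⟩
      · rintro ⟨⟨h1, h2⟩, h5⟩
        exact ⟨⟨by omega, by omega⟩, ⟨⟨by omega, fun t' h3 h4 => ht0U.2 t' h3 (by omega)⟩, by omega⟩, h5⟩
    have := hc (t0 + 1) (by have := ht0U.1; omega) (by omega)
    rw [← hset, ← hset] at this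
    convert this

/-! ### The maximal scores of lattice words -/

/-- Abel summation: `f x` is `f 0` minus the drops `f y - f (y + 1)` over `y < x`, and `upperCard S
(y + 1)` counts the elements of `S` above `y`. -/
theorem sum_eq_sub_sum_upperCard {n : ℕ} {S : Finset ℕ} (hS : S ⊆ Finset.range n) (f : ℕ → ℤ) :
    ∑ x ∈ S, f x =
      S.card * f 0 - ∑ y ∈ Finset.range n, (f y - f (y + 1)) * (upperCard S (y + 1) : ℤ) := by
  have h1 : ∀ x ∈ S, f x = f 0 - ∑ y ∈ Finset.range n, (f y - f (y + 1)) * if y < x then 1 else 0 := by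
    intro x hx
    have hxn := Finset.mem_range.1 (hS hx)
    have : ∑ y ∈ Finset.range n, (f y - f (y + 1)) * (if y < x then (1 : ℤ) else 0) =
        ∑ y ∈ Finset.range x, (f y - f (y + 1)) := by
      simp only [mul_ite, mul_one, mul_zero]
      rw [← Finset.sum_filter]
      congr 1
      ext y; simp only [Finset.mem_filter, Finset.mem_range]; omega
    rw [this, Finset.sum_range_sub']; ring
  rw [Finset.sum_congr rfl h1, Finset.sum_sub_distrib, Finset.sum_comm]
  simp only [Finset.sum_const, nsmul_eq_mul, ← Finset.mul_sum, upperCard, Finset.card_filter, Nat.succ_le_iff]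
  push_cast
  rfl

/-- In the Abel sum the drops below `n - 1` are nonnegative, so moving to rows of smaller index can
only increase the sum. The drop at `n - 1` has no known sign but is multiplied by `0`. -/
theorem sum_le_sum_of_upperCard_le {n : ℕ} {S S' : Finset ℕ} (hS : S ⊆ Finset.range n)
    (hS' : S' ⊆ Finset.range n) (hcard : S.card = S'.card)
    (h : ∀ y, upperCard S' y ≤ upperCard S y) {f : ℕ → ℤ}
    (hf : ∀ x, x + 1 < n → f (x + 1) ≤ f x) : ∑ x ∈ S, f x ≤ ∑ x ∈ S', f x := by
  rw [sum_eq_sub_sum_upperCard hS, sum_eq_sub_sum_upperCard hS', hcard]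
  refine sub_le_sub_left (Finset.sum_le_sum fun y hy => ?_) _
  by_cases hyn : y + 1 < n
  · exact mul_le_mul_of_nonneg_left (by exact_mod_cast h (y + 1)) (by linarith [hf y hyn])
  · have : ∀ Q : Finset ℕ, Q ⊆ Finset.range n → upperCard Q (y + 1) = 0 := by
      intro Q hQ
      rw [upperCard, Finset.card_eq_zero, Finset.filter_eq_empty_iff]
      intro z hz
      have := Finset.mem_range.1 (hQ hz)
      omega
    rw [this S hS, this S' hS']

/-- At most `y` elements of `S` lie below `y`. Together with `upperCard_le_Ico` this makes the first
and the last `r` rows the extreme `r`-sets. -/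
theorem upperCard_range_le {S : Finset ℕ} {r : ℕ} (h : S.card = r) (y : ℕ) :
    upperCard (Finset.range r) y ≤ upperCard S y := by
  unfold upperCard
  have h1 : (Finset.range r).filter (y ≤ ·) = Finset.Ico y r := by ext; simp [and_comm]
  have h2 := Finset.card_filter_add_card_filter_not (s := S) (y ≤ ·)
  have h3 : (S.filter fun z => ¬ y ≤ z).card ≤ (Finset.range y).card :=
    Finset.card_le_card fun z => by simp
  rw [h1, Nat.card_Ico]
  rw [Finset.card_range] at h3
  omega

theorem upperCard_le_Ico {S : Finset ℕ} {n r : ℕ} (hS : S ⊆ Finset.range n) (h : S.card = r)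
    (y : ℕ) : upperCard S y ≤ upperCard (Finset.Ico (n - r) n) y := by
  unfold upperCard
  have h1 : (Finset.Ico (n - r) n).filter (y ≤ ·) = Finset.Ico (max (n - r) y) n := by
    ext; simp
  have h2 : (S.filter (y ≤ ·)).card ≤ S.card := Finset.card_filter_le _ _
  have h3 : (S.filter (y ≤ ·)).card ≤ (Finset.Ico y n).card :=
    Finset.card_le_card fun z => by
      simp only [Finset.mem_filter, Finset.mem_Ico]
      exact fun hz => ⟨hz.2, Finset.mem_range.1 (hS hz.1)⟩
  have h4 := Finset.card_le_card hS
  rw [h1, Nat.card_Ico]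
  rw [Nat.card_Ico] at h3
  rw [Finset.card_range] at h4
  omega

theorem letterCount_succ_right (ρ : ℤ → ℕ) {s q : ℤ} (h : s ≤ q) (x : ℕ) :
    letterCount ρ s (q + 1) x = letterCount ρ s q x + if ρ (q + 1) = x then 1 else 0 := by
  unfold letterCount
  have : Finset.Ioc s (q + 1) = insert (q + 1) (Finset.Ioc s q) := by ext; simp; omega
  rw [this, Finset.filter_insert]
  split_ifs with h1
  · rw [Finset.card_insert_of_notMem (by simp)]
  · rfl

theorem chainScore_succ_right (ρ : ℤ → ℕ) {s q : ℤ} (h : s ≤ q) (S : ℤ → Finset ℕ) :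
    chainScore ρ s (q + 1) S =
      chainScore ρ s q S + if ρ (q + 1) ∈ S (q + 1) then 1 else 0 := by
  unfold chainScore
  have : Finset.Ioc s (q + 1) = insert (q + 1) (Finset.Ioc s q) := by ext; simp; omega
  rw [this, Finset.filter_insert]
  split_ifs with h1
  · rw [Finset.card_insert_of_notMem (by simp)]
  · rfl

theorem letterCount_succ_left (ρ : ℤ → ℕ) {q N : ℤ} (h : q ≤ N) (x : ℕ) :
    letterCount ρ (q - 1) N x = letterCount ρ q N x + if ρ q = x then 1 else 0 := by
  unfold letterCount
  have : Finset.Ioc (q - 1) N = insert q (Finset.Ioc q N) := by ext; simp; omega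
  rw [this, Finset.filter_insert]
  split_ifs with h1
  · rw [Finset.card_insert_of_notMem (by simp)]
  · rfl

theorem chainScore_succ_left (ρ : ℤ → ℕ) {q N : ℤ} (h : q ≤ N) (S : ℤ → Finset ℕ) :
    chainScore ρ (q - 1) N S = chainScore ρ q N S + if ρ q ∈ S q then 1 else 0 := by
  unfold chainScore
  have : Finset.Ioc (q - 1) N = insert q (Finset.Ioc q N) := by ext; simp; omega
  rw [this, Finset.filter_insert]
  split_ifs with h1
  · rw [Finset.card_insert_of_notMem (by simp)]
  · rfl

theorem chainScore_const (ρ : ℤ → ℕ) (s N : ℤ) (A : Finset ℕ) :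
    chainScore ρ s N (fun _ => A) = ∑ x ∈ A, letterCount ρ s N x := by
  unfold chainScore letterCount
  rw [Finset.card_eq_sum_card_fiberwise (f := ρ) (t := A) (by intro t ht; simpa using (by simpa using ht : _ ∧ ρ t ∈ A).2)]
  refine Finset.sum_congr rfl fun x hx => ?_
  congr 1
  ext t
  simp only [Finset.mem_filter]
  constructor
  · rintro ⟨⟨h1, _⟩, h2⟩; exact ⟨h1, h2⟩
  · rintro ⟨h1, h2⟩; exact ⟨⟨h1, h2 ▸ hx⟩, h2⟩

/-- The score up to `q` stays below the total count up to `q` of the letters in `S q`. Passing to `S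
(q + 1)` moves to rows of smaller index, which are at least as frequent in a lattice word, and the
letter at `q + 1` then adds the same to both sides. The constant chain on the first `r` rows attains
the bound. -/
theorem chainScore_le_of_lattice {n r : ℕ} {s N : ℤ} (hsN : s ≤ N) {ρ : ℤ → ℕ}
    (hρ : ∀ q, s ≤ q → q ≤ N → ∀ x, x + 1 < n →
      letterCount ρ s q (x + 1) ≤ letterCount ρ s q x)
    {S : ℤ → Finset ℕ} (hS : RowChain n r S) :
    chainScore ρ s N S ≤ ∑ x ∈ Finset.range r, letterCount ρ s N x := by
  have step : ∀ q, s ≤ q → q ≤ N →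
      (chainScore ρ s q S : ℤ) ≤ ∑ x ∈ S q, (letterCount ρ s q x : ℤ) := by
    intro q hq
    induction q, hq using Int.leInduction with
    | base => intro _; simp [chainScore]; positivity
    | succ q hq ih =>
      intro hqN
      have h1 := ih (by omega)
      have h2 : ∑ x ∈ S q, (letterCount ρ s q x : ℤ) ≤ ∑ x ∈ S (q + 1), (letterCount ρ s q x : ℤ) :=
        sum_le_sum_of_upperCard_le (hS.subset _) (hS.subset _) ((hS.card _).trans (hS.card _).symm)
          (fun y => hS.anti y (by omega)) fun x hx => by exact_mod_cast hρ q hq (by omega) x hx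
      rw [chainScore_succ_right ρ hq]
      simp only [letterCount_succ_right ρ hq]
      push_cast
      rw [Finset.sum_add_distrib, Finset.sum_ite_eq]
      linarith
  have h1 := step N hsN le_rfl
  have hrn : r ≤ n := by
    have := Finset.card_le_card (hS.subset N); rwa [hS.card, Finset.card_range] at this
  have h2 := sum_le_sum_of_upperCard_le (f := fun x => (letterCount ρ s N x : ℤ)) (hS.subset N)
    (Finset.range_subset_range.2 hrn) ((hS.card N).trans (Finset.card_range r).symm)
    (upperCard_range_le (hS.card N)) fun x hx => by exact_mod_cast hρ N hsN le_rfl x hx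
  exact_mod_cast h1.trans h2

/-- The argument of `chainScore_le_of_lattice` read from right to left: as `q` decreases, the sets
move to rows of larger index, which are at least as frequent in every final part of the word. -/
theorem chainScore_le_of_reverse_lattice {n r : ℕ} {s N : ℤ} (hsN : s ≤ N) {ρ : ℤ → ℕ}
    (hρ : ∀ q, s ≤ q → q ≤ N → ∀ x, x + 1 < n →
      letterCount ρ q N x ≤ letterCount ρ q N (x + 1))
    {S : ℤ → Finset ℕ} (hS : RowChain n r S) :
    chainScore ρ s N S ≤ ∑ x ∈ Finset.Ico (n - r) n, letterCount ρ s N x := by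
  have step : ∀ q, q ≤ N → s ≤ q →
      (chainScore ρ q N S : ℤ) ≤ ∑ x ∈ S q, (letterCount ρ q N x : ℤ) := by
    intro q hq
    induction q, hq using Int.leInductionDown with
    | base => intro _; simp [chainScore]; positivity
    | pred q hq ih =>
      intro hqs
      have h1 := ih (by omega)
      have h2 : ∑ x ∈ S q, (letterCount ρ (q - 1) N x : ℤ) ≤
          ∑ x ∈ S (q - 1), (letterCount ρ (q - 1) N x : ℤ) := by
        have := sum_le_sum_of_upperCard_le (f := fun x => -(letterCount ρ (q - 1) N x : ℤ))
          (hS.subset (q - 1)) (hS.subset q) ((hS.card _).trans (hS.card _).symm)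
          (fun y => hS.anti y (by omega))
          fun x hx => neg_le_neg (by exact_mod_cast hρ (q - 1) hqs (by omega) x hx)
        simp only [Finset.sum_neg_distrib] at this
        linarith
      refine le_trans ?_ h2
      rw [chainScore_succ_left ρ hq]
      simp only [letterCount_succ_left ρ hq]
      push_cast
      rw [Finset.sum_add_distrib, Finset.sum_ite_eq]
      linarith
  have h1 := step s hsN le_rfl
  have hrn : r ≤ n := by
    have := Finset.card_le_card (hS.subset N); rwa [hS.card, Finset.card_range] at this
  have h2 := sum_le_sum_of_upperCard_le (f := fun x => -(letterCount ρ s N x : ℤ))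
    (S := Finset.Ico (n - r) n) (n := n) (fun z => by simp)
    (hS.subset s) (by rw [hS.card, Nat.card_Ico]; omega)
    (upperCard_le_Ico (hS.subset s) (hS.card s))
    fun x hx => neg_le_neg (by exact_mod_cast hρ s le_rfl hsN x hx)
  simp only [Finset.sum_neg_distrib] at h2
  have h3 := h1.trans (neg_le_neg_iff.1 h2)
  exact_mod_cast h3

/-- A lattice word and a reverse lattice word with the same maximal scores have opposite
contents. -/
theorem letterCount_eq_of_scoreLE {n : ℕ} {s N : ℤ} (hsN : s ≤ N) {ρ ρ' : ℤ → ℕ}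
    (hρ : ∀ q, s ≤ q → q ≤ N → ∀ x, x + 1 < n →
      letterCount ρ q N x ≤ letterCount ρ q N (x + 1))
    (hρ' : ∀ q, s ≤ q → q ≤ N → ∀ x, x + 1 < n →
      letterCount ρ' s q (x + 1) ≤ letterCount ρ' s q x)
    (h : ScoreLE n s N ρ ρ') (h' : ScoreLE n s N ρ' ρ) {x : ℕ} (hx : x < n) :
    letterCount ρ' s N x = letterCount ρ s N (n - 1 - x) := by
  -- Both sides are the maximal score for `r`-sets, attained by constant chains. The difference of
  -- the equations for `x + 1` and `x` isolates a single letter.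
  have key : ∀ r, r ≤ n → ∑ x ∈ Finset.range r, letterCount ρ' s N x =
      ∑ x ∈ Finset.Ico (n - r) n, letterCount ρ s N x := by
    intro r hr
    apply le_antisymm
    · obtain ⟨S', hS', hle⟩ := h' r _ (RowChain.const (A := Finset.range r)
        (Finset.range_subset_range.2 hr) (Finset.card_range r))
      rw [chainScore_const] at hle
      exact hle.trans (chainScore_le_of_reverse_lattice hsN hρ hS')
    · obtain ⟨S', hS', hle⟩ := h r _ (RowChain.const (n := n) (A := Finset.Ico (n - r) n)
        (fun z => by simp) (by rw [Nat.card_Ico]; omega))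
      rw [chainScore_const] at hle
      exact hle.trans (chainScore_le_of_lattice hsN hρ' hS')
  have h1 := key (x + 1) (by omega)
  have h2 := key x (by omega)
  rw [Finset.sum_range_succ, h2] at h1
  have h3 : Finset.Ico (n - (x + 1)) n = insert (n - 1 - x) (Finset.Ico (n - x) n) := by
    ext z; simp; omega
  rw [h3, Finset.sum_insert (by simp; omega)] at h1
  omega

/-! ### Evacuation of a rectangular tableau -/

/-- A partial tableau in the `n × k` rectangle: the positive entries of `F` in cells outside `H`
form a standard filling, with entries `lo + 1, …, n * k`, of an order ideal (up to the cells in `H`),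
and `pos t` is the cell of the entry `t`. -/
structure IsPartialTab (n k : ℕ) (lo : ℤ) (F : Filling) (H : Set (ℕ × ℕ)) (pos : ℤ → ℕ × ℕ) :
    Prop where
  lo_nonneg : 0 ≤ lo
  pos_lt : ∀ t, lo < t → t ≤ ((n * k : ℕ) : ℤ) → (pos t).1 < n ∧ (pos t).2 < k
  pos_notMem : ∀ t, lo < t → t ≤ ((n * k : ℕ) : ℤ) → pos t ∉ H
  apply_pos : ∀ t, lo < t → t ≤ ((n * k : ℕ) : ℤ) → F (pos t) = t
  entry : ∀ q : ℕ × ℕ, q.1 < n → q.2 < k → q ∉ H → 0 < F q →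
    lo < F q ∧ F q ≤ ((n * k : ℕ) : ℤ) ∧ pos (F q) = q
  mono : ∀ q' q : ℕ × ℕ, q.1 < n → q.2 < k → q ∉ H → 0 < F q → q' ≤ q → q' ≠ q → q' ∉ H →
    0 < F q' ∧ F q' < F q

theorem IsPartialTab.injOn {n k : ℕ} {lo : ℤ} {F : Filling} {H : Set (ℕ × ℕ)} {pos : ℤ → ℕ × ℕ}
    (h : IsPartialTab n k lo F H pos) {p q : ℕ × ℕ} (hp1 : p.1 < n) (hp2 : p.2 < k) (hp : p ∉ H)
    (hp0 : 0 < F p) (hq1 : q.1 < n) (hq2 : q.2 < k) (hq : q ∉ H) (hpq : F p = F q) : p = q := by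
  rw [← (h.entry p hp1 hp2 hp hp0).2.2, ← (h.entry q hq1 hq2 hq (hpq ▸ hp0)).2.2, hpq]

/-- The cell `q` next to the empty cell `p` can slide. -/
def CanSlide (n k : ℕ) (F : Filling) (p q : ℕ × ℕ) : Prop :=
  (q.1 < n ∧ q.2 < k ∧ 0 < F q) ∧
    ((q = (p.1 + 1, p.2) ∧ (p.2 + 1 < k → 0 < F (p.1, p.2 + 1) → F q < F (p.1, p.2 + 1))) ∨
      (q = (p.1, p.2 + 1) ∧ (p.1 + 1 < n → 0 < F (p.1 + 1, p.2) → F q ≤ F (p.1 + 1, p.2))))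

theorem canSlide_of_slideSource {n k : ℕ} {F : Filling} {p q : ℕ × ℕ} (hp1 : p.1 < n)
    (hp2 : p.2 < k) (h : slideSource n k F p = some q) : CanSlide n k F p q := by
  unfold slideSource at h
  split_ifs at h with h1 h2
  · obtain rfl := Option.some.inj h
    exact ⟨⟨h1.1.1, hp2, h1.1.2⟩, Or.inl ⟨rfl, fun h3 h4 => h1.2 ⟨h3, h4⟩⟩⟩
  · obtain rfl := Option.some.inj h
    refine ⟨⟨hp1, h2.1, h2.2⟩, Or.inr ⟨rfl, fun h3 h4 => ?_⟩⟩
    by_contra h5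
    exact h1 ⟨⟨h3, h4⟩, fun _ => not_le.1 h5⟩

theorem nonpos_of_slideSource_eq_none {n k : ℕ} {F : Filling} {p : ℕ × ℕ}
    (h : slideSource n k F p = none) :
    (p.1 + 1 < n → ¬0 < F (p.1 + 1, p.2)) ∧ (p.2 + 1 < k → ¬0 < F (p.1, p.2 + 1)) := by
  unfold slideSource at h
  split_ifs at h with h1 h2
  refine ⟨fun h3 h4 => h1 ⟨⟨h3, h4⟩, fun h5 => absurd h5 h2⟩, fun h3 h4 => h2 ⟨h3, h4⟩⟩

section slide

variable {n k : ℕ} {lo : ℤ} {F : Filling} {p q : ℕ × ℕ} {pos : ℤ → ℕ × ℕ}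

theorem CanSlide.ne (h : CanSlide n k F p q) : q ≠ p := by
  obtain ⟨-, ⟨rfl, -⟩ | ⟨rfl, -⟩⟩ := h <;> simp [Prod.ext_iff]

theorem CanSlide.le (h : CanSlide n k F p q) : p ≤ q := by
  obtain ⟨-, ⟨rfl, -⟩ | ⟨rfl, -⟩⟩ := h <;> simp [Prod.le_def]

/-- Cells beyond the empty cell hold entries that exceed the sliding entry. -/
theorem CanSlide.lt_of_le (hq : CanSlide n k F p q) (h : IsPartialTab n k lo F {p} pos)
    {u : ℕ × ℕ} (hu1 : u.1 < n) (hu2 : u.2 < k) (hu : 0 < F u) (hpu : p ≤ u) (hup : u ≠ p)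
    (huq : u ≠ q) : F q < F u := by
  obtain ⟨⟨hq1, hq2, hq0⟩, hcase⟩ := hq
  have hle := Prod.le_def.1 hpu
  have hup' : u ∉ ({p} : Set (ℕ × ℕ)) := hup
  have hqp : q ≠ p := CanSlide.ne ⟨⟨hq1, hq2, hq0⟩, hcase⟩
  -- A cell `u ≠ p` beyond `p` lies weakly beyond the right or the lower neighbour `v` of `p`.
  -- Positivity passes from `u` back to `v`, and `v` is either `q` itself or loses the comparison
  -- with `q`.
  have main : ∀ v : ℕ × ℕ, v ≠ p → v.1 < n → v.2 < k → v ≤ u → (0 < F v → v ≠ q → F q < F v) →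
      F q < F u := by
    intro v hvp hv1 hv2 hvu hv
    by_cases hvu' : v = u
    · subst hvu'; exact hv hu huq
    · obtain ⟨h1, h2⟩ := h.mono v u hu1 hu2 hup' hu hvu hvu' hvp
      by_cases hvq : v = q
      · rwa [← hvq]
      · exact (hv h1 hvq).trans h2
  -- The sliding rule prefers the right neighbour in a tie, so it only yields `≤`; distinctness of
  -- the entries makes it strict.
  have hstrict : ∀ v : ℕ × ℕ, v ≠ p → v.1 < n → v.2 < k → 0 < F v → v ≠ q → F q ≤ F v → F q < F v := by
    intro v hvp hv1 hv2 hv hvq hle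
    refine lt_of_le_of_ne hle fun he => hvq ?_
    exact (h.injOn hq1 hq2 hqp hq0 hv1 hv2 hvp he).symm
  by_cases hc : p.2 < u.2
  · refine main (p.1, p.2 + 1) (by simp [Prod.ext_iff]) (by simp; omega) (by simp; omega)
      (Prod.le_def.2 ⟨hle.1, hc⟩) fun h0 hne => ?_
    obtain ⟨rfl, h3⟩ | ⟨rfl, h3⟩ := hcase
    · exact h3 (by omega) h0
    · exact absurd rfl hne
  · have hr : p.1 < u.1 := by
      refine lt_of_le_of_ne hle.1 fun h1 => hup ?_
      exact Prod.ext h1.symm (by omega)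
    refine main (p.1 + 1, p.2) (by simp [Prod.ext_iff]) (by simp; omega) (by simp; omega)
      (Prod.le_def.2 ⟨hr, hle.2⟩) fun h0 hne => ?_
    obtain ⟨rfl, h3⟩ | ⟨rfl, h3⟩ := hcase
    · exact absurd rfl hne
    · exact hstrict _ (by simp [Prod.ext_iff]) (by simp; omega) (by simp; omega) h0 hne
        (h3 (by omega) h0)

/-- The entry `F q` fits into `p`: what precedes `p` also precedes `q`, and by `CanSlide.lt_of_le`
every other positive entry beyond `p` exceeds `F q`. -/
theorem IsPartialTab.slide (h : IsPartialTab n k lo F {p} pos) (hp1 : p.1 < n) (hp2 : p.2 < k)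
    (hq : CanSlide n k F p q) :
    IsPartialTab n k lo (Function.update F p (F q)) {q} (Function.update pos (F q) p) := by
  have hqp := hq.ne
  have hpq := hq.le
  obtain ⟨hq1, hq2, hq0⟩ := hq.1
  obtain ⟨hql, hqN, hqpos⟩ := h.entry q hq1 hq2 hqp hq0
  refine ⟨h.lo_nonneg, fun t h1 h2 => ?_, fun t h1 h2 => ?_, fun t h1 h2 => ?_, fun u hu1 hu2 hu hu0 => ?_,
    fun u' u hu1 hu2 hu hu0 hle hne hu' => ?_⟩
  · by_cases ht : t = F q
    · subst ht; simpa using ⟨hp1, hp2⟩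
    · rw [Function.update_of_ne ht]; exact h.pos_lt t h1 h2
  · by_cases ht : t = F q
    · subst ht; simpa using hqp.symm
    · rw [Function.update_of_ne ht]
      intro he
      apply ht
      rw [← h.apply_pos t h1 h2, show pos t = q from he]
  · by_cases ht : t = F q
    · subst ht; simp
    · rw [Function.update_of_ne ht, Function.update_of_ne (h.pos_notMem t h1 h2)]
      exact h.apply_pos t h1 h2
  · by_cases hup : u = p
    · subst hup; simpa using ⟨hql, hqN⟩
    · rw [Function.update_of_ne hup] at hu0 ⊢
      obtain ⟨h1, h2, h3⟩ := h.entry u hu1 hu2 hup hu0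
      refine ⟨h1, h2, ?_⟩
      rw [Function.update_of_ne, h3]
      intro he
      exact hu (h.injOn hu1 hu2 hup hu0 hq1 hq2 hqp he)
  · have huq : u ≠ q := hu
    have huq' : u' ≠ q := hu'
    by_cases hup : u = p
    · subst hup
      rw [Function.update_self, Function.update_of_ne hne]
      exact h.mono u' q hq1 hq2 hqp hq0 (hle.trans hpq) huq' hne
    · rw [Function.update_of_ne hup] at hu0 ⊢
      by_cases hup' : u' = p
      · subst hup'
        rw [Function.update_self]
        exact ⟨hq0, hq.lt_of_le h hu1 hu2 hu0 hle hup huq⟩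
      · rw [Function.update_of_ne hup']
        exact h.mono u' u hu1 hu2 hup hu0 hle hne hup'

/-- A slide does not change the maximal scores of the word of rows. -/
theorem IsPartialTab.scoreLE_slide (h : IsPartialTab n k lo F {p} pos) (hp1 : p.1 < n)
    (hp2 : p.2 < k) (hq : CanSlide n k F p q) {s : ℤ} (hs : lo ≤ s) :
    ScoreLE n s (n * k : ℕ) (fun t => (pos t).1) (fun t => (Function.update pos (F q) p t).1) ∧
    ScoreLE n s (n * k : ℕ) (fun t => (Function.update pos (F q) p t).1) (fun t => (pos t).1) := by
  have hqp := hq.ne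
  have hlo := h.lo_nonneg
  obtain ⟨hq1, hq2, hq0⟩ := hq.1
  obtain ⟨hql, hqN, hqpos⟩ := h.entry q hq1 hq2 hqp hq0
  have hlt : ∀ u : ℕ × ℕ, u.1 < n → u.2 < k → 0 < F u → p ≤ u → u ≠ p → u ≠ q → F q < F u :=
    fun u h1 h2 h3 h4 h5 h6 => hq.lt_of_le h h1 h2 h3 h4 h5 h6
  obtain ⟨-, ⟨hqe, -⟩ | ⟨hqe, -⟩⟩ := hq
  swap
  -- A slide to the left stays in its row, so the word does not change.
  · have : (fun t => (Function.update pos (F q) p t).1) = fun t => (pos t).1 := by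
      funext t
      by_cases ht : t = F q
      · subst ht; rw [Function.update_self, hqpos, hqe]
      · rw [Function.update_of_ne ht]
    rw [this]
    exact ⟨ScoreLE.refl _ _ _ _, ScoreLE.refl _ _ _ _⟩
  obtain ⟨x, c⟩ := p
  have hq1' : x + 1 < n := by rw [hqe] at hq1; exact hq1
  simp only at hp1 hp2 hqe
  have hword : ∀ t, t ≠ F q → (Function.update pos (F q) (x, c) t).1 = (pos t).1 := by
    intro t ht; rw [Function.update_of_ne ht]
  have hposq : (pos (F q)).1 = x + 1 := by rw [hqpos, hqe]
  constructor
  -- A slide upwards lowers the letter at time `F q` from `x + 1` to `x`. An entry of row `x + 1`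
  -- that comes after `F q` lies to the right of column `c`, so the entry above it also comes after
  -- `F q`, yet before the entry itself. This injects the later letters `x + 1` into the letters `x`
  -- of the same interval.
  · refine scoreLE_lower (x := x) (j := F q) hq1' hposq (by simp) hword fun r hr hrN => ?_
    refine Finset.card_le_card_of_injOn (fun t => F (x, (pos t).2)) ?_ ?_
    · intro t ht
      simp only [Finset.coe_filter, Finset.mem_Ioo, Set.mem_ofPred_eq] at ht ⊢
      obtain ⟨⟨ht1, ht2⟩, ht3⟩ := ht
      have b1 := h.pos_lt t (by omega) (by omega)
      have b2 := h.apply_pos t (by omega) (by omega)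
      have b3 := h.pos_notMem t (by omega) (by omega)
      have hac : c < (pos t).2 := by
        by_contra hac
        by_cases hpq : pos t = q
        · rw [hpq] at b2; omega
        · have := h.mono (pos t) q hq1 hq2 hqp hq0 (by
            rw [hqe]; exact Prod.le_def.2 ⟨ht3.le, not_lt.1 hac⟩) hpq b3
          rw [b2] at this; omega
      have c1 := h.mono (x, (pos t).2) (pos t) b1.1 b1.2 b3 (by rw [b2]; omega)
        (Prod.le_def.2 ⟨by simp [ht3], le_rfl⟩) (by intro he; have := congrArg Prod.fst he; simp at this; omega)
        (by simp [Prod.ext_iff]; omega)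
      have c2 := hlt (x, (pos t).2) hp1 b1.2 c1.1 (Prod.le_def.2 ⟨le_rfl, hac.le⟩)
        (by simp [Prod.ext_iff]; omega) (by rw [hqe]; simp [Prod.ext_iff])
      have c3 := h.entry (x, (pos t).2) hp1 b1.2 (by simp [Prod.ext_iff]; omega) c1.1
      rw [c3.2.2]
      exact ⟨⟨c2, by omega⟩, rfl⟩
    · intro t ht t' ht' he
      simp only [Finset.coe_filter, Finset.mem_Ioo, Set.mem_ofPred_eq] at ht ht' he
      obtain ⟨⟨ht1, ht2⟩, ht3⟩ := ht
      obtain ⟨⟨ht1', ht2'⟩, ht3'⟩ := ht'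
      have aux : ∀ t, F q < t → t < r → (pos t).1 = x + 1 → (pos (F (x, (pos t).2))).2 = (pos t).2 := by
        intro t ht1 ht2 ht3
        have b1 := h.pos_lt t (by omega) (by omega)
        have b2 := h.apply_pos t (by omega) (by omega)
        have b3 := h.pos_notMem t (by omega) (by omega)
        have hac : (x, (pos t).2) ∉ ({(x, c)} : Set (ℕ × ℕ)) := by
          intro hac
          have : (pos t).2 = c := congrArg Prod.snd hac
          have : pos t = q := by rw [hqe]; exact Prod.ext ht3 this
          rw [this] at b2; omega
        have c1 := h.mono (x, (pos t).2) (pos t) b1.1 b1.2 b3 (by rw [b2]; omega)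
          (Prod.le_def.2 ⟨by simp [ht3], le_rfl⟩) (by intro he; have := congrArg Prod.fst he; simp at this; omega)
          hac
        rw [(h.entry (x, (pos t).2) hp1 b1.2 hac c1.1).2.2]
      have e1 := aux t ht1 ht2 ht3
      have e2 := aux t' ht1' ht2' ht3'
      rw [he, e2] at e1
      have : pos t = pos t' := Prod.ext (ht3.trans ht3'.symm) e1.symm
      rw [← h.apply_pos t (by omega) (by omega), this, h.apply_pos t' (by omega) (by omega)]
  · refine scoreLE_raise (x := x) (j := F q) hq1' (by simp) hposq (fun t ht => (hword t ht).symm)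
      fun r hr hrN => ?_
    have hfil : ∀ y, ((Finset.Ioo r (F q)).filter
        fun t => (Function.update pos (F q) (x, c) t).1 = y) =
        (Finset.Ioo r (F q)).filter fun t => (pos t).1 = y := by
      intro y
      refine Finset.filter_congr fun t ht => ?_
      rw [hword t (by rw [Finset.mem_Ioo] at ht; omega)]
    rw [hfil, hfil]
    -- For the converse, an entry of row `x` that comes before `F q` lies to the left of column `c`;
    -- the entry below it is larger than it, but to the left of `q` and hence still before `F q`.
    have aux : ∀ t, r < t → t < F q → (pos t).1 = x →
        (pos t).2 < c ∧ (r < F (x + 1, (pos t).2) ∧ F (x + 1, (pos t).2) < F q) ∧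
          pos (F (x + 1, (pos t).2)) = (x + 1, (pos t).2) := by
      intro t ht1 ht2 ht3
      have b1 := h.pos_lt t (by omega) (by omega)
      have b2 := h.apply_pos t (by omega) (by omega)
      have b3 : pos t ≠ (x, c) := h.pos_notMem t (by omega) (by omega)
      have hac : (pos t).2 < c := by
        by_contra hac
        have := hlt (pos t) b1.1 b1.2 (by rw [b2]; omega) (Prod.le_def.2 ⟨ht3.ge, not_lt.1 hac⟩)
          b3 (by intro he; rw [he, hqe] at ht3; simp at ht3)
        omega
      have hn : (x + 1, (pos t).2) ∉ ({(x, c)} : Set (ℕ × ℕ)) := by simp [Prod.ext_iff]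
      have c1 := h.mono (x + 1, (pos t).2) q hq1 hq2 hqp hq0 (by rw [hqe]; exact Prod.le_def.2 ⟨le_rfl, hac.le⟩)
        (by rw [hqe]; simp [Prod.ext_iff]; omega) hn
      have c2 := h.mono (pos t) (x + 1, (pos t).2) hq1' b1.2 hn c1.1
        (Prod.le_def.2 ⟨by simp [ht3], le_rfl⟩)
        (by intro he; have := congrArg Prod.fst he; simp at this; omega) b3
      exact ⟨hac, ⟨by omega, c1.2⟩, (h.entry (x + 1, (pos t).2) hq1' b1.2 hn c1.1).2.2⟩
    refine Finset.card_le_card_of_injOn (fun t => F (x + 1, (pos t).2)) ?_ ?_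
    · intro t ht
      simp only [Finset.coe_filter, Finset.mem_Ioo, Set.mem_ofPred_eq] at ht ⊢
      obtain ⟨h1, h2, h3⟩ := aux t ht.1.1 ht.1.2 ht.2
      rw [h3]
      exact ⟨h2, rfl⟩
    · intro t ht t' ht' he
      simp only [Finset.coe_filter, Finset.mem_Ioo, Set.mem_ofPred_eq] at ht ht' he
      obtain ⟨-, -, h3⟩ := aux t ht.1.1 ht.1.2 ht.2
      obtain ⟨-, -, h3'⟩ := aux t' ht'.1.1 ht'.1.2 ht'.2
      rw [he, h3'] at h3
      have : pos t = pos t' := Prod.ext (ht.2.trans ht'.2.symm) (congrArg Prod.snd h3).symm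
      rw [← h.apply_pos t (by omega) (by omega), this, h.apply_pos t' (by omega) (by omega)]

end slide

/-- The outcome of the slides into an empty cell. -/
theorem slides_spec {n k : ℕ} {lo : ℤ} : ∀ (f : ℕ) (F : Filling) (p : ℕ × ℕ) (pos : ℤ → ℕ × ℕ),
    IsPartialTab n k lo F {p} pos → p.1 < n → p.2 < k → n + k ≤ f + p.1 + p.2 + 1 →
    (∀ q, q ≤ p → q ≠ p → 0 < F q) → 0 < F p →
    ∃ pos', IsPartialTab n k lo (slides n k f F p).1 {(slides n k f F p).2} pos' ∧
      (slides n k f F p).2.1 < n ∧ (slides n k f F p).2.2 < k ∧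
      slideSource n k (slides n k f F p).1 (slides n k f F p).2 = none ∧
      0 < F (slides n k f F p).2 ∧
      (∀ q, q ≤ (slides n k f F p).2 → q ≠ (slides n k f F p).2 → 0 < (slides n k f F p).1 q) ∧
      (∀ q, ¬0 < F q → (slides n k f F p).1 q = F q) ∧
      (∀ q, 0 < F q → 0 < (slides n k f F p).1 q) ∧
      ∀ s, lo ≤ s →
        ScoreLE n s (n * k : ℕ) (fun t => (pos t).1) (fun t => (pos' t).1) ∧
        ScoreLE n s (n * k : ℕ) (fun t => (pos' t).1) (fun t => (pos t).1) := by
  intro f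
  induction f with
  -- In the rectangle `p.1 + p.2 ≤ n + k - 2`, so the bound on `f` rules out that the supply of
  -- slides is exhausted.
  | zero => intro F p pos h hp1 hp2 hf; omega
  | succ f ih =>
    intro F p pos h hp1 hp2 hf hbelow hp0
    rw [slides]
    cases hsrc : slideSource n k F p with
    | none =>
      exact ⟨pos, h, hp1, hp2, hsrc, hp0, hbelow, fun _ _ => rfl, fun _ h => h,
        fun s _ => ⟨ScoreLE.refl _ _ _ _, ScoreLE.refl _ _ _ _⟩⟩
    | some q =>
      have hq := canSlide_of_slideSource hp1 hp2 hsrc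
      obtain ⟨hq1, hq2, hq0⟩ := hq.1
      have hqp := hq.ne
      have hsum : q.1 + q.2 = p.1 + p.2 + 1 := by
        obtain ⟨-, ⟨rfl, -⟩ | ⟨rfl, -⟩⟩ := hq <;> simp <;> omega
      -- The empty cell keeps a stale positive value, so a slide does not change which cells are
      -- positive.
      have hup : ∀ u, 0 < Function.update F p (F q) u ↔ 0 < F u := by
        intro u
        by_cases hu : u = p
        · subst hu; simp [hq0, hp0]
        · rw [Function.update_of_ne hu]
      obtain ⟨pos', h1, h2, h3, h4, h5, h6, h7, h8, h9⟩ := ih (Function.update F p (F q)) q _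
        (h.slide hp1 hp2 hq) hq1 hq2 (by omega) (by
          intro u hu hne
          rw [hup]
          by_cases hu' : u = p
          · rwa [hu']
          · exact (h.mono u q hq1 hq2 hqp hq0 hu hne hu').1) (by rwa [hup])
      refine ⟨pos', h1, h2, h3, h4, (hup _).1 h5, h6, fun u hu => ?_, fun u hu => h8 u ((hup u).2 hu),
        fun s hs => ?_⟩
      · rw [h7 u (by rwa [hup])]
        rw [Function.update_of_ne]; rintro rfl; exact hu hp0
      · obtain ⟨a1, a2⟩ := h.scoreLE_slide hp1 hp2 hq hs
        exact ⟨a1.trans (h9 s hs).1, (h9 s hs).2.trans a2⟩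

theorem IsPartialTab.apply_corner {n k : ℕ} {lo : ℤ} {F : Filling} {pos : ℤ → ℕ × ℕ}
    (h : IsPartialTab n k lo F ∅ pos) (hN : lo < ((n * k : ℕ) : ℤ)) :
    0 < n ∧ 0 < k ∧ F (0, 0) = lo + 1 := by
  have hlo := h.lo_nonneg
  have h1 := h.pos_lt (lo + 1) (by omega) (by omega)
  have h2 := h.apply_pos (lo + 1) (by omega) (by omega)
  have hn : 0 < n := by omega
  have hk : 0 < k := by omega
  refine ⟨hn, hk, ?_⟩
  by_cases hc : (0, 0) = pos (lo + 1)
  · rw [hc, h2]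
  · have h3 := h.mono (0, 0) (pos (lo + 1)) h1.1 h1.2 (by simp) (by omega)
      (Prod.le_def.2 ⟨by simp, by simp⟩) hc (by simp)
    have h4 := h.entry (0, 0) hn hk (by simp) h3.1
    omega

/-- One round of evacuation. -/
theorem IsPartialTab.evacStep {n k : ℕ} {lo : ℤ} {F : Filling} {pos : ℤ → ℕ × ℕ}
    (h : IsPartialTab n k lo F ∅ pos) (hN : lo < ((n * k : ℕ) : ℤ)) :
    ∃ pos' e, IsPartialTab n k (lo + 1) (evacStep n k F) ∅ pos' ∧
      0 < F e ∧ evacStep n k F e = -(lo + 1) ∧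
      (∀ q, ¬0 < F q → evacStep n k F q = F q) ∧
      (∀ q, q ≠ e → 0 < F q → 0 < evacStep n k F q) ∧
      ∀ s, lo + 1 ≤ s →
        ScoreLE n s (n * k : ℕ) (fun t => (pos t).1) (fun t => (pos' t).1) ∧
        ScoreLE n s (n * k : ℕ) (fun t => (pos' t).1) (fun t => (pos t).1) := by
  have hlo := h.lo_nonneg
  obtain ⟨hn, hk, h00⟩ := h.apply_corner hN
  -- The corner holds the least entry `lo + 1`; without it the corner is the empty cell of a partial
  -- tableau.
  have hp : IsPartialTab n k (lo + 1) F {(0, 0)} pos := by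
    refine ⟨by omega, fun t h1 h2 => h.pos_lt t (by omega) h2, fun t h1 h2 => ?_,
      fun t h1 h2 => h.apply_pos t (by omega) h2, fun q h1 h2 h3 h4 => ?_,
      fun q' q h1 h2 h3 h4 h5 h6 h7 => h.mono q' q h1 h2 (by simp) h4 h5 h6 (by simp)⟩
    · intro hc
      have h3 := h.apply_pos t (by omega) h2
      rw [show pos t = (0, 0) from hc] at h3
      omega
    · obtain ⟨h5, h6, h7⟩ := h.entry q h1 h2 (by simp) h4
      refine ⟨?_, h6, h7⟩
      have := (h.mono (0, 0) q h1 h2 (by simp) h4 (Prod.le_def.2 ⟨by simp, by simp⟩)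
        (fun he => h3 he.symm) (by simp)).2
      omega
  obtain ⟨pos', h1, h2, h3, h4, h5, h6, h7, h8, h9⟩ := slides_spec (n + k) F (0, 0) pos hp hn hk
    (by simp) (by
      intro q hq hne
      exact absurd (Prod.ext (Nat.le_zero.1 (Prod.le_def.1 hq).1) (Nat.le_zero.1 (Prod.le_def.1 hq).2)) hne)
    (by omega)
  obtain ⟨h4a, h4b⟩ := nonpos_of_slideSource_eq_none h4
  set G := (slides n k (n + k) F (0, 0)).1 with hG
  set e := (slides n k (n + k) F (0, 0)).2 with he
  have hstep : _root_.evacStep n k F = Function.update G e (-(lo + 1)) := by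
    rw [_root_.evacStep, ← hG, ← he, h00]
  have hneg : ¬0 < -(lo + 1) := by omega
  refine ⟨pos', e, ⟨h1.lo_nonneg, h1.pos_lt, by simp, fun t a1 a2 => ?_, fun q a1 a2 _ a3 => ?_,
    fun q' q a1 a2 _ a3 a4 a5 _ => ?_⟩, h5, by rw [hstep]; simp, fun q hq => ?_, fun q hq hq0 => ?_, h9⟩
  · rw [hstep, Function.update_of_ne (h1.pos_notMem t a1 a2)]
    exact h1.apply_pos t a1 a2
  · rw [hstep] at a3 ⊢
    have hqe : q ≠ e := by rintro rfl; rw [Function.update_self] at a3; exact hneg a3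
    rw [Function.update_of_ne hqe] at a3 ⊢
    exact h1.entry q a1 a2 hqe a3
  · rw [hstep] at a3 ⊢
    have hqe : q ≠ e := by rintro rfl; rw [Function.update_self] at a3; exact hneg a3
    rw [Function.update_of_ne hqe] at a3 ⊢
    -- No positive entry lies beyond the final empty cell `e`: otherwise its right or lower
    -- neighbour would be positive and the slides would go on.
    have hqe' : q' ≠ e := by
      rintro he'
      rw [he'] at a4 a5
      have hle := Prod.le_def.1 a4
      by_cases hc : e.2 < q.2
      · refine h4b (by omega) ?_
        by_cases hcq : (e.1, e.2 + 1) = q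
        · rwa [hcq]
        · exact (h1.mono (e.1, e.2 + 1) q a1 a2 hqe a3 (Prod.le_def.2 ⟨hle.1, hc⟩) hcq
            (by simp [Prod.ext_iff])).1
      · have hr : e.1 < q.1 := by
          refine lt_of_le_of_ne hle.1 fun hr => a5 ?_
          exact Prod.ext hr (by omega)
        refine h4a (by omega) ?_
        by_cases hcq : (e.1 + 1, e.2) = q
        · rwa [hcq]
        · exact (h1.mono (e.1 + 1, e.2) q a1 a2 hqe a3 (Prod.le_def.2 ⟨hr, hle.2⟩) hcq
            (by simp [Prod.ext_iff])).1
    rw [Function.update_of_ne hqe']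
    exact h1.mono q' q a1 a2 hqe a3 a4 a5 hqe'
  · rw [hstep, Function.update_of_ne (by rintro rfl; exact hq h5)]
    exact h7 q hq
  · rw [hstep, Function.update_of_ne hq]
    exact h8 q hq0

/-- A property inherited by smaller columns holds on an initial segment. This turns equality of row
lengths into equality of sets of cells. -/
theorem lt_card_filter_range_iff {k : ℕ} {P : ℕ → Prop} [DecidablePred P]
    (h : ∀ c c', c ≤ c' → c' < k → P c' → P c) {c : ℕ} (hc : c < k) :
    P c ↔ c < ((Finset.range k).filter P).card := by
  constructor
  · intro hP
    have : Finset.range (c + 1) ⊆ (Finset.range k).filter P := by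
      intro z hz
      rw [Finset.mem_range] at hz
      exact Finset.mem_filter.2 ⟨Finset.mem_range.2 (by omega), h z c (by omega) hc hP⟩
    simpa using Finset.card_le_card this
  · intro hlt
    by_contra hP
    have : (Finset.range k).filter P ⊆ Finset.range c := by
      intro z hz
      rw [Finset.mem_filter, Finset.mem_range] at hz
      rw [Finset.mem_range]
      by_contra hcz
      exact hP (h c z (by omega) hz.1 hz.2)
    have := Finset.card_le_card this
    rw [Finset.card_range] at this
    omega

theorem card_filter_range_reflect (k : ℕ) (P : ℕ → Prop) [DecidablePred P] :
    ((Finset.range k).filter fun c => P (k - 1 - c)).card = ((Finset.range k).filter P).card := by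
  simp only [Finset.card_filter]
  exact Finset.sum_range_reflect (fun c => if P c then 1 else 0) k

theorem IsPartialTab.letterCount_eq {n k : ℕ} {lo : ℤ} {F : Filling} {pos : ℤ → ℕ × ℕ}
    (h : IsPartialTab n k lo F ∅ pos) {s q : ℤ} (hs : lo ≤ s) (hq : q ≤ ((n * k : ℕ) : ℤ)) {x : ℕ}
    (hx : x < n) : letterCount (fun t => (pos t).1) s q x =
      ((Finset.range k).filter fun c => s < F (x, c) ∧ F (x, c) ≤ q).card := by
  have hlo := h.lo_nonneg
  refine Finset.card_bij (fun t _ => (pos t).2) (fun t ht => ?_) (fun t ht t' ht' he => ?_)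
    fun c hc => ?_
  · simp only [Finset.mem_filter, Finset.mem_Ioc, Finset.mem_range] at ht ⊢
    have h1 := h.pos_lt t (by omega) (by omega)
    have h2 := h.apply_pos t (by omega) (by omega)
    have h3 : (x, (pos t).2) = pos t := Prod.ext ht.2.symm rfl
    rw [h3, h2]
    exact ⟨h1.2, ht.1⟩
  · simp only [Finset.mem_filter, Finset.mem_Ioc] at ht ht'
    rw [← h.apply_pos t (by omega) (by omega), ← h.apply_pos t' (by omega) (by omega)]
    exact congrArg F (Prod.ext (ht.2.trans ht'.2.symm) he)
  · simp only [Finset.mem_filter, Finset.mem_Ioc, Finset.mem_range] at hc ⊢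
    have h1 := h.entry (x, c) hx hc.1 (by simp) (by omega)
    exact ⟨F (x, c), ⟨hc.2, by rw [h1.2.2]⟩, by rw [h1.2.2]⟩

/-! ### Shapes during the evacuation of a rectangle -/

/-- The cell of an entry of a tableau. -/
noncomputable def entryCell (n k : ℕ) (T : Filling) (t : ℤ) : ℕ × ℕ :=
  Function.invFunOn T {p : ℕ × ℕ | p.1 < n ∧ p.2 < k} t

theorem IsRectSYT.one_le {n k : ℕ} {T : Filling} (hT : IsRectSYT n k T) {p : ℕ × ℕ}
    (h1 : p.1 < n) (h2 : p.2 < k) : 1 ≤ T p ∧ T p ≤ ((n * k : ℕ) : ℤ) :=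
  hT.bijOn.mapsTo (show p ∈ {p : ℕ × ℕ | p.1 < n ∧ p.2 < k} from ⟨h1, h2⟩)

theorem IsRectSYT.entryCell_apply {n k : ℕ} {T : Filling} (hT : IsRectSYT n k T) {p : ℕ × ℕ}
    (h1 : p.1 < n) (h2 : p.2 < k) : entryCell n k T (T p) = p :=
  hT.bijOn.injOn.leftInvOn_invFunOn (show p ∈ {p : ℕ × ℕ | p.1 < n ∧ p.2 < k} from ⟨h1, h2⟩)

theorem IsRectSYT.entryCell_spec {n k : ℕ} {T : Filling} (hT : IsRectSYT n k T) {t : ℤ}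
    (h1 : 1 ≤ t) (h2 : t ≤ ((n * k : ℕ) : ℤ)) :
    ((entryCell n k T t).1 < n ∧ (entryCell n k T t).2 < k) ∧ T (entryCell n k T t) = t := by
  have h := hT.bijOn.surjOn (show t ∈ Set.Icc (1 : ℤ) ((n * k : ℕ) : ℤ) from ⟨h1, h2⟩)
  exact ⟨Function.invFunOn_mem h, Function.invFunOn_eq h⟩

theorem IsRectSYT.isPartialTab {n k : ℕ} {T : Filling} (hT : IsRectSYT n k T) :
    IsPartialTab n k 0 T ∅ (entryCell n k T) := by
  refine ⟨le_rfl, fun t h1 h2 => (hT.entryCell_spec h1 h2).1, by simp,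
    fun t h1 h2 => (hT.entryCell_spec h1 h2).2, fun q h1 h2 _ h4 =>
    ⟨h4, (hT.one_le h1 h2).2, hT.entryCell_apply h1 h2⟩, ?_⟩
  rintro ⟨r', c'⟩ ⟨r, c⟩ h1 h2 _ _ hle hne _
  obtain ⟨hr, hc⟩ := Prod.le_def.1 hle
  simp only at h1 h2 hr hc
  refine ⟨(hT.one_le (p := (r', c')) (by simp; omega) (by simp; omega)).1, ?_⟩
  rcases hr.eq_or_lt with rfl | hr
  · rcases hc.eq_or_lt with rfl | hc
    · exact absurd rfl hne
    · exact hT.row_lt _ _ _ h1 hc h2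
  · rcases hc.eq_or_lt with rfl | hc
    · exact hT.col_lt _ _ _ hr h1 h2
    · exact (hT.col_lt _ _ _ hr h1 (hc.trans h2)).trans (hT.row_lt _ _ _ h1 hc h2)

/-- A partial tableau whose word has the maximal scores of a final part of the word of the
rectangular tableau `T` fills the rotated cells of this part. -/
theorem IsPartialTab.pos_iff {n k : ℕ} {T : Filling} (hT : IsRectSYT n k T) {lo : ℤ} {F : Filling}
    {pos : ℤ → ℕ × ℕ} (h : IsPartialTab n k lo F ∅ pos) (hN : lo ≤ ((n * k : ℕ) : ℤ))
    (h1 : ScoreLE n lo (n * k : ℕ) (fun t => (entryCell n k T t).1) (fun t => (pos t).1))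
    (h2 : ScoreLE n lo (n * k : ℕ) (fun t => (pos t).1) (fun t => (entryCell n k T t).1))
    {r c : ℕ} (hr : r < n) (hc : c < k) :
    0 < F (r, c) ↔ lo < T (n - 1 - r, k - 1 - c) := by
  have hlo := h.lo_nonneg
  have hP := hT.isPartialTab
  -- In `T` the cell below an entry above `q` holds a larger entry, so the word is reverse lattice.
  -- In `F` the cell above a positive entry holds a smaller positive one, so the word is lattice.
  -- Row `r` of `F` thus has as many positive entries as row `n - 1 - r` of `T` has entries above
  -- `lo`.
  have key := letterCount_eq_of_scoreLE hN (fun q hq hqN x hx => ?_) (fun q hq hqN x hx => ?_) h1 h2 hr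
  · rw [h.letterCount_eq le_rfl le_rfl hr, hP.letterCount_eq hlo le_rfl (by omega)] at key
    have e1 : ((Finset.range k).filter fun c => lo < F (r, c) ∧ F (r, c) ≤ ((n * k : ℕ) : ℤ)) =
        (Finset.range k).filter fun c => 0 < F (r, c) := by
      refine Finset.filter_congr fun c hc => ⟨fun h => by omega, fun h0 => ?_⟩
      have := h.entry (r, c) hr (Finset.mem_range.1 hc) (by simp) h0
      exact ⟨this.1, this.2.1⟩
    have e2 : ((Finset.range k).filter fun c => lo < T (n - 1 - r, c) ∧
        T (n - 1 - r, c) ≤ ((n * k : ℕ) : ℤ)) =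
        (Finset.range k).filter fun c => lo < T (n - 1 - r, c) := by
      refine Finset.filter_congr fun c hc => ⟨fun h => h.1, fun h0 => ⟨h0, ?_⟩⟩
      exact (hT.one_le (p := (n - 1 - r, c)) (by simp; omega) (Finset.mem_range.1 hc)).2
    -- Reversing the columns of `T` makes its entries above `lo` an initial segment too, so both
    -- conditions compare `c` with the same length.
    rw [e1, e2, ← card_filter_range_reflect k fun c => lo < T (n - 1 - r, c)] at key
    rw [lt_card_filter_range_iff (P := fun c => 0 < F (r, c)) ?_ hc, key,
      lt_card_filter_range_iff (P := fun c => lo < T (n - 1 - r, k - 1 - c)) ?_ hc]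
    · intro c c' hcc hc' hlt
      rcases hcc.eq_or_lt with rfl | hcc
      · exact hlt
      · exact hlt.trans (hT.row_lt _ _ _ (by omega) (by omega) (by omega))
    · intro c c' hcc hc' hlt
      rcases hcc.eq_or_lt with rfl | hcc
      · exact hlt
      · exact (h.mono (r, c) (r, c') hr hc' (by simp) hlt (Prod.le_def.2 ⟨le_rfl, hcc.le⟩)
          (by simp [Prod.ext_iff]; omega) (by simp)).1
  · rw [hP.letterCount_eq (by omega) le_rfl (by omega), hP.letterCount_eq (by omega) le_rfl hx]
    refine Finset.card_le_card fun c hc => ?_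
    simp only [Finset.mem_filter, Finset.mem_range] at hc ⊢
    have := hT.col_lt x (x + 1) c (by omega) hx hc.1
    exact ⟨hc.1, by omega, (hT.one_le (p := (x + 1, c)) hx hc.1).2⟩
  · rw [h.letterCount_eq le_rfl hqN hx, h.letterCount_eq le_rfl hqN (by omega)]
    refine Finset.card_le_card fun c hc => ?_
    simp only [Finset.mem_filter, Finset.mem_range] at hc ⊢
    have h3 := h.mono (x, c) (x + 1, c) hx hc.1 (by simp) (by omega)
      (Prod.le_def.2 ⟨by simp, le_rfl⟩) (by simp [Prod.ext_iff]) (by simp)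
    have h4 := h.entry (x, c) (by simp; omega) hc.1 (by simp) h3.1
    exact ⟨hc.1, h4.1, by omega⟩

/-- The state of the evacuation after `i` rounds. -/
theorem IsRectSYT.evacStep_iterate {n k : ℕ} {T : Filling} (hT : IsRectSYT n k T) (i : ℕ)
    (hi : i ≤ n * k) :
    (∃ pos, IsPartialTab n k i ((evacStep n k)^[i] T) ∅ pos ∧ ∀ s, (i : ℤ) ≤ s →
      ScoreLE n s (n * k : ℕ) (fun t => (entryCell n k T t).1) (fun t => (pos t).1) ∧
      ScoreLE n s (n * k : ℕ) (fun t => (pos t).1) (fun t => (entryCell n k T t).1)) ∧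
    ∀ r c, r < n → c < k →
      ((i : ℤ) < T (n - 1 - r, k - 1 - c) → 0 < (evacStep n k)^[i] T (r, c)) ∧
      (T (n - 1 - r, k - 1 - c) ≤ i →
        (evacStep n k)^[i] T (r, c) = -T (n - 1 - r, k - 1 - c)) := by
  induction i with
  | zero =>
    refine ⟨⟨_, hT.isPartialTab, fun s _ => ⟨ScoreLE.refl _ _ _ _, ScoreLE.refl _ _ _ _⟩⟩,
      fun r c hr hc => ⟨fun _ => (hT.one_le (p := (r, c)) hr hc).1, fun h => ?_⟩⟩
    have := (hT.one_le (p := (n - 1 - r, k - 1 - c)) (by simp; omega) (by simp; omega)).1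
    simp at h; omega
  | succ i ih =>
    obtain ⟨⟨pos, h1, h2⟩, h3⟩ := ih (by omega)
    obtain ⟨pos', e, g1, g2, g3, g4, g5, g6⟩ := h1.evacStep (by exact_mod_cast hi)
    rw [Function.iterate_succ_apply']
    have g7 : ∀ s, ((i : ℤ) + 1) ≤ s →
        ScoreLE n s (n * k : ℕ) (fun t => (entryCell n k T t).1) (fun t => (pos' t).1) ∧
        ScoreLE n s (n * k : ℕ) (fun t => (pos' t).1) (fun t => (entryCell n k T t).1) :=
      fun s hs => ⟨(h2 s (by omega)).1.trans (g6 s hs).1, (g6 s hs).2.trans (h2 s (by omega)).2⟩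
    refine ⟨⟨pos', by exact_mod_cast g1, fun s hs => g7 s (by exact_mod_cast hs)⟩,
      fun r c hr hc => ?_⟩
    have hiff := g1.pos_iff hT (by exact_mod_cast hi) (g7 _ le_rfl).1 (g7 _ le_rfl).2 hr hc
    obtain ⟨h3a, h3b⟩ := h3 r c hr hc
    push_cast
    refine ⟨hiff.2, fun hle => ?_⟩
    have hpos := (hT.one_le (p := (n - 1 - r, k - 1 - c)) (by simp; omega) (by simp; omega)).1
    -- The rotated cell of `i + 1` was positive before this round and by `hiff` is not afterwards.
    -- Only `e` stops being positive, so this cell is `e` and receives `-(i + 1)`.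
    rcases hle.eq_or_lt with heq | hlt
    · by_cases hce : (r, c) = e
      · rw [hce, g3, heq]
      · have := hiff.1 (g5 _ hce (h3a (by omega)))
        omega
    · rw [g4 _ (by rw [h3b (by omega)]; omega), h3b (by omega)]

/-- The evacuation of a rectangular tableau is its rotated complement. -/
theorem IsRectSYT.evacuation_apply {n k : ℕ} {T : Filling} (hT : IsRectSYT n k T) {r c : ℕ}
    (hr : r < n) (hc : c < k) :
    evacuation n k T (r, c) = ((n * k : ℕ) : ℤ) + 1 - T (n - 1 - r, k - 1 - c) := by
  have hle := (hT.one_le (p := (n - 1 - r, k - 1 - c)) (by simp; omega) (by simp; omega)).2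
  rw [evacuation, ((hT.evacStep_iterate (n * k) le_rfl).2 r c hr hc).2 hle]
  ring

theorem IsRectSYT.evacuation {n k : ℕ} {T : Filling} (hT : IsRectSYT n k T) :
    IsRectSYT n k (evacuation n k T) := by
  refine ⟨⟨?_, ?_, ?_⟩, fun r c c' hr hc hc' => ?_, fun r r' c hr hr' hc => ?_⟩
  · rintro ⟨r, c⟩ ⟨hr, hc⟩
    simp only at hr hc
    rw [hT.evacuation_apply hr hc, Set.mem_Icc]
    have := hT.one_le (p := (n - 1 - r, k - 1 - c)) (by simp; omega) (by simp; omega)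
    omega
  · rintro ⟨r, c⟩ ⟨hr, hc⟩ ⟨r', c'⟩ ⟨hr', hc'⟩ h
    simp only at hr hc hr' hc'
    rw [hT.evacuation_apply hr hc, hT.evacuation_apply hr' hc'] at h
    have := hT.bijOn.injOn (show (n - 1 - r, k - 1 - c) ∈ _ from ⟨by simp; omega, by simp; omega⟩)
      (show (n - 1 - r', k - 1 - c') ∈ _ from ⟨by simp; omega, by simp; omega⟩) (by omega)
    simp only [Prod.ext_iff] at this ⊢
    omega
  · intro t ht
    rw [Set.mem_Icc] at ht
    obtain ⟨⟨h1, h2⟩, h3⟩ := hT.entryCell_spec (t := ((n * k : ℕ) : ℤ) + 1 - t) (by omega) (by omega)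
    set p := entryCell n k T (((n * k : ℕ) : ℤ) + 1 - t)
    refine ⟨(n - 1 - p.1, k - 1 - p.2), ⟨by simp; omega, by simp; omega⟩, ?_⟩
    rw [hT.evacuation_apply (by omega) (by omega), show n - 1 - (n - 1 - p.1) = p.1 by omega,
      show k - 1 - (k - 1 - p.2) = p.2 by omega]
    rw [show T (p.1, p.2) = T p from rfl, h3]
    ring
  · rw [hT.evacuation_apply hr (by omega), hT.evacuation_apply hr hc']
    have := hT.row_lt (n - 1 - r) (k - 1 - c') (k - 1 - c) (by omega) (by omega) (by omega)
    omega
  · rw [hT.evacuation_apply (by omega) hc, hT.evacuation_apply hr' hc]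
    have := hT.col_lt (n - 1 - r') (n - 1 - r) (k - 1 - c) (by omega) (by omega) (by omega)
    omega

/-! ### The matching of a tableau and of its evacuation -/

/-- A noncrossing perfect matching of the increasing sequences `A` and `B` of length `k`. -/
structure IsNoncrossingMatching (k : ℕ) (A B : ℕ → ℤ) (R : Finset (ℕ × ℕ)) : Prop where
  lt : ∀ p ∈ R, p.1 < k ∧ p.2 < k ∧ A p.1 < B p.2
  exists_left : ∀ c < k, ∃ a, (a, c) ∈ R
  exists_right : ∀ a < k, ∃ c, (a, c) ∈ R
  inj_left : ∀ p ∈ R, ∀ q ∈ R, p.1 = q.1 → p = q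
  inj_right : ∀ p ∈ R, ∀ q ∈ R, p.2 = q.2 → p = q
  noncrossing : ∀ p ∈ R, ∀ q ∈ R, p.1 < q.1 → A q.1 < B p.2 → q.2 < p.2

/-- A candidate always exists: the `c` earlier pairs cannot use up the columns `0, …, c` of row `x`,
whose entries are all less than `T (x + 1, c)`. The last clause is noncrossing in the form that
survives the induction: since the rightmost free candidate is taken, a smaller entry further to the
right must have been paired earlier. -/
theorem rowPairs_partial {T : Filling} {k x : ℕ}
    (hA : ∀ c c', c < c' → c' < k → T (x, c) < T (x, c'))
    (hAB : ∀ c < k, T (x, c) < T (x + 1, c)) (c : ℕ) (hc : c ≤ k) :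
    (∀ p ∈ rowPairs T k x c, p.1 < k ∧ p.2 < c ∧ T (x, p.1) < T (x + 1, p.2)) ∧
    (∀ b < c, ∃ a, (a, b) ∈ rowPairs T k x c) ∧
    (∀ p ∈ rowPairs T k x c, ∀ q ∈ rowPairs T k x c, p.1 = q.1 → p = q) ∧
    (∀ p ∈ rowPairs T k x c, ∀ q ∈ rowPairs T k x c, p.2 = q.2 → p = q) ∧
    (∀ p ∈ rowPairs T k x c, ∀ a, a < k → p.1 < a → T (x, a) < T (x + 1, p.2) →
      ∃ q ∈ rowPairs T k x c, q.1 = a ∧ q.2 < p.2) := by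
  induction c with
  | zero => simp [rowPairs]
  | succ c ih =>
    obtain ⟨h1, h2, h3, h4, h5⟩ := ih (by omega)
    rw [rowPairs]
    set R := rowPairs T k x c
    set C := (Finset.range k).filter fun a => T (x, a) < T (x + 1, c) ∧ ∀ q ∈ R, q.1 ≠ a with hC
    have hne : C.Nonempty := by
      by_contra hempty
      rw [Finset.not_nonempty_iff_eq_empty, hC, Finset.filter_eq_empty_iff] at hempty
      have hsub : Finset.range (c + 1) ⊆ R.image Prod.fst := by
        intro a ha
        rw [Finset.mem_range] at ha
        have := hempty (Finset.mem_range.2 (show a < k by omega))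
        have hlt : T (x, a) < T (x + 1, c) := by
          rcases Nat.lt_succ_iff_lt_or_eq.1 ha with h | rfl
          · exact (hA a c h (by omega)).trans (hAB c (by omega))
          · exact hAB _ (by omega)
        simp only [hlt, true_and, not_forall, not_not] at this
        obtain ⟨q, hq, hqa⟩ := this
        exact Finset.mem_image.2 ⟨q, hq, hqa⟩
      have hcard : R.card ≤ c := by
        have : R.card = (R.image Prod.snd).card :=
          (Finset.card_image_of_injOn fun p hp q hq h => h4 p hp q hq h).symm
        rw [this]
        have : R.image Prod.snd ⊆ Finset.range c := by
          intro b hb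
          obtain ⟨q, hq, rfl⟩ := Finset.mem_image.1 hb
          exact Finset.mem_range.2 (h1 q hq).2.1
        simpa using Finset.card_le_card this
      have := Finset.card_le_card hsub
      have := Finset.card_image_le (s := R) (f := Prod.fst)
      rw [Finset.card_range] at *
      omega
    obtain ⟨a, ha⟩ := Finset.max_of_nonempty hne
    have haC := Finset.mem_of_max ha
    rw [ha]
    simp only
    rw [hC, Finset.mem_filter, Finset.mem_range] at haC
    obtain ⟨hak, halt, haR⟩ := haC
    refine ⟨fun p hp => ?_, fun b hb => ?_, fun p hp q hq h => ?_, fun p hp q hq h => ?_,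
      fun p hp b hbk hpb hlt => ?_⟩
    · rcases Finset.mem_insert.1 hp with rfl | hp
      · exact ⟨hak, by simp, halt⟩
      · obtain ⟨g1, g2, g3⟩ := h1 p hp
        exact ⟨g1, by omega, g3⟩
    · rcases Nat.lt_succ_iff_lt_or_eq.1 hb with h | rfl
      · obtain ⟨a', ha'⟩ := h2 b h
        exact ⟨a', Finset.mem_insert_of_mem ha'⟩
      · exact ⟨a, Finset.mem_insert_self _ _⟩
    · rcases Finset.mem_insert.1 hp with rfl | hp <;> rcases Finset.mem_insert.1 hq with rfl | hq
      · rfl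
      · exact absurd h.symm (haR q hq)
      · exact absurd h (haR p hp)
      · exact h3 p hp q hq h
    · rcases Finset.mem_insert.1 hp with rfl | hp <;> rcases Finset.mem_insert.1 hq with rfl | hq
      · rfl
      · have := (h1 q hq).2.1
        simp only at h; omega
      · have := (h1 p hp).2.1
        simp only at h; omega
      · exact h4 p hp q hq h
    · rcases Finset.mem_insert.1 hp with rfl | hp
      · simp only at hpb hlt ⊢
        by_contra hno
        have hbC : b ∈ C := by
          rw [hC, Finset.mem_filter, Finset.mem_range]
          refine ⟨hbk, hlt, fun q hq hqb => hno ?_⟩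
          exact ⟨q, Finset.mem_insert_of_mem hq, hqb, (h1 q hq).2.1⟩
        have := Finset.le_max_of_eq hbC ha
        omega
      · obtain ⟨q, hq, g1, g2⟩ := h5 p hp b hbk hpb hlt
        exact ⟨q, Finset.mem_insert_of_mem hq, g1, g2⟩

/-- All `k` columns of row `x + 1` are paired, so there are at least `k` pairs, and injectivity
makes every column of row `x` occur. -/
theorem isNoncrossingMatching_rowPairs {T : Filling} {k x : ℕ}
    (hA : ∀ c c', c < c' → c' < k → T (x, c) < T (x, c'))
    (hAB : ∀ c < k, T (x, c) < T (x + 1, c)) :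
    IsNoncrossingMatching k (fun c => T (x, c)) (fun c => T (x + 1, c)) (rowPairs T k x k) := by
  obtain ⟨h1, h2, h3, h4, h5⟩ := rowPairs_partial hA hAB k le_rfl
  refine ⟨h1, h2, fun a ha => ?_, h3, h4, fun p hp q hq hpq hlt => ?_⟩
  · have hsub : (rowPairs T k x k).image Prod.fst ⊆ Finset.range k := by
      intro b hb
      obtain ⟨q, hq, rfl⟩ := Finset.mem_image.1 hb
      exact Finset.mem_range.2 (h1 q hq).1
    have hsub' : Finset.range k ⊆ (rowPairs T k x k).image Prod.snd := by
      intro b hb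
      obtain ⟨a, ha⟩ := h2 b (Finset.mem_range.1 hb)
      exact Finset.mem_image.2 ⟨_, ha, rfl⟩
    have hcard : ((rowPairs T k x k).image Prod.fst).card = (rowPairs T k x k).card :=
      Finset.card_image_of_injOn fun p hp q hq h => h3 p hp q hq h
    have hcard' := (Finset.card_le_card hsub').trans Finset.card_image_le
    have heq := Finset.eq_of_subset_of_card_le hsub (by omega)
    have : a ∈ (rowPairs T k x k).image Prod.fst := by rw [heq]; exact Finset.mem_range.2 ha
    obtain ⟨q, hq, rfl⟩ := Finset.mem_image.1 this
    exact ⟨q.2, hq⟩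
  · obtain ⟨q', hq', g1, g2⟩ := h5 p hp q.1 (h1 q hq).1 hpq hlt
    rwa [h3 q hq q' hq' g1.symm]

/-- Uniqueness of the noncrossing perfect matching. If `a` is the partner of `c`, a candidate `b >
a` has a partner before `c` by noncrossing, so it is taken already and the greedy rule selects `a`.
-/
theorem IsNoncrossingMatching.rowPairs_eq {T : Filling} {k x : ℕ} {R : Finset (ℕ × ℕ)}
    (h : IsNoncrossingMatching k (fun c => T (x, c)) (fun c => T (x + 1, c)) R) (c : ℕ)
    (hc : c ≤ k) : rowPairs T k x c = R.filter fun p : ℕ × ℕ => p.2 < c := by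
  induction c with
  | zero => simp [rowPairs]
  | succ c ih =>
    rw [rowPairs, ih (by omega)]
    obtain ⟨a, ha⟩ := h.exists_left c (by omega)
    obtain ⟨hak, -, halt⟩ := h.lt _ ha
    have hmax : ((Finset.range k).filter fun a => T (x, a) < T (x + 1, c) ∧
        ∀ q ∈ R.filter (fun p : ℕ × ℕ => p.2 < c), q.1 ≠ a).max = WithBot.some a := by
      refine le_antisymm (Finset.max_le fun b hb => ?_) (Finset.le_max ?_)
      · rw [Finset.mem_filter, Finset.mem_range] at hb
        obtain ⟨hbk, hblt, hb⟩ := hb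
        by_contra hab
        have hab : a < b := by
          by_contra h'
          exact hab (WithBot.coe_le_coe.2 (show b ≤ a by omega))
        obtain ⟨d, hd⟩ := h.exists_right b hbk
        have := h.noncrossing _ ha _ hd hab hblt
        exact hb _ (Finset.mem_filter.2 ⟨hd, this⟩) rfl
      · rw [Finset.mem_filter, Finset.mem_range]
        refine ⟨hak, halt, fun q hq hqa => ?_⟩
        rw [Finset.mem_filter] at hq
        have := h.inj_left q hq.1 _ ha hqa
        rw [this] at hq
        exact lt_irrefl _ hq.2
    rw [hmax]
    change insert (a, c) _ = _
    ext p
    simp only [Finset.mem_insert, Finset.mem_filter]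
    constructor
    · rintro (rfl | ⟨h1, h2⟩)
      · exact ⟨ha, by simp⟩
      · exact ⟨h1, by omega⟩
    · rintro ⟨h1, h2⟩
      rcases Nat.lt_succ_iff_lt_or_eq.1 h2 with h3 | h3
      · exact Or.inr ⟨h1, h3⟩
      · exact Or.inl (h.inj_right p h1 _ ha h3)

/-- The mirror image of an arc, with the complementary color. -/
def ColoredArc.mirror (n N : ℕ) (a : ColoredArc) : ColoredArc :=
  ⟨(N : ℤ) + 1 - a.term, (N : ℤ) + 1 - a.init, n - a.color⟩

theorem IsRectSYT.isNoncrossingMatching {n k : ℕ} {T : Filling} (hT : IsRectSYT n k T) {x : ℕ}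
    (hx : x + 1 < n) :
    IsNoncrossingMatching k (fun c => T (x, c)) (fun c => T (x + 1, c)) (rowPairs T k x k) :=
  isNoncrossingMatching_rowPairs (fun c c' h h' => hT.row_lt x c c' (by omega) h h')
    fun c h => hT.col_lt x (x + 1) c (by omega) hx h

/-- Rotation sends the rows `x`, `x + 1` to `n - 1 - x`, `n - 2 - x` and reverses the order of the
entries, so starts and ends of arcs change places. The rotated pairs are again a noncrossing perfect
matching, and by uniqueness they are the greedy one. -/
theorem IsRectSYT.rowPairs_evacuation {n k : ℕ} {T : Filling} (hT : IsRectSYT n k T) {x : ℕ}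
    (hx : x + 1 < n) : rowPairs (_root_.evacuation n k T) k (n - 2 - x) k =
      (rowPairs T k x k).image fun p => (k - 1 - p.2, k - 1 - p.1) := by
  have h := hT.isNoncrossingMatching hx
  have hE1 : ∀ a < k, _root_.evacuation n k T (n - 2 - x, a) =
      ((n * k : ℕ) : ℤ) + 1 - T (x + 1, k - 1 - a) := fun a ha => by
    rw [hT.evacuation_apply (by omega) ha, show n - 1 - (n - 2 - x) = x + 1 by omega]
  have hE2 : ∀ a < k, _root_.evacuation n k T (n - 2 - x + 1, a) =
      ((n * k : ℕ) : ℤ) + 1 - T (x, k - 1 - a) := fun a ha => by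
    rw [hT.evacuation_apply (by omega) ha, show n - 1 - (n - 2 - x + 1) = x by omega]
  have hR : IsNoncrossingMatching k (fun c => _root_.evacuation n k T (n - 2 - x, c))
      (fun c => _root_.evacuation n k T (n - 2 - x + 1, c))
      ((rowPairs T k x k).image fun p => (k - 1 - p.2, k - 1 - p.1)) := by
    refine ⟨?_, ?_, ?_, ?_, ?_, ?_⟩
    all_goals simp only [Finset.mem_image]
    · rintro _ ⟨p, hp, rfl⟩
      obtain ⟨h1, h2, h3⟩ := h.lt p hp
      refine ⟨by simp; omega, by simp; omega, ?_⟩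
      simp only
      rw [hE1 _ (by omega), hE2 _ (by omega), show k - 1 - (k - 1 - p.2) = p.2 by omega,
        show k - 1 - (k - 1 - p.1) = p.1 by omega]
      omega
    · intro c hc
      obtain ⟨b, hb⟩ := h.exists_right (k - 1 - c) (by omega)
      refine ⟨k - 1 - b, _, hb, ?_⟩
      simp only [Prod.ext_iff, true_and]; omega
    · intro c hc
      obtain ⟨b, hb⟩ := h.exists_left (k - 1 - c) (by omega)
      refine ⟨k - 1 - b, _, hb, ?_⟩
      simp only [Prod.ext_iff, and_true]; omega
    · rintro _ ⟨p, hp, rfl⟩ _ ⟨q, hq, rfl⟩ he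
      have h1 := h.lt p hp
      have h2 := h.lt q hq
      rw [h.inj_right p hp q hq (by simp only at he; omega)]
    · rintro _ ⟨p, hp, rfl⟩ _ ⟨q, hq, rfl⟩ he
      have h1 := h.lt p hp
      have h2 := h.lt q hq
      rw [h.inj_left p hp q hq (by simp only at he; omega)]
    · rintro _ ⟨p, hp, rfl⟩ _ ⟨q, hq, rfl⟩ he hlt
      have h1 := h.lt p hp
      have h2 := h.lt q hq
      simp only at he hlt ⊢
      rw [hE1 _ (by omega), hE2 _ (by omega), show k - 1 - (k - 1 - q.2) = q.2 by omega,
        show k - 1 - (k - 1 - p.1) = p.1 by omega] at hlt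
      have hne : p.1 ≠ q.1 := fun hpq => by
        rw [h.inj_left p hp q hq hpq] at he; omega
      by_contra hcon
      have := h.noncrossing q hq p hp (by omega)
        (show T (x, p.1) < T (x + 1, q.2) by omega)
      omega
  rw [hR.rowPairs_eq k le_rfl, Finset.filter_eq_self]
  exact fun p hp => (hR.lt p hp).2.1

theorem IsRectSYT.mirror_mem_evacuation {n k : ℕ} {T : Filling} (hT : IsRectSYT n k T)
    {a : ColoredArc} (ha : a ∈ tableauMatching n k T) :
    a.mirror n (n * k) ∈ tableauMatching n k (_root_.evacuation n k T) := by
  obtain ⟨x, hx, p, hp, rfl⟩ := ha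
  obtain ⟨h1, h2, -⟩ := (hT.isNoncrossingMatching hx).lt p hp
  -- Row index `n - 2 - x` means color `n - 1 - x`, the complement of the color `x + 1`.
  refine ⟨n - 2 - x, by omega, (k - 1 - p.2, k - 1 - p.1), ?_, ?_⟩
  · rw [hT.rowPairs_evacuation hx]
    exact Finset.mem_image_of_mem _ hp
  · rw [hT.evacuation_apply (by omega) (by simp; omega), hT.evacuation_apply (by omega) (by simp; omega)]
    simp only [ColoredArc.mirror, ColoredArc.mk.injEq]
    rw [show n - 1 - (n - 2 - x) = x + 1 by omega, show n - 1 - (n - 2 - x + 1) = x by omega,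
      show k - 1 - (k - 1 - p.2) = p.2 by omega, show k - 1 - (k - 1 - p.1) = p.1 by omega]
    exact ⟨rfl, rfl, by omega⟩

theorem IsRectSYT.tableauMatching_evacuation {n k : ℕ} {T : Filling} (hT : IsRectSYT n k T) :
    tableauMatching n k (_root_.evacuation n k T) =
      ColoredArc.mirror n (n * k) '' tableauMatching n k T := by
  refine Set.Subset.antisymm ?_ ?_
  · rintro _ ⟨y, hy, q, hq, rfl⟩
    obtain ⟨x, hx, rfl⟩ : ∃ x, x + 1 < n ∧ y = n - 2 - x := ⟨n - 2 - y, by omega, by omega⟩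
    have hq' := hq
    rw [hT.rowPairs_evacuation hx, Finset.mem_image] at hq
    obtain ⟨p, hp, rfl⟩ := hq
    obtain ⟨h1, h2, -⟩ := (hT.isNoncrossingMatching hx).lt p hp
    refine ⟨⟨T (x, p.1), T (x + 1, p.2), x + 1⟩, ⟨x, hx, p, hp, rfl⟩, ?_⟩
    rw [hT.evacuation_apply (by omega) (by simp; omega), hT.evacuation_apply (by omega) (by simp; omega)]
    simp only [ColoredArc.mirror, ColoredArc.mk.injEq]
    rw [show n - 1 - (n - 2 - x) = x + 1 by omega, show n - 1 - (n - 2 - x + 1) = x by omega,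
      show k - 1 - (k - 1 - p.2) = p.2 by omega, show k - 1 - (k - 1 - p.1) = p.1 by omega]
    exact ⟨rfl, rfl, by omega⟩
  · rintro _ ⟨a, ha, rfl⟩
    exact hT.mirror_mem_evacuation ha

/-- The properties of the multicolored matching of a rectangular tableau in which the entry `j`
lies in row `row j`. -/
structure IsTableauMatching (n N : ℕ) (row : ℤ → ℕ) (M : Set ColoredArc) : Prop where
  one_le_init : ∀ a ∈ M, 1 ≤ a.init
  init_lt_term : ∀ a ∈ M, a.init < a.term
  term_le : ∀ a ∈ M, a.term ≤ N
  row_init : ∀ a ∈ M, row a.init + 1 = a.color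
  row_term : ∀ a ∈ M, row a.term = a.color
  row_lt : ∀ j : ℤ, 1 ≤ j → j ≤ N → row j < n
  init_inj : ∀ a ∈ M, ∀ b ∈ M, a.init = b.init → a = b
  term_inj : ∀ a ∈ M, ∀ b ∈ M, a.term = b.term → a = b
  exists_init : ∀ j : ℤ, 1 ≤ j → j ≤ N → row j + 1 < n → ∃ a ∈ M, a.init = j
  exists_term : ∀ j : ℤ, 1 ≤ j → j ≤ N → 0 < row j → ∃ a ∈ M, a.term = j
  color_ne : ∀ a ∈ M, ∀ b ∈ M, a.Crosses b → a.color ≠ b.color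

theorem IsRectSYT.isTableauMatching {n k : ℕ} {T : Filling} (hT : IsRectSYT n k T) :
    IsTableauMatching n (n * k) (fun j => (entryCell n k T j).1) (tableauMatching n k T) := by
  have hrow : ∀ r c, r < n → c < k → (entryCell n k T (T (r, c))).1 = r := fun r c hr hc => by
    rw [hT.entryCell_apply (p := (r, c)) hr hc]
  have hinj : ∀ r c r' c', r < n → c < k → r' < n → c' < k → T (r, c) = T (r', c') →
      r = r' ∧ c = c' := by
    intro r c r' c' hr hc hr' hc' he
    have := hT.bijOn.injOn (show (r, c) ∈ _ from ⟨hr, hc⟩) (show (r', c') ∈ _ from ⟨hr', hc'⟩) he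
    simpa [Prod.ext_iff] using this
  refine ⟨?_, ?_, ?_, ?_, ?_, fun j h1 h2 => (hT.entryCell_spec h1 h2).1.1, ?_, ?_, ?_, ?_, ?_⟩
  · rintro _ ⟨x, hx, p, hp, rfl⟩
    obtain ⟨h1, h2, -⟩ := (hT.isNoncrossingMatching hx).lt p hp
    exact (hT.one_le (p := (x, p.1)) (by simp; omega) h1).1
  · rintro _ ⟨x, hx, p, hp, rfl⟩
    exact ((hT.isNoncrossingMatching hx).lt p hp).2.2
  · rintro _ ⟨x, hx, p, hp, rfl⟩
    obtain ⟨h1, h2, -⟩ := (hT.isNoncrossingMatching hx).lt p hp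
    exact (hT.one_le (p := (x + 1, p.2)) hx h2).2
  · rintro _ ⟨x, hx, p, hp, rfl⟩
    obtain ⟨h1, h2, -⟩ := (hT.isNoncrossingMatching hx).lt p hp
    simp only
    rw [hrow _ _ (by omega) h1]
  · rintro _ ⟨x, hx, p, hp, rfl⟩
    obtain ⟨h1, h2, -⟩ := (hT.isNoncrossingMatching hx).lt p hp
    simp only
    rw [hrow _ _ hx h2]
  · rintro _ ⟨x, hx, p, hp, rfl⟩ _ ⟨y, hy, q, hq, rfl⟩ he
    obtain ⟨h1, h2, -⟩ := (hT.isNoncrossingMatching hx).lt p hp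
    obtain ⟨g1, g2, -⟩ := (hT.isNoncrossingMatching hy).lt q hq
    obtain ⟨rfl, h3⟩ := hinj _ _ _ _ (by omega) h1 (by omega) g1 he
    rw [(hT.isNoncrossingMatching hx).inj_left p hp q hq h3]
  · rintro _ ⟨x, hx, p, hp, rfl⟩ _ ⟨y, hy, q, hq, rfl⟩ he
    obtain ⟨h1, h2, -⟩ := (hT.isNoncrossingMatching hx).lt p hp
    obtain ⟨g1, g2, -⟩ := (hT.isNoncrossingMatching hy).lt q hq
    obtain ⟨hxy, h3⟩ := hinj _ _ _ _ hx h2 hy g2 he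
    obtain rfl : x = y := by omega
    rw [(hT.isNoncrossingMatching hx).inj_right p hp q hq h3]
  · intro j h1 h2 h3
    obtain ⟨⟨h4, h5⟩, h6⟩ := hT.entryCell_spec h1 h2
    obtain ⟨c, hc⟩ := (hT.isNoncrossingMatching h3).exists_right _ h5
    exact ⟨_, ⟨_, h3, _, hc, rfl⟩, h6⟩
  · intro j h1 h2 h3
    obtain ⟨⟨h4, h5⟩, h6⟩ := hT.entryCell_spec h1 h2
    obtain ⟨x, hx⟩ : ∃ x, (entryCell n k T j).1 = x + 1 := ⟨_, (Nat.succ_pred_eq_of_pos h3).symm⟩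
    obtain ⟨a, ha⟩ := (hT.isNoncrossingMatching (x := x) (by omega)).exists_left _ h5
    refine ⟨_, ⟨x, by omega, _, ha, rfl⟩, ?_⟩
    simp only
    rw [← hx]; exact h6
  -- Crossing arcs of one color would belong to the same noncrossing matching, which puts the end of
  -- `q` before that of `p`.
  · rintro _ ⟨x, hx, p, hp, rfl⟩ _ ⟨y, hy, q, hq, rfl⟩ ⟨h1, h2, h3⟩ he
    simp only at h1 h2 h3 he
    obtain rfl : x = y := by omega
    have hm := hT.isNoncrossingMatching hx
    obtain ⟨g1, g2, -⟩ := hm.lt p hp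
    obtain ⟨g3, g4, -⟩ := hm.lt q hq
    have hpq : p.1 < q.1 := by
      rcases lt_trichotomy p.1 q.1 with h | h | h
      · exact h
      · rw [h] at h1; omega
      · have := hT.row_lt x _ _ (by omega) h g1; omega
    have := hm.noncrossing p hp q hq hpq h2
    have := hT.row_lt (x + 1) _ _ hx this g2
    omega

/-! ### The usual form of a web -/

/-- The edge directed and weighted by the usual conventions. -/
def PlaneEdge.usual (n : ℕ) (e : PlaneEdge) : PlaneEdge :=
  if e.weight = 1 then e
  else if e.weight + 1 = n then e.flip n
  else ⟨e.curve, e.ends.forget, e.weight⟩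

/-- The web directed and weighted by the usual conventions. -/
def PlaneWeb.usual (n : ℕ) (w : PlaneWeb) : PlaneWeb :=
  ⟨w.boundary, w.interior, PlaneEdge.usual n '' w.edges⟩

/-- For `n = 4`, forget the direction of an edge of weight `2`. -/
def PlaneEdge.forgetMiddle (n : ℕ) (e : PlaneEdge) : PlaneEdge :=
  if n = 4 ∧ e.weight = 2 then ⟨e.curve, e.ends.forget, e.weight⟩ else e

theorem PlaneWeb.forgetMiddle_edges (n : ℕ) (w : PlaneWeb) :
    (w.forgetMiddle n).edges = PlaneEdge.forgetMiddle n '' w.edges := rfl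

theorem EdgeEnds.forget_reverse (d : EdgeEnds) : d.reverse.forget = d.forget := by
  cases d with
  | directed a b => simp [EdgeEnds.reverse, EdgeEnds.forget, Sym2.eq_swap]
  | undirected z => rfl

theorem EdgeEnds.reverse_reverse (d : EdgeEnds) : d.reverse.reverse = d := by
  cases d <;> rfl

@[simp] theorem EdgeEnds.has_reverse (d : EdgeEnds) (v : ℝ × ℝ) : d.reverse.Has v ↔ d.Has v := by
  cases d with
  | directed a b => exact or_comm
  | undirected z => rfl

@[simp] theorem EdgeEnds.has_forget (d : EdgeEnds) (v : ℝ × ℝ) : d.forget.Has v ↔ d.Has v := by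
  cases d with
  | directed a b => simp [EdgeEnds.forget, EdgeEnds.Has]
  | undirected z => rfl

theorem PlaneEdge.has_usual (n : ℕ) (e : PlaneEdge) (v : ℝ × ℝ) :
    (e.usual n).ends.Has v ↔ e.ends.Has v := by
  unfold PlaneEdge.usual
  split_ifs <;> simp [PlaneEdge.flip]

theorem PlaneEdge.has_forgetMiddle (n : ℕ) (e : PlaneEdge) (v : ℝ × ℝ) :
    (e.forgetMiddle n).ends.Has v ↔ e.ends.Has v := by
  unfold PlaneEdge.forgetMiddle
  split_ifs <;> simp

theorem PlaneEdge.weight_forgetMiddle (n : ℕ) (e : PlaneEdge) :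
    (e.forgetMiddle n).weight = e.weight := by
  unfold PlaneEdge.forgetMiddle
  split_ifs <;> rfl

/-- A flip exchanges the weights `1` and `n - 1`, of which the usual form keeps the variant of
weight `1`. The weight `2` for `n = 4` is fixed by a flip, and there the direction is forgotten.
This invariance absorbs all flips that the reflection causes. -/
theorem PlaneEdge.usual_flip {n : ℕ} (hn : n = 3 ∨ n = 4) {e : PlaneEdge} (h1 : 1 ≤ e.weight)
    (h2 : e.weight < n) : (e.flip n).usual n = e.usual n := by
  obtain ⟨c, d, w⟩ := e
  simp only at h1 h2
  rcases hn with rfl | rfl <;> interval_cases w <;>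
    simp [PlaneEdge.usual, PlaneEdge.flip, EdgeEnds.reverse_reverse, EdgeEnds.forget_reverse]

theorem PlaneEdge.forgetMiddle_eq_usual {n : ℕ} (hn : n = 3 ∨ n = 4) {e : PlaneEdge}
    (h : e.weight = 1 ∨ n = 4 ∧ e.weight = 2) : e.forgetMiddle n = e.usual n := by
  rcases hn with rfl | rfl <;> rcases h with h | ⟨h', h⟩ <;>
    simp_all [PlaneEdge.usual, PlaneEdge.forgetMiddle]

theorem PlaneWeb.exists_flip_eq_usual {n : ℕ} (hn : n = 3 ∨ n = 4) {w : PlaneWeb}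
    (hw : ∀ e ∈ w.edges, 1 ≤ e.weight ∧ e.weight < n) :
    ∃ S ⊆ w.edges, w.usual n = (w.flip n S).forgetMiddle n := by
  -- Flipping the edges of weight `n - 1` leaves only weights `1` and, for `n = 4`, weight `2`.
  refine ⟨{e ∈ w.edges | e.weight + 1 = n}, fun e he => he.1, ?_⟩
  refine PlaneWeb.ext rfl rfl ?_
  rw [PlaneWeb.forgetMiddle_edges]
  change PlaneEdge.usual n '' w.edges = PlaneEdge.forgetMiddle n ''
    ((w.edges \ {e ∈ w.edges | e.weight + 1 = n}) ∪
      PlaneEdge.flip n '' {e ∈ w.edges | e.weight + 1 = n})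
  have h1 : ∀ e ∈ w.edges, e.weight + 1 = n → (e.flip n).forgetMiddle n = e.usual n := by
    intro e he hen
    obtain ⟨g1, g2⟩ := hw e he
    rw [PlaneEdge.forgetMiddle_eq_usual hn, PlaneEdge.usual_flip hn g1 g2]
    left; change n - e.weight = 1; omega
  have h2 : ∀ e ∈ w.edges, e.weight + 1 ≠ n → e.forgetMiddle n = e.usual n := by
    intro e he hen
    obtain ⟨g1, g2⟩ := hw e he
    refine PlaneEdge.forgetMiddle_eq_usual hn ?_
    omega
  ext f
  constructor
  · rintro ⟨e, he, rfl⟩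
    by_cases hen : e.weight + 1 = n
    · exact ⟨e.flip n, Or.inr ⟨e, ⟨he, hen⟩, rfl⟩, h1 e he hen⟩
    · exact ⟨e, Or.inl ⟨he, fun h => hen h.2⟩, h2 e he hen⟩
  · rintro ⟨_, ⟨he, hen⟩ | ⟨e, ⟨he, hen⟩, rfl⟩, rfl⟩
    · exact ⟨_, he, (h2 _ he fun h => hen ⟨he, h⟩).symm⟩
    · exact ⟨e, he, (h1 e he hen).symm⟩

/-- For `n = 4` two edges of weight `1` and one of weight `2` exhaust the three edges at an interior
vertex, so no other weight occurs there. Knowing the weight decides whether an edge had to be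
flipped. -/
theorem UsualConventions.weight_eq {n : ℕ} (hn : n = 3 ∨ n = 4) {W : PlaneWeb}
    (h : UsualConventions n W) {e : PlaneEdge} (he : e ∈ W.edges) {v : ℝ × ℝ}
    (hv : v ∈ W.boundary ∪ W.interior) (hev : e.ends.Has v) :
    e.weight = 1 ∨ n = 4 ∧ e.weight = 2 := by
  rcases hv with hv | hv
  · obtain ⟨f, h1, h2, -⟩ := h.boundary_source v hv
    have : e ∈ W.incident v := ⟨he, hev⟩
    rw [h1] at this
    rw [show e = f from this]
    exact Or.inl h2
  · rcases hn with rfl | rfl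
    · exact Or.inl (h.weights_three rfl v hv e ⟨he, hev⟩)
    · have h3 := h.trivalent v hv
      obtain ⟨h1, h2⟩ := h.weights_four rfl v hv
      by_contra hcon
      push Not at hcon
      -- `Set.ncard` is `0` on infinite sets, so trivalence includes finiteness.
      have hfin : (W.incident v).Finite := Set.finite_of_ncard_pos (by omega)
      have hdis : Disjoint {e | e ∈ W.incident v ∧ e.weight = 1} {e | e ∈ W.incident v ∧ e.weight = 2} := by
        rw [Set.disjoint_left]
        rintro x ⟨-, hx⟩ ⟨-, hx'⟩
        omega
      have hu := Set.ncard_union_eq hdis (hfin.subset fun x hx => hx.1) (hfin.subset fun x hx => hx.1)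
      have hlt : ({e | e ∈ W.incident v ∧ e.weight = 1} ∪ {e | e ∈ W.incident v ∧ e.weight = 2}).ncard <
          (W.incident v).ncard := by
        refine Set.ncard_lt_ncard ?_ hfin
        refine Set.ssubset_iff_subset_ne.2 ⟨?_, fun heq => ?_⟩
        · rintro x (hx | hx)
          · exact hx.1
          · exact hx.1
        · have hmem : e ∈ W.incident v := ⟨he, hev⟩
          rw [← heq] at hmem
          rcases hmem with hx | hx
          · exact hcon.1 hx.2
          · exact hcon.2 rfl hx.2
      omega

/-- A usual form of a web is the one in which each edge has been changed as its weight
demands. -/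
theorem IsUsualForm.eq_usual {n : ℕ} (hn : n = 3 ∨ n = 4) {w W : PlaneWeb}
    (hw : ∀ e ∈ w.edges, 1 ≤ e.weight ∧ e.weight < n)
    (hends : ∀ e ∈ w.edges, ∃ v ∈ w.boundary ∪ w.interior, e.ends.Has v)
    (h : IsUsualForm n w W) : W = w.usual n := by
  obtain ⟨⟨S, hS, rfl⟩, hconv⟩ := h
  refine PlaneWeb.ext rfl rfl ?_
  have hedges : ((w.flip n S).forgetMiddle n).edges =
    PlaneEdge.forgetMiddle n '' ((w.edges \ S) ∪ PlaneEdge.flip n '' S) := rfl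
  have h1 : ∀ e ∈ w.edges, e ∉ S → e.forgetMiddle n = e.usual n := by
    intro e he heS
    obtain ⟨v, hv, hev⟩ := hends e he
    refine PlaneEdge.forgetMiddle_eq_usual hn ?_
    have := hconv.weight_eq hn (e := e.forgetMiddle n) (by
      rw [hedges]; exact ⟨e, Or.inl ⟨he, heS⟩, rfl⟩) hv ((PlaneEdge.has_forgetMiddle n e v).2 hev)
    rwa [PlaneEdge.weight_forgetMiddle] at this
  have h2 : ∀ e ∈ S, (e.flip n).forgetMiddle n = e.usual n := by
    intro e heS
    obtain ⟨v, hv, hev⟩ := hends e (hS heS)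
    obtain ⟨g1, g2⟩ := hw e (hS heS)
    rw [← PlaneEdge.usual_flip hn g1 g2]
    refine PlaneEdge.forgetMiddle_eq_usual hn ?_
    have := hconv.weight_eq hn (e := (e.flip n).forgetMiddle n) (by
      rw [hedges]; exact ⟨e.flip n, Or.inr ⟨e, heS, rfl⟩, rfl⟩) hv
      ((PlaneEdge.has_forgetMiddle n _ v).2 ((EdgeEnds.has_reverse _ v).2 hev))
    rwa [PlaneEdge.weight_forgetMiddle] at this
  rw [hedges]
  change _ = PlaneEdge.usual n '' w.edges
  ext f
  constructor
  · rintro ⟨_, ⟨he, hen⟩ | ⟨e, he, rfl⟩, rfl⟩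
    · exact ⟨_, he, (h1 _ he hen).symm⟩
    · exact ⟨e, hS he, (h2 e he).symm⟩
  · rintro ⟨e, he, rfl⟩
    by_cases heS : e ∈ S
    · exact ⟨e.flip n, Or.inr ⟨e, heS, rfl⟩, h2 e heS⟩
    · exact ⟨e, Or.inl ⟨he, heS⟩, h1 e he heS⟩

/-! ### The conventions at a trivalent vertex -/

theorem ncard_weight_four {f₁ f₂ f₃ : PlaneEdge} (h12 : f₁ ≠ f₂) (h13 : f₁ ≠ f₃) (h23 : f₂ ≠ f₃)
    (h : (f₁.weight = 1 ∧ f₂.weight = 1 ∧ f₃.weight = 2) ∨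
      (f₁.weight = 1 ∧ f₂.weight = 2 ∧ f₃.weight = 1) ∨
      (f₁.weight = 2 ∧ f₂.weight = 1 ∧ f₃.weight = 1)) :
    {e | e ∈ ({f₁, f₂, f₃} : Set PlaneEdge) ∧ e.weight = 1}.ncard = 2 ∧
    {e | e ∈ ({f₁, f₂, f₃} : Set PlaneEdge) ∧ e.weight = 2}.ncard = 1 := by
  have key : ∀ g₁ g₂ g₃ : PlaneEdge, g₁ ≠ g₂ → g₁.weight = 1 → g₂.weight = 1 → g₃.weight = 2 →
      {e | e ∈ ({g₁, g₂, g₃} : Set PlaneEdge) ∧ e.weight = 1}.ncard = 2 ∧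
      {e | e ∈ ({g₁, g₂, g₃} : Set PlaneEdge) ∧ e.weight = 2}.ncard = 1 := by
    intro g₁ g₂ g₃ hne h1 h2 h3
    have e1 : {e | e ∈ ({g₁, g₂, g₃} : Set PlaneEdge) ∧ e.weight = 1} = {g₁, g₂} := by
      ext e
      constructor
      · rintro ⟨rfl | rfl | rfl, he⟩
        · exact Or.inl rfl
        · exact Or.inr rfl
        · omega
      · rintro (rfl | rfl)
        · exact ⟨Or.inl rfl, h1⟩
        · exact ⟨Or.inr (Or.inl rfl), h2⟩
    have e2 : {e | e ∈ ({g₁, g₂, g₃} : Set PlaneEdge) ∧ e.weight = 2} = {g₃} := by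
      ext e
      constructor
      · rintro ⟨rfl | rfl | rfl, he⟩
        · omega
        · omega
        · rfl
      · rintro rfl
        exact ⟨Or.inr (Or.inr rfl), h3⟩
    rw [e1, e2]
    exact ⟨Set.ncard_pair hne, Set.ncard_singleton _⟩
  rcases h with ⟨h1, h2, h3⟩ | ⟨h1, h2, h3⟩ | ⟨h1, h2, h3⟩
  · exact key _ _ _ h12 h1 h2 h3
  · rw [show ({f₁, f₂, f₃} : Set PlaneEdge) = {f₁, f₃, f₂} by rw [Set.pair_comm]]
    exact key _ _ _ h13 h1 h3 h2
  · rw [show ({f₁, f₂, f₃} : Set PlaneEdge) = {f₂, f₃, f₁} by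
      ext e; simp only [Set.mem_insert_iff, Set.mem_singleton_iff]; tauto]
    exact key _ _ _ h23 h2 h3 h1

/-- The edges at an interior vertex `v`: one arrives with weight `x`, one leaves with weight `y`,
and the third one balances the weights. -/
theorem usual_trivalent {n : ℕ} (hn : n = 3 ∨ n = 4) {e₁ e₂ e₃ : PlaneEdge} {l r u v : ℝ × ℝ}
    {x y : ℕ} (hx : 1 ≤ x) (hxn : x < n) (hy : 1 ≤ y) (hyn : y < n) (hxy : x ≠ y)
    (h₁ : e₁.ends = .directed l v) (h₂ : e₂.ends = .directed v r)
    (h₃ : e₃.ends = if x < y then .directed u v else .directed v u)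
    (w₁ : e₁.weight = x) (w₂ : e₂.weight = y) (w₃ : e₃.weight = if x < y then y - x else x - y)
    (hlv : l ≠ v) (hrv : r ≠ v) (hlr : l ≠ r) (hlu : l ≠ u) (hru : r ≠ u) {I : Set PlaneEdge}
    (hI : I = {e₁.usual n, e₂.usual n, e₃.usual n}) :
    I.ncard = 3 ∧ (n = 3 → ∀ e ∈ I, e.weight = 1) ∧
    (n = 4 → {e | e ∈ I ∧ e.weight = 1}.ncard = 2 ∧ {e | e ∈ I ∧ e.weight = 2}.ncard = 1) ∧
    ((∀ e ∈ I, e.weight = 1 → ∃ u, e.ends = .directed v u) ∨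
      (∀ e ∈ I, e.weight = 1 → ∃ u, e.ends = .directed u v)) := by
  -- The usual form keeps the ends of an edge, so the points `l` and `r` suffice to tell the three
  -- edges apart.
  have hne : ∀ {f g : PlaneEdge} {z : ℝ × ℝ}, f.ends.Has z → ¬g.ends.Has z →
      f.usual n ≠ g.usual n := by
    intro f g z hf hg he
    rw [← PlaneEdge.has_usual n, he, PlaneEdge.has_usual] at hf
    exact hg hf
  have h12 : e₁.usual n ≠ e₂.usual n := hne (z := l) (by rw [h₁]; exact Or.inl rfl) (by
    rw [h₂]; rintro (h | h)
    · exact hlv h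
    · exact hlr h)
  have h13 : e₁.usual n ≠ e₃.usual n := hne (z := l) (by rw [h₁]; exact Or.inl rfl) (by
    rw [h₃]; split_ifs
    · rintro (h | h)
      · exact hlu h
      · exact hlv h
    · rintro (h | h)
      · exact hlv h
      · exact hlu h)
  have h23 : e₂.usual n ≠ e₃.usual n := hne (z := r) (by rw [h₂]; exact Or.inr rfl) (by
    rw [h₃]; split_ifs
    · rintro (h | h)
      · exact hru h
      · exact hrv h
    · rintro (h | h)
      · exact hrv h
      · exact hru h)
  subst hI
  obtain ⟨c₁, d₁, m₁⟩ := e₁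
  obtain ⟨c₂, d₂, m₂⟩ := e₂
  obtain ⟨c₃, d₃, m₃⟩ := e₃
  simp only at h₁ h₂ h₃ w₁ w₂ w₃
  subst h₁ h₂ h₃ w₁ w₂ w₃
  refine ⟨Set.ncard_eq_three.2 ⟨_, _, _, h12, h13, h23, rfl⟩, ?_, fun h4 => ?_, ?_⟩
  · rintro rfl
    interval_cases m₁ <;> interval_cases m₂ <;>
      simp_all [PlaneEdge.usual, PlaneEdge.flip]
  · subst h4
    refine ncard_weight_four h12 h13 h23 ?_
    interval_cases m₁ <;> interval_cases m₂ <;>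
      simp_all [PlaneEdge.usual, PlaneEdge.flip]
  · clear hne h12 h13 h23
    rcases hn with rfl | rfl <;> interval_cases m₁ <;> interval_cases m₂ <;>
      simp_all [PlaneEdge.usual, PlaneEdge.flip, EdgeEnds.reverse, EdgeEnds.forget, -Prod.exists]

theorem PlaneEdge.usual_eq_undirected {e : PlaneEdge} (h1 : 1 ≤ e.weight) (h2 : e.weight < 4)
    (h : (e.usual 4).weight = 2) : ∃ z, (e.usual 4).ends = .undirected z := by
  obtain ⟨c, d, w⟩ := e
  simp only at h1 h2
  interval_cases w
  · simp [PlaneEdge.usual] at h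
  · cases d with
    | directed a b => exact ⟨s(a, b), by simp [PlaneEdge.usual, EdgeEnds.forget]⟩
    | undirected z => exact ⟨z, by simp [PlaneEdge.usual, EdgeEnds.forget]⟩
  · simp [PlaneEdge.usual, PlaneEdge.flip] at h

/-! ### The vertices of the web of a matching -/

/-- The vertices of the web of a matching: boundary vertices, vertices of the `Y`s, and the upper
and lower vertices of the dumbbells. -/
inductive WebVertex where
  | bd (j : ℤ) : WebVertex
  | y (j : ℤ) : WebVertex
  | top (u v : ℤ) : WebVertex
  | bot (u v : ℤ) : WebVertex

/-- The vertices that are used: in the crossing points the arguments are increasing. -/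
def WebVertex.Valid : WebVertex → Prop
  | .top u v => u < v
  | .bot u v => u < v
  | _ => True

noncomputable def WebVertex.point (m ε : ℝ) : WebVertex → ℝ × ℝ
  | .bd j => boundaryVertex j
  | .y j => yVertex ε j
  | .top u v => dumbbellTop m ε u v
  | .bot u v => dumbbellBot m ε u v

/-- If `d ≠ 0`, then `|m * d| ≥ m > 2 * ε ≥ |s * ε|`. This is where the bound `ε < m / 2` enters. -/
theorem eq_zero_of_mul_eq {m ε : ℝ} {d s : ℤ} (hε : 0 < ε) (hεm : ε < m / 2) (hs : |s| ≤ 2)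
    (h : m * d = s * ε) : d = 0 ∧ s = 0 := by
  have hm : 0 < m := by linarith
  have hd : d = 0 := by
    by_contra hd
    have h1 : (1 : ℝ) ≤ |(d : ℝ)| := by exact_mod_cast Int.one_le_abs hd
    have h2 : |(s : ℝ)| ≤ 2 := by exact_mod_cast hs
    have h3 : |m * d| = |s * ε| := by rw [h]
    rw [abs_mul, abs_mul, abs_of_pos hm, abs_of_pos hε] at h3
    nlinarith
  refine ⟨hd, ?_⟩
  rw [hd] at h
  simp only [Int.cast_zero, mul_zero] at h
  rcases mul_eq_zero.1 h.symm with h | h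
  · exact_mod_cast h
  · linarith

namespace WebVertex

/-- Twice the abscissa of a vertex. -/
def abscissa : WebVertex → ℤ
  | .bd j => 2 * j
  | .y j => 2 * j
  | .top u v => u + v
  | .bot u v => u + v

/-- The height of a vertex in units of `m / 2`, up to a multiple of `ε`. -/
def level : WebVertex → ℤ
  | .bd _ => 0
  | .y _ => 0
  | .top u v => v - u
  | .bot u v => v - u

/-- The multiple of `ε` in the height of a vertex. -/
def shift : WebVertex → ℤ
  | .bd _ => 0
  | .y _ => 1
  | .top _ _ => 1
  | .bot _ _ => -1

theorem point_fst (m ε : ℝ) (α : WebVertex) : (α.point m ε).1 = (α.abscissa : ℝ) / 2 := by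
  cases α <;> simp [point, abscissa, boundaryVertex, yVertex, dumbbellTop, dumbbellBot, legPoint]

theorem point_snd (m ε : ℝ) (α : WebVertex) :
    (α.point m ε).2 = m * α.level / 2 + α.shift * ε := by
  cases α <;> simp [point, level, shift, boundaryVertex, yVertex, dumbbellTop, dumbbellBot,
    legPoint, sub_eq_add_neg]

/-- Abscissa and level have the same parity, so vertices with the same abscissa differ in height by
an integer multiple of `m` plus at most two shifts by `ε`; both contributions must vanish
separately. `Valid` is needed because `top j j` would be drawn at the point of `y j`. -/
theorem point_injOn {m ε : ℝ} (hε : 0 < ε) (hεm : ε < m / 2) {α β : WebVertex} (hα : α.Valid)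
    (hβ : β.Valid) (h : α.point m ε = β.point m ε) : α = β := by
  have h1 : α.abscissa = β.abscissa := by
    have := congrArg Prod.fst h
    rw [point_fst, point_fst] at this
    have : (α.abscissa : ℝ) = β.abscissa := by linarith
    exact_mod_cast this
  have hpar : ∀ γ : WebVertex, ∃ d, γ.abscissa - γ.level = 2 * d := by
    intro γ
    cases γ with
    | bd j => exact ⟨j, by simp [abscissa, level]⟩
    | y j => exact ⟨j, by simp [abscissa, level]⟩
    | top u v => exact ⟨u, by simp [abscissa, level]; ring⟩
    | bot u v => exact ⟨u, by simp [abscissa, level]; ring⟩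
  obtain ⟨d, hd⟩ := hpar α
  obtain ⟨d', hd'⟩ := hpar β
  have hlevel : α.level - β.level = 2 * (d' - d) := by omega
  have hshift : |β.shift - α.shift| ≤ 2 := by
    cases α <;> cases β <;> simp [shift]
  have hsnd := congrArg Prod.snd h
  rw [point_snd, point_snd] at hsnd
  have hlevel' : (α.level : ℝ) - β.level = 2 * ((d' - d : ℤ) : ℝ) := by exact_mod_cast hlevel
  obtain ⟨h2, h3⟩ := eq_zero_of_mul_eq (d := d' - d) (s := β.shift - α.shift) hε hεm hshift (by
    push_cast at hlevel' ⊢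
    linear_combination hsnd - m / 2 * hlevel')
  have h2 : α.level = β.level := by omega
  cases α <;> cases β <;> simp only [abscissa, level, shift, Valid] at * <;>
    first
    | omega
    | (congr 1 <;> omega)

end WebVertex

section web

variable {n N : ℕ} {row : ℤ → ℕ} {M : Set ColoredArc} {m ε : ℝ}

open Classical in
/-- The vertex where an arc with boundary point `j` starts or ends. -/
noncomputable def foot (M : Set ColoredArc) (j : ℤ) : WebVertex :=
  if IsYPoint M j then .y j else .bd j

/-- The vertex from which an arc leaves its stop `t`. -/
noncomputable def leave (M : Set ColoredArc) (a : ColoredArc) (t : ℤ) : WebVertex :=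
  if t = a.init then foot M a.init
  else if t < a.term then .top a.init t
  else .bot (t - (a.term - a.init)) a.term

/-- The vertex at which an arc reaches its stop `t`. -/
noncomputable def reach (M : Set ColoredArc) (a : ColoredArc) (t : ℤ) : WebVertex :=
  if t = 2 * a.term - a.init then foot M a.term
  else if t < a.term then .bot a.init t
  else .top (t - (a.term - a.init)) a.term

theorem point_foot (M : Set ColoredArc) (j : ℤ) : (foot M j).point m ε = footVertex ε M j := by
  unfold foot footVertex
  split_ifs <;> rfl

theorem point_leave (M : Set ColoredArc) (a : ColoredArc) (t : ℤ) :
    (leave M a t).point m ε = leaveVertex m ε M a t := by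
  unfold leave leaveVertex
  split_ifs
  · exact point_foot M _
  · rfl
  · rfl

theorem point_reach (M : Set ColoredArc) (a : ColoredArc) (t : ℤ) :
    (reach M a t).point m ε = reachVertex m ε M a t := by
  unfold reach reachVertex
  split_ifs
  · exact point_foot M _
  · rfl
  · rfl

theorem singleArcEdge_ends (M : Set ColoredArc) (a : ColoredArc) (p q : ℤ) :
    (singleArcEdge m ε M a p q).ends =
      .directed ((leave M a p).point m ε) ((reach M a q).point m ε) := by
  rw [point_leave, point_reach]; rfl

theorem abscissa_foot (M : Set ColoredArc) (j : ℤ) : (foot M j).abscissa = 2 * j := by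
  unfold foot; split_ifs <;> rfl

/-- Twice the abscissa is `a.init + t` on both legs, so the vertices of an arc move strictly to the
right from stop to stop. -/
theorem abscissa_leave (M : Set ColoredArc) (a : ColoredArc) (t : ℤ) :
    (leave M a t).abscissa = a.init + t := by
  unfold leave
  split_ifs with h1 h2
  · rw [abscissa_foot, h1]; ring
  · rfl
  · simp only [WebVertex.abscissa]; ring

theorem abscissa_reach (M : Set ColoredArc) (a : ColoredArc) (t : ℤ) :
    (reach M a t).abscissa = a.init + t := by
  unfold reach
  split_ifs with h1 h2
  · rw [abscissa_foot, h1]; ring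
  · rfl
  · simp only [WebVertex.abscissa]; ring

theorem valid_foot (M : Set ColoredArc) (j : ℤ) : (foot M j).Valid := by
  unfold foot; split_ifs <;> trivial

/-! ### Stops -/

/-- The stops of an arc are its two ends and its crossings while it rises and while it falls. -/
theorem arcStops_cases {a : ColoredArc} {t : ℤ} (ht : t ∈ arcStops M a) :
    t = a.init ∨ t = 2 * a.term - a.init ∨
      (a.init < t ∧ t < a.term ∧ ∃ b ∈ M, b.Crosses a ∧ t = b.term) ∨
      (a.term < t ∧ t < 2 * a.term - a.init ∧
        ∃ b ∈ M, a.Crosses b ∧ t = b.init + (a.term - a.init)) := by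
  rcases ht with ((h | h) | ⟨b, hb, hc, h⟩) | ⟨b, hb, hc, h⟩
  · exact Or.inl h
  · exact Or.inr (Or.inl h)
  · obtain ⟨h1, h2, h3⟩ := hc
    exact Or.inr (Or.inr (Or.inl ⟨by omega, by omega, b, hb, ⟨h1, h2, h3⟩, h⟩))
  · obtain ⟨h1, h2, h3⟩ := hc
    exact Or.inr (Or.inr (Or.inr ⟨by omega, by omega, b, hb, ⟨h1, h2, h3⟩, h⟩))

theorem init_mem_arcStops (M : Set ColoredArc) (a : ColoredArc) : a.init ∈ arcStops M a :=
  Or.inl (Or.inl (Or.inl rfl))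

theorem last_mem_arcStops (M : Set ColoredArc) (a : ColoredArc) :
    2 * a.term - a.init ∈ arcStops M a :=
  Or.inl (Or.inl (Or.inr rfl))

theorem arcStops_bounds {a : ColoredArc} (ha : a.init < a.term) {t : ℤ} (ht : t ∈ arcStops M a) :
    a.init ≤ t ∧ t ≤ 2 * a.term - a.init := by
  rcases arcStops_cases ht with h | h | ⟨h1, h2, -⟩ | ⟨h1, h2, -⟩ <;> omega

theorem exists_nextStop_right {a : ColoredArc} (ha : a.init < a.term) {t : ℤ}
    (ht : t ∈ arcStops M a) (hlast : t ≠ 2 * a.term - a.init) : ∃ q, NextStop M a t q := by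
  have hb := arcStops_bounds ha ht
  obtain ⟨q, ⟨hq, htq⟩, hmin⟩ := Int.exists_least_of_bdd
    (P := fun q => q ∈ arcStops M a ∧ t < q) ⟨t, fun z hz => hz.2.le⟩
    ⟨_, last_mem_arcStops M a, by omega⟩
  exact ⟨q, ht, hq, htq, fun z hz hzq => by have := hmin z ⟨hz, hzq.1⟩; omega⟩

theorem exists_nextStop_left {a : ColoredArc} (ha : a.init < a.term) {t : ℤ}
    (ht : t ∈ arcStops M a) (hfirst : t ≠ a.init) : ∃ p, NextStop M a p t := by
  have hb := arcStops_bounds ha ht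
  obtain ⟨q, ⟨hq, htq⟩, hmax⟩ := Int.exists_greatest_of_bdd
    (P := fun q => q ∈ arcStops M a ∧ q < t) ⟨t, fun z hz => hz.2.le⟩
    ⟨_, init_mem_arcStops M a, by omega⟩
  exact ⟨q, hq, ht, htq, fun z hz hzq => by have := hmax z ⟨hz, hzq.2⟩; omega⟩

theorem NextStop.right_unique {a : ColoredArc} {p q q' : ℤ} (h : NextStop M a p q)
    (h' : NextStop M a p q') : q = q' := by
  obtain ⟨-, h1, h2, h3⟩ := h
  obtain ⟨-, h1', h2', h3'⟩ := h'
  have := h3 _ h1'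
  have := h3' _ h1
  omega

theorem NextStop.left_unique {a : ColoredArc} {p p' q : ℤ} (h : NextStop M a p q)
    (h' : NextStop M a p' q) : p = p' := by
  obtain ⟨h1, -, h2, h3⟩ := h
  obtain ⟨h1', -, h2', h3'⟩ := h'
  have := h3 _ h1'
  have := h3' _ h1
  omega

theorem NextStop.ne_last {a : ColoredArc} (ha : a.init < a.term) {p q : ℤ} (h : NextStop M a p q) :
    p ≠ 2 * a.term - a.init := by
  have := (arcStops_bounds ha h.2.1).2
  have := h.2.2.1
  omega

theorem NextStop.ne_init {a : ColoredArc} (ha : a.init < a.term) {p q : ℤ} (h : NextStop M a p q) :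
    q ≠ a.init := by
  have := (arcStops_bounds ha h.1).1
  have := h.2.2.1
  omega

/-- The vertex from which an arc leaves a stop. -/
theorem leave_cases {a : ColoredArc} {t : ℤ}
    (ht : t ∈ arcStops M a) (hlast : t ≠ 2 * a.term - a.init) :
    (t = a.init ∧ leave M a t = foot M a.init) ∨
      (∃ b ∈ M, b.Crosses a ∧ t = b.term ∧ leave M a t = .top a.init b.term) ∨
      (∃ b ∈ M, a.Crosses b ∧ t = b.init + (a.term - a.init) ∧
        leave M a t = .bot b.init a.term) := by
  unfold leave
  rcases arcStops_cases ht with h | h | ⟨h1, h2, b, hb, hc, rfl⟩ | ⟨h1, h2, b, hb, hc, rfl⟩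
  · exact Or.inl ⟨h, by rw [if_pos h]⟩
  · exact absurd h hlast
  · exact Or.inr (Or.inl ⟨b, hb, hc, rfl, by rw [if_neg (by omega), if_pos h2]⟩)
  · refine Or.inr (Or.inr ⟨b, hb, hc, rfl, ?_⟩)
    rw [if_neg (by omega), if_neg (by omega), add_sub_cancel_right]

/-- The vertex at which an arc reaches a stop. -/
theorem reach_cases {a : ColoredArc} (ha : a.init < a.term) {t : ℤ}
    (ht : t ∈ arcStops M a) (hfirst : t ≠ a.init) :
    (t = 2 * a.term - a.init ∧ reach M a t = foot M a.term) ∨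
      (∃ b ∈ M, b.Crosses a ∧ t = b.term ∧ reach M a t = .bot a.init b.term) ∨
      (∃ b ∈ M, a.Crosses b ∧ t = b.init + (a.term - a.init) ∧
        reach M a t = .top b.init a.term) := by
  unfold reach
  rcases arcStops_cases ht with h | h | ⟨h1, h2, b, hb, hc, rfl⟩ | ⟨h1, h2, b, hb, hc, rfl⟩
  · exact absurd h hfirst
  · exact Or.inl ⟨h, by rw [if_pos h]⟩
  · exact Or.inr (Or.inl ⟨b, hb, hc, rfl, by rw [if_neg (by omega), if_pos h2]⟩)
  · refine Or.inr (Or.inr ⟨b, hb, hc, rfl, ?_⟩)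
    rw [if_neg (by omega), if_neg (by omega), add_sub_cancel_right]

theorem valid_leave {a : ColoredArc} {t : ℤ}
    (ht : t ∈ arcStops M a) (hlast : t ≠ 2 * a.term - a.init) : (leave M a t).Valid := by
  rcases leave_cases ht hlast with ⟨-, h⟩ | ⟨b, -, hc, -, h⟩ | ⟨b, -, hc, -, h⟩ <;> rw [h]
  · exact valid_foot M _
  · exact hc.2.1
  · exact hc.2.1

theorem valid_reach {a : ColoredArc} (ha : a.init < a.term) {t : ℤ}
    (ht : t ∈ arcStops M a) (hfirst : t ≠ a.init) : (reach M a t).Valid := by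
  rcases reach_cases ha ht hfirst with ⟨-, h⟩ | ⟨b, -, hc, -, h⟩ | ⟨b, -, hc, -, h⟩ <;> rw [h]
  · exact valid_foot M _
  · exact hc.2.1
  · exact hc.2.1

/-! ### Edges at a vertex -/

theorem foot_eq_y {i j : ℤ} (h : foot M i = .y j) : i = j := by
  unfold foot at h
  split_ifs at h
  cases h; rfl

theorem foot_eq_bd {i j : ℤ} (h : foot M i = .bd j) : i = j ∧ ¬IsYPoint M j := by
  unfold foot at h
  split_ifs at h with h1
  cases h; exact ⟨rfl, h1⟩

theorem foot_ne_top {i u v : ℤ} : foot M i ≠ .top u v := by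
  unfold foot; split_ifs <;> simp

theorem foot_ne_bot {i u v : ℤ} : foot M i ≠ .bot u v := by
  unfold foot; split_ifs <;> simp

/-- The vertical edges of the web before the edges at the boundary are normalized, with the colors
of the two arcs that they carry. -/
def IsDoubleEdge (M : Set ColoredArc) (lo hi : WebVertex) (x x' : ℕ) : Prop :=
  (∃ a ∈ M, ∃ b ∈ M, a.term = b.init ∧ lo = .bd b.init ∧ hi = .y b.init ∧ x = a.color ∧
    x' = b.color) ∨
  (∃ a ∈ M, ∃ b ∈ M, a.Crosses b ∧ lo = .bot b.init a.term ∧ hi = .top b.init a.term ∧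
    x = a.color ∧ x' = b.color)

theorem mem_rawWeb_edges {e : PlaneEdge} : e ∈ (rawWeb m ε N M).edges ↔
    (∃ a ∈ M, ∃ p q : ℤ, NextStop M a p q ∧ e = singleArcEdge m ε M a p q) ∨
    ∃ lo hi x x', IsDoubleEdge M lo hi x x' ∧
      e = doubleArcEdge (lo.point m ε) (hi.point m ε) x x' := by
  constructor
  · rintro ((h | ⟨a, ha, b, hb, h, rfl⟩) | ⟨a, ha, b, hb, h, rfl⟩)
    · exact Or.inl h
    · exact Or.inr ⟨_, _, _, _, Or.inl ⟨a, ha, b, hb, h, rfl, rfl, rfl, rfl⟩, rfl⟩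
    · exact Or.inr ⟨_, _, _, _, Or.inr ⟨a, ha, b, hb, h, rfl, rfl, rfl, rfl⟩, rfl⟩
  · rintro (h | ⟨_, _, _, _, ⟨a, ha, b, hb, h, rfl, rfl, rfl, rfl⟩ |
      ⟨a, ha, b, hb, h, rfl, rfl, rfl, rfl⟩, rfl⟩)
    · exact Or.inl (Or.inl h)
    · exact Or.inl (Or.inr ⟨a, ha, b, hb, h, rfl⟩)
    · exact Or.inr ⟨a, ha, b, hb, h, rfl⟩

theorem doubleArcEdge_has (lo hi v : ℝ × ℝ) (x x' : ℕ) :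
    (doubleArcEdge lo hi x x').ends.Has v ↔ v = lo ∨ v = hi := by
  unfold doubleArcEdge
  split_ifs
  · exact Iff.rfl
  · exact or_comm

theorem IsDoubleEdge.valid {lo hi : WebVertex} {x x' : ℕ} (h : IsDoubleEdge M lo hi x x') :
    lo.Valid ∧ hi.Valid := by
  rcases h with ⟨a, -, b, -, -, rfl, rfl, -, -⟩ | ⟨a, -, b, -, h, rfl, rfl, -, -⟩
  · exact ⟨trivial, trivial⟩
  · exact ⟨h.2.1, h.2.1⟩

theorem IsDoubleEdge.abscissa {lo hi : WebVertex} {x x' : ℕ} (h : IsDoubleEdge M lo hi x x') :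
    lo.abscissa = hi.abscissa ∧ lo ≠ hi := by
  rcases h with ⟨a, -, b, -, -, rfl, rfl, -, -⟩ | ⟨a, -, b, -, h, rfl, rfl, -, -⟩ <;>
    simp [WebVertex.abscissa]

/-- The edges at a vertex of the web. -/
theorem mem_incident_rawWeb (hM : IsTableauMatching n N row M) (hε : 0 < ε) (hεm : ε < m / 2)
    {α : WebVertex} (hα : α.Valid) {e : PlaneEdge} :
    e ∈ (rawWeb m ε N M).incident (α.point m ε) ↔
      (∃ a ∈ M, ∃ p q : ℤ, NextStop M a p q ∧ leave M a p = α ∧ e = singleArcEdge m ε M a p q) ∨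
      (∃ a ∈ M, ∃ p q : ℤ, NextStop M a p q ∧ reach M a q = α ∧ e = singleArcEdge m ε M a p q) ∨
      ∃ lo hi x x', IsDoubleEdge M lo hi x x' ∧ (lo = α ∨ hi = α) ∧
        e = doubleArcEdge (lo.point m ε) (hi.point m ε) x x' := by
  unfold PlaneWeb.incident
  rw [Set.mem_ofPred_eq, mem_rawWeb_edges]
  constructor
  · rintro ⟨⟨a, ha, p, q, h, rfl⟩ | ⟨lo, hi, x, x', h, rfl⟩, hv⟩
    · have hlt := hM.init_lt_term a ha
      rw [singleArcEdge_ends] at hv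
      rcases hv with hv | hv
      · exact Or.inl ⟨a, ha, p, q, h, (WebVertex.point_injOn hε hεm hα
          (valid_leave h.1 (h.ne_last hlt)) hv).symm, rfl⟩
      · exact Or.inr (Or.inl ⟨a, ha, p, q, h, (WebVertex.point_injOn hε hεm hα
          (valid_reach hlt h.2.1 (h.ne_init hlt)) hv).symm, rfl⟩)
    · rw [doubleArcEdge_has] at hv
      refine Or.inr (Or.inr ⟨lo, hi, x, x', h, ?_, rfl⟩)
      rcases hv with hv | hv
      · exact Or.inl (WebVertex.point_injOn hε hεm hα h.valid.1 hv).symm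
      · exact Or.inr (WebVertex.point_injOn hε hεm hα h.valid.2 hv).symm
  · rintro (⟨a, ha, p, q, h, rfl, rfl⟩ | ⟨a, ha, p, q, h, rfl, rfl⟩ |
      ⟨lo, hi, x, x', h, hα', rfl⟩)
    · exact ⟨Or.inl ⟨a, ha, p, q, h, rfl⟩, by rw [singleArcEdge_ends]; exact Or.inl rfl⟩
    · exact ⟨Or.inl ⟨a, ha, p, q, h, rfl⟩, by rw [singleArcEdge_ends]; exact Or.inr rfl⟩
    · refine ⟨Or.inr ⟨lo, hi, x, x', h, rfl⟩, ?_⟩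
      rw [doubleArcEdge_has]
      rcases hα' with rfl | rfl
      · exact Or.inl rfl
      · exact Or.inr rfl

/-- The stops and the vertical edge at an interior vertex `α`: the arc `a` reaches its stop `s`
there, the arc `b` leaves its stop `t`. -/
structure VertexStops (M : Set ColoredArc) (α : WebVertex) (a b : ColoredArc) (s t : ℤ)
    (lo hi : WebVertex) (x x' : ℕ) : Prop where
  valid : α.Valid
  mem_left : a ∈ M
  mem_right : b ∈ M
  stop_left : s ∈ arcStops M a
  stop_right : t ∈ arcStops M b
  ne_init : s ≠ a.init
  ne_last : t ≠ 2 * b.term - b.init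
  reach_eq : reach M a s = α
  leave_eq : leave M b t = α
  reach_unique : ∀ c ∈ M, ∀ q ∈ arcStops M c, q ≠ c.init → reach M c q = α → c = a ∧ q = s
  leave_unique : ∀ c ∈ M, ∀ p ∈ arcStops M c, p ≠ 2 * c.term - c.init → leave M c p = α →
    c = b ∧ p = t
  isDouble : IsDoubleEdge M lo hi x x'
  double_unique : ∀ lo' hi' y y', IsDoubleEdge M lo' hi' y y' → (lo' = α ∨ hi' = α) →
    lo' = lo ∧ hi' = hi ∧ y = x ∧ y' = x'
  colors : (hi = α ∧ a.color = x ∧ b.color = x') ∨ (lo = α ∧ a.color = x' ∧ b.color = x)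
  color_ne : x ≠ x'

theorem vertexStops_y (hM : IsTableauMatching n N row M) {a b : ColoredArc} (ha : a ∈ M)
    (hb : b ∈ M) (hab : a.term = b.init) :
    VertexStops M (.y b.init) a b (2 * a.term - a.init) b.init (.bd b.init) (.y b.init)
      a.color b.color := by
  have hlta := hM.init_lt_term a ha
  have hltb := hM.init_lt_term b hb
  have hY : IsYPoint M b.init := ⟨⟨a, ha, hab⟩, ⟨b, hb, rfl⟩⟩
  refine ⟨trivial, ha, hb, last_mem_arcStops M a, init_mem_arcStops M b, by omega, by omega, ?_, ?_,
    fun c hc q hq hqi h => ?_, fun c hc p hp hpl h => ?_, Or.inl ⟨a, ha, b, hb, hab, rfl, rfl, rfl, rfl⟩,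
    ?_, Or.inl ⟨rfl, rfl, rfl⟩, ?_⟩
  · rw [reach, if_pos rfl, foot, hab, if_pos hY]
  · rw [leave, if_pos rfl, foot, if_pos hY]
  · rcases reach_cases (hM.init_lt_term c hc) hq hqi with ⟨h1, h2⟩ | ⟨d, -, -, -, h2⟩ |
      ⟨d, -, -, -, h2⟩ <;> rw [h2] at h
    · obtain rfl := hM.term_inj c hc a ha ((foot_eq_y h).trans hab.symm)
      exact ⟨rfl, h1⟩
    · cases h
    · cases h
  · rcases leave_cases hp hpl with ⟨h1, h2⟩ | ⟨d, -, -, -, h2⟩ |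
      ⟨d, -, -, -, h2⟩ <;> rw [h2] at h
    · obtain rfl := hM.init_inj c hc b hb (foot_eq_y h)
      exact ⟨rfl, h1⟩
    · cases h
    · cases h
  · rintro lo' hi' y y' (⟨c, hc, d, hd, hcd, rfl, rfl, rfl, rfl⟩ |
      ⟨c, hc, d, hd, hcd, rfl, rfl, rfl, rfl⟩) (h | h)
    · cases h
    · injection h with h
      obtain rfl := hM.init_inj d hd b hb h
      obtain rfl := hM.term_inj c hc a ha (hcd.trans hab.symm)
      exact ⟨rfl, rfl, rfl, rfl⟩
    · cases h
    · cases h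
  -- The arc that ends at `j` has color `row j`, the one that starts there `row j + 1`.
  · have h1 := hM.row_term a ha
    have h2 := hM.row_init b hb
    rw [hab] at h1
    omega

theorem double_unique_crossing (hM : IsTableauMatching n N row M) {a b : ColoredArc} (ha : a ∈ M)
    (hb : b ∈ M) {lo hi : WebVertex} {y y' : ℕ} (h : IsDoubleEdge M lo hi y y')
    (hα : (lo = .bot b.init a.term ∨ lo = .top b.init a.term) ∨
      (hi = .bot b.init a.term ∨ hi = .top b.init a.term)) :
    lo = .bot b.init a.term ∧ hi = .top b.init a.term ∧ y = a.color ∧ y' = b.color := by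
  rcases h with ⟨c, hc, d, hd, hcd, rfl, rfl, rfl, rfl⟩ | ⟨c, hc, d, hd, hcd, rfl, rfl, rfl, rfl⟩
  · rcases hα with (h | h) | (h | h) <;> cases h
  · have : d.init = b.init ∧ c.term = a.term := by
      rcases hα with (h | h) | (h | h)
      · injection h with h1 h2; exact ⟨h1, h2⟩
      · cases h
      · cases h
      · injection h with h1 h2; exact ⟨h1, h2⟩
    obtain rfl := hM.init_inj d hd b hb this.1
    obtain rfl := hM.term_inj c hc a ha this.2
    exact ⟨rfl, rfl, rfl, rfl⟩

/-- The falling arc `a` arrives at the upper vertex, from which the rising arc `b` leaves; at the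
lower vertex the roles are exchanged. The crossing point determines `b.init` and `a.term`, and each
of these belongs to one arc only. -/
theorem vertexStops_top (hM : IsTableauMatching n N row M) {a b : ColoredArc} (ha : a ∈ M)
    (hb : b ∈ M) (hab : a.Crosses b) :
    VertexStops M (.top b.init a.term) a b (b.init + (a.term - a.init)) a.term
      (.bot b.init a.term) (.top b.init a.term) a.color b.color := by
  obtain ⟨h1, h2, h3⟩ := id hab
  have hsa : b.init + (a.term - a.init) ∈ arcStops M a := Or.inr ⟨b, hb, hab, rfl⟩
  have hsb : a.term ∈ arcStops M b := Or.inl (Or.inr ⟨a, ha, hab, rfl⟩)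
  refine ⟨h2, ha, hb, hsa, hsb, by omega, by omega, ?_, ?_,
    fun c hc q hq hqi h => ?_, fun c hc p hp hpl h => ?_,
    Or.inr ⟨a, ha, b, hb, hab, rfl, rfl, rfl, rfl⟩,
    fun lo' hi' y y' hd h => double_unique_crossing hM ha hb hd ?_,
    Or.inl ⟨rfl, rfl, rfl⟩, hM.color_ne a ha b hb hab⟩
  · rw [reach, if_neg (by omega), if_neg (by omega), add_sub_cancel_right]
  · rw [leave, if_neg (by omega), if_pos h3]
  · rcases reach_cases (hM.init_lt_term c hc) hq hqi with ⟨-, h2⟩ | ⟨d, -, -, -, h2⟩ |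
      ⟨d, hd, -, h5, h2⟩ <;> rw [h2] at h
    · exact absurd h foot_ne_top
    · cases h
    · injection h with h6 h7
      obtain rfl := hM.term_inj c hc a ha h7
      exact ⟨rfl, by rw [h5, h6]⟩
  · rcases leave_cases hp hpl with ⟨-, h2⟩ | ⟨d, -, -, h5, h2⟩ |
      ⟨d, hd, -, -, h2⟩ <;> rw [h2] at h
    · exact absurd h foot_ne_top
    · injection h with h6 h7
      obtain rfl := hM.init_inj c hc b hb h6
      exact ⟨rfl, by rw [h5, h7]⟩
    · cases h
  · rcases h with h | h
    · exact Or.inl (Or.inr h)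
    · exact Or.inr (Or.inr h)

theorem vertexStops_bot (hM : IsTableauMatching n N row M) {a b : ColoredArc} (ha : a ∈ M)
    (hb : b ∈ M) (hab : a.Crosses b) :
    VertexStops M (.bot b.init a.term) b a a.term (b.init + (a.term - a.init))
      (.bot b.init a.term) (.top b.init a.term) a.color b.color := by
  obtain ⟨h1, h2, h3⟩ := id hab
  have hsa : b.init + (a.term - a.init) ∈ arcStops M a := Or.inr ⟨b, hb, hab, rfl⟩
  have hsb : a.term ∈ arcStops M b := Or.inl (Or.inr ⟨a, ha, hab, rfl⟩)
  refine ⟨h2, hb, ha, hsb, hsa, by omega, by omega, ?_, ?_,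
    fun c hc q hq hqi h => ?_, fun c hc p hp hpl h => ?_,
    Or.inr ⟨a, ha, b, hb, hab, rfl, rfl, rfl, rfl⟩,
    fun lo' hi' y y' hd h => double_unique_crossing hM ha hb hd ?_,
    Or.inr ⟨rfl, rfl, rfl⟩, hM.color_ne a ha b hb hab⟩
  · rw [reach, if_neg (by omega), if_pos h3]
  · rw [leave, if_neg (by omega), if_neg (by omega), add_sub_cancel_right]
  · rcases reach_cases (hM.init_lt_term c hc) hq hqi with ⟨-, h2⟩ | ⟨d, -, -, h5, h2⟩ |
      ⟨d, hd, -, -, h2⟩ <;> rw [h2] at h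
    · exact absurd h foot_ne_bot
    · injection h with h6 h7
      obtain rfl := hM.init_inj c hc b hb h6
      exact ⟨rfl, by rw [h5, h7]⟩
    · cases h
  · rcases leave_cases hp hpl with ⟨-, h2⟩ | ⟨d, -, -, -, h2⟩ |
      ⟨d, hd, -, h5, h2⟩ <;> rw [h2] at h
    · exact absurd h foot_ne_bot
    · cases h
    · injection h with h6 h7
      obtain rfl := hM.term_inj c hc a ha h7
      exact ⟨rfl, by rw [h5, h6]⟩
  · rcases h with h | h
    · exact Or.inl (Or.inl h)
    · exact Or.inr (Or.inl h)

theorem exists_vertexStops (hM : IsTableauMatching n N row M) {v : ℝ × ℝ}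
    (hv : v ∈ (rawWeb m ε N M).interior) : ∃ α a b s t lo hi x x',
      v = WebVertex.point m ε α ∧ VertexStops M α a b s t lo hi x x' := by
  rcases hv with ⟨j, ⟨⟨a, ha, rfl⟩, ⟨b, hb, hab⟩⟩, rfl⟩ | ⟨a, ha, b, hb, hab, rfl | rfl⟩
  · rw [← hab]
    exact ⟨_, _, _, _, _, _, _, _, _, rfl, vertexStops_y hM ha hb hab.symm⟩
  · exact ⟨_, _, _, _, _, _, _, _, _, rfl, vertexStops_top hM ha hb hab⟩
  · exact ⟨_, _, _, _, _, _, _, _, _, rfl, vertexStops_bot hM ha hb hab⟩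

theorem VertexStops.incident (hM : IsTableauMatching n N row M) (hε : 0 < ε) (hεm : ε < m / 2)
    {α : WebVertex} {a b : ColoredArc} {s t : ℤ} {lo hi : WebVertex} {x x' : ℕ}
    (h : VertexStops M α a b s t lo hi x x') {p q : ℤ} (hp : NextStop M a p s)
    (hq : NextStop M b t q) :
    (rawWeb m ε N M).incident (α.point m ε) =
      {singleArcEdge m ε M a p s, singleArcEdge m ε M b t q,
        doubleArcEdge (lo.point m ε) (hi.point m ε) x x'} := by
  ext e
  rw [mem_incident_rawWeb hM hε hεm h.valid]
  constructor
  · rintro (⟨c, hc, p', q', hn, hl, rfl⟩ | ⟨c, hc, p', q', hn, hl, rfl⟩ |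
      ⟨lo', hi', y, y', hd, hl, rfl⟩)
    · have hlt := hM.init_lt_term c hc
      obtain ⟨rfl, rfl⟩ := h.leave_unique c hc p' hn.1 (hn.ne_last hlt) hl
      rw [hn.right_unique hq]
      exact Or.inr (Or.inl rfl)
    · have hlt := hM.init_lt_term c hc
      obtain ⟨rfl, rfl⟩ := h.reach_unique c hc q' hn.2.1 (hn.ne_init hlt) hl
      rw [hn.left_unique hp]
      exact Or.inl rfl
    · obtain ⟨rfl, rfl, rfl, rfl⟩ := h.double_unique _ _ _ _ hd hl
      exact Or.inr (Or.inr rfl)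
  · rintro (rfl | rfl | rfl)
    · exact Or.inr (Or.inl ⟨a, h.mem_left, p, s, hp, h.reach_eq, rfl⟩)
    · exact Or.inl ⟨b, h.mem_right, t, q, hq, h.leave_eq, rfl⟩
    · refine Or.inr (Or.inr ⟨lo, hi, x, x', h.isDouble, ?_, rfl⟩)
      rcases h.colors with ⟨h, -⟩ | ⟨h, -⟩
      · exact Or.inr h
      · exact Or.inl h

end web

section web

variable {n N : ℕ} {row : ℤ → ℕ} {M : Set ColoredArc} {m ε : ℝ}

/-! ### The usual form of the web of a matching -/

theorem PlaneWeb.incident_usual (n : ℕ) (w : PlaneWeb) (v : ℝ × ℝ) :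
    (w.usual n).incident v = PlaneEdge.usual n '' w.incident v := by
  ext e
  constructor
  · rintro ⟨⟨f, hf, rfl⟩, hv⟩
    exact ⟨f, ⟨hf, (PlaneEdge.has_usual n f v).1 hv⟩, rfl⟩
  · rintro ⟨f, ⟨hf, hv⟩, rfl⟩
    exact ⟨⟨f, hf, rfl⟩, (PlaneEdge.has_usual n f v).2 hv⟩

theorem PlaneEdge.weight_usual_of_one {n : ℕ} {e : PlaneEdge} (h : e.weight = 1) :
    e.usual n = e := by
  rw [PlaneEdge.usual, if_pos h]

theorem PlaneEdge.usual_of_weight_add_one {n : ℕ} {e : PlaneEdge} (h1 : e.weight ≠ 1)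
    (h : e.weight + 1 = n) : e.usual n = ⟨e.curve, e.ends.reverse, 1⟩ := by
  rw [PlaneEdge.usual, if_neg h1, if_pos h, PlaneEdge.flip, show n - e.weight = 1 by omega]

open Classical in
theorem PlaneEdge.normalize_of_directed {B : Set (ℝ × ℝ)} {e : PlaneEdge} {a b : ℝ × ℝ}
    (h : e.ends = .directed a b) : e.normalize B =
      if a ∈ B then ⟨e.curve, .directed a b, 1⟩
      else if b ∈ B then ⟨e.curve, .directed b a, 1⟩ else e := by
  obtain ⟨c, d, w⟩ := e
  simp only at h
  subst h
  rfl

/-! ### Colors of arcs and rows of boundary points -/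

namespace IsTableauMatching

theorem color_pos (hM : IsTableauMatching n N row M) {a : ColoredArc} (ha : a ∈ M) :
    1 ≤ a.color := by
  have := hM.row_init a ha; omega

theorem color_lt (hM : IsTableauMatching n N row M) {a : ColoredArc} (ha : a ∈ M) :
    a.color < n := by
  rw [← hM.row_term a ha]
  exact hM.row_lt _ (by have := hM.one_le_init a ha; have := hM.init_lt_term a ha; omega)
    (hM.term_le a ha)

theorem one_le_term (hM : IsTableauMatching n N row M) {a : ColoredArc} (ha : a ∈ M) :
    1 ≤ a.term := by
  have := hM.one_le_init a ha; have := hM.init_lt_term a ha; omega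

theorem init_le (hM : IsTableauMatching n N row M) {a : ColoredArc} (ha : a ∈ M) :
    a.init ≤ N := by
  have := hM.term_le a ha; have := hM.init_lt_term a ha; omega

theorem not_isYPoint_of_row_eq_zero (hM : IsTableauMatching n N row M) {j : ℤ} (h : row j = 0) :
    ¬IsYPoint M j := by
  rintro ⟨⟨a, ha, rfl⟩, -⟩
  have := hM.row_term a ha
  have := hM.color_pos ha
  omega

theorem not_isYPoint_of_row_add_one_eq (hM : IsTableauMatching n N row M) {j : ℤ}
    (h : row j + 1 = n) : ¬IsYPoint M j := by
  rintro ⟨-, ⟨a, ha, rfl⟩⟩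
  have := hM.row_init a ha
  have := hM.color_lt ha
  omega

theorem row_init_eq_zero (hM : IsTableauMatching n N row M) {a : ColoredArc} (ha : a ∈ M)
    (h : ¬IsYPoint M a.init) : row a.init = 0 := by
  by_contra h0
  obtain ⟨b, hb, hba⟩ := hM.exists_term a.init (hM.one_le_init a ha) (hM.init_le ha) (by omega)
  exact h ⟨⟨b, hb, hba⟩, ⟨a, ha, rfl⟩⟩

theorem row_term_add_one (hM : IsTableauMatching n N row M) {a : ColoredArc} (ha : a ∈ M)
    (h : ¬IsYPoint M a.term) : row a.term + 1 = n := by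
  by_contra h0
  have := hM.row_lt a.term (hM.one_le_term ha) (hM.term_le a ha)
  obtain ⟨b, hb, hba⟩ := hM.exists_init a.term (hM.one_le_term ha) (hM.term_le a ha) (by omega)
  exact h ⟨⟨a, ha, rfl⟩, ⟨b, hb, hba⟩⟩

theorem doubleEdge_colors (hM : IsTableauMatching n N row M) {lo hi : WebVertex} {x x' : ℕ}
    (h : IsDoubleEdge M lo hi x x') :
    (1 ≤ x ∧ x < n) ∧ (1 ≤ x' ∧ x' < n) ∧ x ≠ x' ∧ ∀ j, lo = .bd j → x' = x + 1 := by
  rcases h with ⟨a, ha, b, hb, hab, rfl, rfl, rfl, rfl⟩ | ⟨a, ha, b, hb, hab, rfl, rfl, rfl, rfl⟩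
  · have h1 := hM.row_term a ha
    have h2 := hM.row_init b hb
    rw [hab] at h1
    exact ⟨⟨hM.color_pos ha, hM.color_lt ha⟩, ⟨hM.color_pos hb, hM.color_lt hb⟩, by omega,
      fun _ _ => by omega⟩
  · exact ⟨⟨hM.color_pos ha, hM.color_lt ha⟩, ⟨hM.color_pos hb, hM.color_lt hb⟩,
      hM.color_ne a ha b hb hab, fun j hj => by cases hj⟩

end IsTableauMatching

theorem doubleArcEdge_weight (lo hi : ℝ × ℝ) (x x' : ℕ) :
    (doubleArcEdge lo hi x x').weight = if x < x' then x' - x else x - x' := rfl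

theorem doubleArcEdge_ends (lo hi : ℝ × ℝ) (x x' : ℕ) :
    (doubleArcEdge lo hi x x').ends = if x < x' then .directed lo hi else .directed hi lo := rfl

theorem rawWeb_weight (hM : IsTableauMatching n N row M) {e : PlaneEdge}
    (he : e ∈ (rawWeb m ε N M).edges) : 1 ≤ e.weight ∧ e.weight < n := by
  rw [mem_rawWeb_edges] at he
  rcases he with ⟨a, ha, p, q, h, rfl⟩ | ⟨lo, hi, x, x', h, rfl⟩
  · exact ⟨hM.color_pos ha, hM.color_lt ha⟩
  · obtain ⟨h1, h2, h3, -⟩ := hM.doubleEdge_colors h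
    rw [doubleArcEdge_weight]
    split_ifs <;> omega

theorem WebVertex.exists_bd_of_mem_boundary (hε : 0 < ε) (hεm : ε < m / 2) {α : WebVertex}
    (hα : α.Valid) (h : α.point m ε ∈ (rawWeb m ε N M).boundary) : ∃ j, α = .bd j := by
  obtain ⟨j, -, -, hj⟩ := h
  exact ⟨j, WebVertex.point_injOn hε hεm hα (β := .bd j) trivial hj⟩

theorem bd_mem_boundary {j : ℤ} (h1 : 1 ≤ j) (h2 : j ≤ N) :
    WebVertex.point m ε (.bd j) ∈ (rawWeb m ε N M).boundary := ⟨j, h1, h2, rfl⟩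

/-- Normalizing the edges at the boundary does not affect the usual form. -/
theorem usual_normalize (hn : 3 ≤ n) (hM : IsTableauMatching n N row M) (hε : 0 < ε)
    (hεm : ε < m / 2) {e : PlaneEdge} (he : e ∈ (rawWeb m ε N M).edges) :
    (e.normalize (rawWeb m ε N M).boundary).usual n = e.usual n := by
  rw [mem_rawWeb_edges] at he
  rcases he with ⟨a, ha, p, q, h, rfl⟩ | ⟨lo, hi, x, x', h, rfl⟩
  · have hlt := hM.init_lt_term a ha
    rw [PlaneEdge.normalize_of_directed (singleArcEdge_ends M a p q)]
    split_ifs with h1 h2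
    · obtain ⟨j, hj⟩ := WebVertex.exists_bd_of_mem_boundary hε hεm
        (valid_leave h.1 (h.ne_last hlt)) h1
      -- An arc that starts directly at a boundary vertex starts in the first row, so its edge is
      -- normalized already.
      have hc : a.color = 1 := by
        rcases leave_cases h.1 (h.ne_last hlt) with ⟨-, h5⟩ | ⟨b, -, -, -, h5⟩ |
          ⟨b, -, -, -, h5⟩ <;> rw [h5] at hj
        · obtain ⟨rfl, hY⟩ := foot_eq_bd hj
          rw [← hM.row_init a ha, hM.row_init_eq_zero ha hY]
        · cases hj
        · cases hj
      congr 1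
      refine PlaneEdge.ext rfl (singleArcEdge_ends M a p q).symm hc.symm
    · obtain ⟨j, hj⟩ := WebVertex.exists_bd_of_mem_boundary hε hεm
        (valid_reach hlt h.2.1 (h.ne_init hlt)) h2
      -- An arc that ends directly at a boundary vertex ends in the last row. Here normalizing is
      -- the flip, which the usual form performs anyway.
      have hc : a.color + 1 = n := by
        rcases reach_cases hlt h.2.1 (h.ne_init hlt) with ⟨-, h5⟩ | ⟨b, -, -, -, h5⟩ |
          ⟨b, -, -, -, h5⟩ <;> rw [h5] at hj
        · obtain ⟨rfl, hY⟩ := foot_eq_bd hj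
          rw [← hM.row_term a ha, hM.row_term_add_one ha hY]
        · cases hj
        · cases hj
      have hw : (singleArcEdge m ε M a p q).weight = a.color := rfl
      rw [PlaneEdge.usual_of_weight_add_one (e := singleArcEdge m ε M a p q) (by omega) (by omega),
        singleArcEdge_ends, PlaneEdge.weight_usual_of_one rfl]
      rfl
    · rfl
  · obtain ⟨-, -, h3, h4⟩ := hM.doubleEdge_colors h
    have hlohi : ∀ j, hi ≠ .bd j := by
      rcases h with ⟨a, ha, b, hb, hab, rfl, rfl, rfl, rfl⟩ | ⟨a, ha, b, hb, hab, rfl, rfl, rfl, rfl⟩ <;>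
        simp
    have hhi : hi.point m ε ∉ (rawWeb m ε N M).boundary := fun hb => by
      obtain ⟨j, hj⟩ := WebVertex.exists_bd_of_mem_boundary hε hεm h.valid.2 hb
      exact hlohi j hj
    by_cases hlo : lo.point m ε ∈ (rawWeb m ε N M).boundary
    · obtain ⟨j, hj⟩ := WebVertex.exists_bd_of_mem_boundary hε hεm h.valid.1 hlo
      -- The colors at the stem of a `Y` are consecutive, so the stem already points upwards with
      -- weight `1`.
      have hx := h4 j hj
      have he : (doubleArcEdge (lo.point m ε) (hi.point m ε) x x').ends =
          .directed (lo.point m ε) (hi.point m ε) := if_pos (by omega)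
      rw [PlaneEdge.normalize_of_directed he, if_pos hlo]
      congr 1
      refine PlaneEdge.ext rfl he.symm ?_
      rw [doubleArcEdge_weight, if_pos (by omega), hx]
      simp
    · by_cases hxx : x < x'
      · rw [PlaneEdge.normalize_of_directed (e := doubleArcEdge _ _ x x') (if_pos hxx),
          if_neg hlo, if_neg hhi]
      · rw [PlaneEdge.normalize_of_directed (e := doubleArcEdge _ _ x x') (if_neg hxx),
          if_neg hhi, if_neg hlo]

theorem PlaneEdge.has_normalize (B : Set (ℝ × ℝ)) (e : PlaneEdge) (v : ℝ × ℝ) :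
    (e.normalize B).ends.Has v ↔ e.ends.Has v := by
  classical
  obtain ⟨c, d, w⟩ := e
  cases d with
  | directed a b =>
    rw [PlaneEdge.normalize_of_directed rfl]
    split_ifs
    · exact Iff.rfl
    · exact or_comm
    · exact Iff.rfl
  | undirected z => rfl

theorem PlaneEdge.weight_normalize (B : Set (ℝ × ℝ)) (e : PlaneEdge) :
    (e.normalize B).weight = 1 ∨ (e.normalize B).weight = e.weight := by
  classical
  obtain ⟨c, d, w⟩ := e
  cases d with
  | directed a b =>
    rw [PlaneEdge.normalize_of_directed rfl]
    split_ifs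
    · exact Or.inl rfl
    · exact Or.inl rfl
    · exact Or.inr rfl
  | undirected z => exact Or.inr rfl

theorem foot_mem (hM : IsTableauMatching n N row M) {a : ColoredArc} (ha : a ∈ M) :
    (foot M a.init).point m ε ∈ (rawWeb m ε N M).boundary ∪ (rawWeb m ε N M).interior := by
  unfold foot
  split_ifs with h
  · exact Or.inr (Or.inl ⟨_, h, rfl⟩)
  · exact Or.inl (bd_mem_boundary (hM.one_le_init a ha) (hM.init_le ha))

/-- Needed for uniqueness: the weight conventions constrain an edge only through a boundary or
interior vertex at one of its ends. -/
theorem rawWeb_exists_end (hM : IsTableauMatching n N row M) {e : PlaneEdge}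
    (he : e ∈ (rawWeb m ε N M).edges) :
    ∃ v ∈ (rawWeb m ε N M).boundary ∪ (rawWeb m ε N M).interior, e.ends.Has v := by
  rw [mem_rawWeb_edges] at he
  rcases he with ⟨a, ha, p, q, h, rfl⟩ | ⟨lo, hi, x, x', h, rfl⟩
  · have hlt := hM.init_lt_term a ha
    refine ⟨(leave M a p).point m ε, ?_, by rw [singleArcEdge_ends]; exact Or.inl rfl⟩
    rcases leave_cases h.1 (h.ne_last hlt) with ⟨-, h5⟩ | ⟨b, hb, hc, -, h5⟩ |
      ⟨b, hb, hc, -, h5⟩ <;> rw [h5]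
    · exact foot_mem hM ha
    · exact Or.inr (Or.inr ⟨b, hb, a, ha, hc, Or.inl rfl⟩)
    · exact Or.inr (Or.inr ⟨a, ha, b, hb, hc, Or.inr rfl⟩)
  · refine ⟨hi.point m ε, ?_, by rw [doubleArcEdge_has]; exact Or.inr rfl⟩
    rcases h with ⟨a, ha, b, hb, hab, rfl, rfl, rfl, rfl⟩ | ⟨a, ha, b, hb, hab, rfl, rfl, rfl, rfl⟩
    · exact Or.inr (Or.inl ⟨_, ⟨⟨a, ha, hab⟩, ⟨b, hb, rfl⟩⟩, rfl⟩)
    · exact Or.inr (Or.inr ⟨a, ha, b, hb, hab, Or.inl rfl⟩)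

theorem matchingWeb_usual (hn : 3 ≤ n) (hM : IsTableauMatching n N row M) (hε : 0 < ε)
    (hεm : ε < m / 2) : (matchingWeb m ε N M).usual n = (rawWeb m ε N M).usual n := by
  refine PlaneWeb.ext rfl rfl ?_
  change PlaneEdge.usual n '' (PlaneEdge.normalize (rawWeb m ε N M).boundary ''
    (rawWeb m ε N M).edges) = PlaneEdge.usual n '' (rawWeb m ε N M).edges
  rw [Set.image_image]
  exact Set.image_congr fun e he => usual_normalize hn hM hε hεm he

/-- The edge at a boundary vertex. -/
theorem exists_incident_bd (hn : 3 ≤ n) (hM : IsTableauMatching n N row M) (hε : 0 < ε)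
    (hεm : ε < m / 2) {j : ℤ} (h1 : 1 ≤ j) (h2 : j ≤ N) :
    ∃ e v, (rawWeb m ε N M).incident (WebVertex.point m ε (.bd j)) = {e} ∧
      ((e.weight = 1 ∧ e.ends = .directed (WebVertex.point m ε (.bd j)) v) ∨
        (e.weight + 1 = n ∧ e.ends = .directed v (WebVertex.point m ε (.bd j)))) := by
  have hleave : ∀ c ∈ M, ∀ p q, NextStop M c p q → leave M c p = .bd j →
      c.init = j ∧ ¬IsYPoint M j ∧ p = c.init := by
    intro c hc p q h hl
    have hlt := hM.init_lt_term c hc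
    rcases leave_cases h.1 (h.ne_last hlt) with ⟨h4, h5⟩ | ⟨b, -, -, -, h5⟩ |
      ⟨b, -, -, -, h5⟩ <;> rw [h5] at hl
    · exact ⟨(foot_eq_bd hl).1, (foot_eq_bd hl).2, h4⟩
    · cases hl
    · cases hl
  have hreach : ∀ c ∈ M, ∀ p q, NextStop M c p q → reach M c q = .bd j →
      c.term = j ∧ ¬IsYPoint M j ∧ q = 2 * c.term - c.init := by
    intro c hc p q h hl
    have hlt := hM.init_lt_term c hc
    rcases reach_cases hlt h.2.1 (h.ne_init hlt) with ⟨h4, h5⟩ | ⟨b, -, -, -, h5⟩ |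
      ⟨b, -, -, -, h5⟩ <;> rw [h5] at hl
    · exact ⟨(foot_eq_bd hl).1, (foot_eq_bd hl).2, h4⟩
    · cases hl
    · cases hl
  have hdouble : ∀ lo hi x x', IsDoubleEdge M lo hi x x' → (lo = .bd j ∨ hi = .bd j) →
      ∃ a ∈ M, ∃ b ∈ M, a.term = j ∧ b.init = j ∧ lo = .bd j ∧ hi = .y j ∧ x = a.color ∧
        x' = b.color := by
    rintro lo hi x x' (⟨a, ha, b, hb, hab, rfl, rfl, rfl, rfl⟩ |
      ⟨a, ha, b, hb, hab, rfl, rfl, rfl, rfl⟩) (h | h) <;> cases h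
    exact ⟨a, ha, b, hb, hab, rfl, rfl, rfl, rfl, rfl⟩
  have hmem := fun e => mem_incident_rawWeb (e := e) hM hε hεm (α := .bd j) trivial
  have hrow := hM.row_lt j h1 h2
  -- An entry of the first row only starts an arc and one of the last row only ends one; in the
  -- other rows the edge is the stem of a `Y`.
  by_cases hr0 : row j = 0
  · have hY := hM.not_isYPoint_of_row_eq_zero hr0
    obtain ⟨b, hb, rfl⟩ := hM.exists_init j h1 h2 (by omega)
    have hlt := hM.init_lt_term b hb
    obtain ⟨q, hq⟩ := exists_nextStop_right hlt (init_mem_arcStops M b) (by omega)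
    have hl : leave M b b.init = .bd b.init := by rw [leave, if_pos rfl, foot, if_neg hY]
    refine ⟨singleArcEdge m ε M b b.init q, (reach M b q).point m ε, ?_, Or.inl ⟨?_, ?_⟩⟩
    · ext e
      rw [hmem]
      constructor
      · rintro (⟨c, hc, p, q', h, h', rfl⟩ | ⟨c, hc, p, q', h, h', rfl⟩ | ⟨lo, hi, x, x', h, h', rfl⟩)
        · obtain ⟨g1, -, g3⟩ := hleave c hc p q' h h'
          obtain rfl := hM.init_inj c hc b hb g1
          rw [g3] at h ⊢
          rw [h.right_unique hq]; rfl
        · obtain ⟨g1, -, -⟩ := hreach c hc p q' h h'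
          have := hM.row_term c hc
          have := hM.color_pos hc
          rw [g1] at *; omega
        · obtain ⟨a, ha, b', hb', g1, g2, -⟩ := hdouble _ _ _ _ h h'
          exact absurd ⟨⟨a, ha, g1⟩, ⟨b', hb', g2⟩⟩ hY
      · rintro rfl
        exact Or.inl ⟨b, hb, _, q, hq, hl, rfl⟩
    · change b.color = 1
      rw [← hM.row_init b hb, hr0]
    · rw [singleArcEdge_ends, hl]
  by_cases hrn : row j + 1 = n
  · have hY := hM.not_isYPoint_of_row_add_one_eq hrn
    obtain ⟨a, ha, rfl⟩ := hM.exists_term j h1 h2 (by omega)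
    have hlt := hM.init_lt_term a ha
    obtain ⟨p, hp⟩ := exists_nextStop_left hlt (last_mem_arcStops M a) (by omega)
    have hl : reach M a (2 * a.term - a.init) = .bd a.term := by
      rw [reach, if_pos rfl, foot, if_neg hY]
    refine ⟨singleArcEdge m ε M a p (2 * a.term - a.init), (leave M a p).point m ε, ?_,
      Or.inr ⟨?_, ?_⟩⟩
    · ext e
      rw [hmem]
      constructor
      · rintro (⟨c, hc, p', q', h, h', rfl⟩ | ⟨c, hc, p', q', h, h', rfl⟩ |
          ⟨lo, hi, x, x', h, h', rfl⟩)
        · obtain ⟨g1, -, g3⟩ := hleave c hc p' q' h h'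
          have := hM.row_init c hc
          have := hM.color_lt hc
          rw [g1] at *; omega
        · obtain ⟨g1, -, g3⟩ := hreach c hc p' q' h h'
          obtain rfl := hM.term_inj c hc a ha g1
          rw [g3] at h ⊢
          rw [h.left_unique hp]; rfl
        · obtain ⟨a, ha, b', hb', g1, g2, -⟩ := hdouble _ _ _ _ h h'
          exact absurd ⟨⟨a, ha, g1⟩, ⟨b', hb', g2⟩⟩ hY
      · rintro rfl
        exact Or.inr (Or.inl ⟨a, ha, p, _, hp, hl, rfl⟩)
    · change a.color + 1 = n
      rw [← hM.row_term a ha, hrn]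
    · rw [singleArcEdge_ends, hl]
  · obtain ⟨a, ha, haj⟩ := hM.exists_term j h1 h2 (by omega)
    obtain ⟨b, hb, hbj⟩ := hM.exists_init j h1 h2 (by omega)
    have hY : IsYPoint M j := ⟨⟨a, ha, haj⟩, ⟨b, hb, hbj⟩⟩
    have hca := hM.row_term a ha
    have hcb := hM.row_init b hb
    rw [haj] at hca
    rw [hbj] at hcb
    refine ⟨doubleArcEdge (WebVertex.point m ε (.bd j)) (WebVertex.point m ε (.y j)) a.color b.color,
      WebVertex.point m ε (.y j), ?_, Or.inl ⟨?_, if_pos (by omega)⟩⟩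
    · ext e
      rw [hmem]
      constructor
      · rintro (⟨c, hc, p', q', h, h', rfl⟩ | ⟨c, hc, p', q', h, h', rfl⟩ |
          ⟨lo, hi, x, x', h, h', rfl⟩)
        · exact absurd hY (hleave c hc p' q' h h').2.1
        · exact absurd hY (hreach c hc p' q' h h').2.1
        · obtain ⟨a', ha', b', hb', g1, g2, rfl, rfl, rfl, rfl⟩ := hdouble _ _ _ _ h h'
          obtain rfl := hM.term_inj a' ha' a ha (g1.trans haj.symm)
          obtain rfl := hM.init_inj b' hb' b hb (g2.trans hbj.symm)
          rfl
      · rintro rfl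
        exact Or.inr (Or.inr ⟨_, _, _, _, Or.inl ⟨a, ha, b, hb, haj.trans hbj.symm, rfl, rfl, rfl, rfl⟩,
          Or.inl (by rw [hbj]), by rw [hbj]⟩)
    · rw [doubleArcEdge_weight, if_pos (by omega)]
      omega

/-- The edges at an interior vertex obey the conventions. -/
theorem usual_interior (hn : n = 3 ∨ n = 4) (hM : IsTableauMatching n N row M) (hε : 0 < ε)
    (hεm : ε < m / 2) {v : ℝ × ℝ} (hv : v ∈ (rawWeb m ε N M).interior) {I : Set PlaneEdge}
    (hI : I = ((rawWeb m ε N M).usual n).incident v) :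
    I.ncard = 3 ∧ (n = 3 → ∀ e ∈ I, e.weight = 1) ∧
    (n = 4 → {e | e ∈ I ∧ e.weight = 1}.ncard = 2 ∧ {e | e ∈ I ∧ e.weight = 2}.ncard = 1) ∧
    ((∀ e ∈ I, e.weight = 1 → ∃ u, e.ends = .directed v u) ∨
      (∀ e ∈ I, e.weight = 1 → ∃ u, e.ends = .directed u v)) := by
  obtain ⟨α, a, b, s, t, lo, hi, x, x', rfl, h⟩ := exists_vertexStops hM hv
  have hlta := hM.init_lt_term a h.mem_left
  have hltb := hM.init_lt_term b h.mem_right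
  obtain ⟨p, hp⟩ := exists_nextStop_left hlta h.stop_left h.ne_init
  obtain ⟨q, hq⟩ := exists_nextStop_right hltb h.stop_right h.ne_last
  have e1 := singleArcEdge_ends (m := m) (ε := ε) M a p s
  have e2 := singleArcEdge_ends (m := m) (ε := ε) M b t q
  rw [h.reach_eq] at e1
  rw [h.leave_eq] at e2
  rw [PlaneWeb.incident_usual, h.incident hM hε hεm hp hq, Set.image_insert_eq, Set.image_insert_eq,
    Set.image_singleton] at hI
  have xα : α.abscissa = a.init + s := by rw [← h.reach_eq, abscissa_reach]
  have xα' : α.abscissa = b.init + t := by rw [← h.leave_eq, abscissa_leave]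
  have hps := hp.2.2.1
  have htq := hq.2.2.1
  -- Abscissas separate the neighbours of the vertex: the arriving edge comes from the left, the
  -- leaving one goes to the right, and the vertical edge stays on the same line.
  have hne : ∀ {β γ : WebVertex}, β.abscissa ≠ γ.abscissa → β.point m ε ≠ γ.point m ε := by
    intro β γ hβγ he
    apply hβγ
    have := congrArg Prod.fst he
    rw [WebVertex.point_fst, WebVertex.point_fst] at this
    have : (β.abscissa : ℝ) = γ.abscissa := by linarith
    exact_mod_cast this
  have xl := abscissa_leave M a p
  have xr := abscissa_reach M b q
  have xd := h.isDouble.abscissa.1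
  -- The vertex is the upper or the lower end of the vertical edge. At the lower end the two colors
  -- change roles and the direction relative to the vertex is reversed.
  rcases h.colors with ⟨hα, rfl, rfl⟩ | ⟨hα, rfl, rfl⟩
  · refine usual_trivalent hn (u := lo.point m ε) (hM.color_pos h.mem_left) (hM.color_lt h.mem_left)
      (hM.color_pos h.mem_right) (hM.color_lt h.mem_right) h.color_ne e1 e2 ?_ rfl rfl rfl
      (hne (by omega)) (hne (by omega)) (hne (by omega))
      (hne (by rw [xd, hα]; omega)) (hne (by rw [xd, hα]; omega)) hI
    rw [hα]; rfl
  · have hxx := h.color_ne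
    refine usual_trivalent hn (u := hi.point m ε) (hM.color_pos h.mem_left) (hM.color_lt h.mem_left)
      (hM.color_pos h.mem_right) (hM.color_lt h.mem_right) h.color_ne.symm e1 e2 ?_ rfl rfl ?_
      (hne (by omega)) (hne (by omega)) (hne (by omega))
      (hne (by rw [← xd, hα]; omega)) (hne (by rw [← xd, hα]; omega)) hI
    · rw [hα, doubleArcEdge_ends]
      rcases lt_or_gt_of_ne hxx with h' | h'
      · rw [if_pos h', if_neg (by omega)]
      · rw [if_neg (by omega), if_pos h']
    · rw [doubleArcEdge_weight]
      rcases lt_or_gt_of_ne hxx with h' | h'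
      · rw [if_pos h', if_neg (by omega)]
      · rw [if_neg (by omega), if_pos h']

theorem usualConventions_rawWeb (hn : n = 3 ∨ n = 4) (hM : IsTableauMatching n N row M)
    (hε : 0 < ε) (hεm : ε < m / 2) : UsualConventions n ((rawWeb m ε N M).usual n) where
  boundary_source := by
    rintro _ ⟨j, h1, h2, rfl⟩
    obtain ⟨e, v, h, hcase⟩ := exists_incident_bd (by omega) hM hε hεm h1 h2
    refine ⟨e.usual n, ?_, ?_⟩
    · rw [PlaneWeb.incident_usual]
      change PlaneEdge.usual n '' (rawWeb m ε N M).incident (WebVertex.point m ε (.bd j)) = _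
      rw [h, Set.image_singleton]
    · rcases hcase with ⟨h3, h4⟩ | ⟨h3, h4⟩
      · rw [PlaneEdge.weight_usual_of_one h3]
        exact ⟨h3, v, h4⟩
      · rw [PlaneEdge.usual_of_weight_add_one (by omega) h3, h4]
        exact ⟨rfl, v, rfl⟩
  trivalent v hv := (usual_interior hn hM hε hεm hv rfl).1
  weights_three h v hv := (usual_interior hn hM hε hεm hv rfl).2.1 h
  weights_four h v hv := (usual_interior hn hM hε hεm hv rfl).2.2.1 h
  source_or_sink v hv := (usual_interior hn hM hε hεm hv rfl).2.2.2
  undirected_four := by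
    rintro rfl _ ⟨e, he, rfl⟩ hw
    obtain ⟨h1, h2⟩ := rawWeb_weight hM he
    exact PlaneEdge.usual_eq_undirected h1 h2 hw

/-- The web of a matching has exactly one usual form. -/
theorem isUsualForm_iff (hn : n = 3 ∨ n = 4) (hM : IsTableauMatching n N row M)
    (hε : 0 < ε) (hεm : ε < m / 2) {W : PlaneWeb} :
    IsUsualForm n (matchingWeb m ε N M) W ↔ W = (rawWeb m ε N M).usual n := by
  have hw : ∀ e ∈ (matchingWeb m ε N M).edges, 1 ≤ e.weight ∧ e.weight < n := by
    rintro _ ⟨e, he, rfl⟩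
    have := rawWeb_weight hM he
    rcases PlaneEdge.weight_normalize (rawWeb m ε N M).boundary e with h | h <;> omega
  rw [← matchingWeb_usual (by omega) hM hε hεm]
  constructor
  · refine IsUsualForm.eq_usual hn hw ?_
    rintro _ ⟨e, he, rfl⟩
    obtain ⟨v, hv, hev⟩ := rawWeb_exists_end hM he
    exact ⟨v, hv, (PlaneEdge.has_normalize _ e v).2 hev⟩
  · rintro rfl
    refine ⟨PlaneWeb.exists_flip_eq_usual hn hw, ?_⟩
    rw [matchingWeb_usual (by omega) hM hε hεm]
    exact usualConventions_rawWeb hn hM hε hεm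

end web

section mirror

variable {n N : ℕ} {row : ℤ → ℕ} {M : Set ColoredArc} {m ε : ℝ}

/-! ### The reflection of the web of a matching -/

theorem reflectPoint_reflectPoint (N : ℕ) (p : ℝ × ℝ) :
    reflectPoint N (reflectPoint N p) = p := by
  simp [reflectPoint]

theorem EdgeEnds.map_reverse (f : ℝ × ℝ → ℝ × ℝ) (d : EdgeEnds) :
    d.reverse.map f = (d.map f).reverse := by cases d <;> rfl

theorem EdgeEnds.map_forget (f : ℝ × ℝ → ℝ × ℝ) (d : EdgeEnds) :
    d.forget.map f = (d.map f).forget := by cases d <;> rfl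

theorem PlaneEdge.reflect_reflect (N : ℕ) (e : PlaneEdge) : (e.reflect N).reflect N = e := by
  have hinv : reflectPoint N ∘ reflectPoint N = id := funext (reflectPoint_reflectPoint N)
  obtain ⟨c, d, w⟩ := e
  refine PlaneEdge.ext ?_ ?_ rfl
  · change reflectPoint N '' (reflectPoint N '' c) = c
    rw [← Set.image_comp, hinv, Set.image_id]
  · cases d with
    | directed a b => simp [PlaneEdge.reflect, EdgeEnds.map, reflectPoint_reflectPoint]
    | undirected z =>
      change EdgeEnds.undirected (Sym2.map _ (Sym2.map _ z)) = _
      rw [Sym2.map_map, hinv, Sym2.map_id]; rfl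

theorem PlaneEdge.reflect_usual (n N : ℕ) (e : PlaneEdge) :
    (e.usual n).reflect N = (e.reflect N).usual n := by
  have hw : (e.reflect N).weight = e.weight := rfl
  unfold PlaneEdge.usual
  rw [hw]
  split_ifs
  · rfl
  · simp [PlaneEdge.reflect, PlaneEdge.flip, EdgeEnds.map_reverse]
  · simp [PlaneEdge.reflect, EdgeEnds.map_forget]

theorem reflectPoint_image_segment (N : ℕ) (a b : ℝ × ℝ) :
    reflectPoint N '' segment ℝ a b = segment ℝ (reflectPoint N a) (reflectPoint N b) := by
  have h : reflectPoint N = fun p => ((LinearMap.prodMap (-LinearMap.id) LinearMap.id :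
      ℝ × ℝ →ₗ[ℝ] ℝ × ℝ).toAffineMap + AffineMap.const ℝ (ℝ × ℝ) ((N : ℝ) + 1, (0 : ℝ))) p := by
    funext p
    simp [reflectPoint]
    ring
  rw [h]
  exact image_segment ℝ _ a b

theorem reflectPoint_legPoint (N : ℕ) (m : ℝ) (u v : ℤ) :
    reflectPoint N (legPoint m u v) = legPoint m (N + 1 - v) (N + 1 - u) := by
  simp only [reflectPoint, legPoint, Prod.mk.injEq]
  push_cast
  constructor <;> ring

theorem reflectPoint_dumbbellTop (N : ℕ) (m ε : ℝ) (u v : ℤ) :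
    reflectPoint N (dumbbellTop m ε u v) = dumbbellTop m ε (N + 1 - v) (N + 1 - u) := by
  have h := reflectPoint_legPoint N m u v
  unfold dumbbellTop
  rw [← h]; rfl

theorem reflectPoint_dumbbellBot (N : ℕ) (m ε : ℝ) (u v : ℤ) :
    reflectPoint N (dumbbellBot m ε u v) = dumbbellBot m ε (N + 1 - v) (N + 1 - u) := by
  have h := reflectPoint_legPoint N m u v
  unfold dumbbellBot
  rw [← h]; rfl

theorem reflectPoint_boundaryVertex (N : ℕ) (j : ℤ) :
    reflectPoint N (boundaryVertex j) = boundaryVertex (N + 1 - j) := by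
  simp [reflectPoint, boundaryVertex]

theorem reflectPoint_yVertex (N : ℕ) (ε : ℝ) (j : ℤ) :
    reflectPoint N (yVertex ε j) = yVertex ε (N + 1 - j) := by
  simp [reflectPoint, yVertex]

theorem isYPoint_mirror {j : ℤ} :
    IsYPoint (ColoredArc.mirror n N '' M) (N + 1 - j) ↔ IsYPoint M j := by
  simp only [IsYPoint, Set.exists_mem_image, ColoredArc.mirror]
  rw [and_comm]
  refine and_congr (exists_congr fun a => and_congr_right fun _ => ?_)
    (exists_congr fun a => and_congr_right fun _ => ?_) <;> omega

theorem ColoredArc.Crosses.mirror {a b : ColoredArc} (h : a.Crosses b) :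
    (b.mirror n N).Crosses (a.mirror n N) := by
  obtain ⟨h1, h2, h3⟩ := h
  simp only [ColoredArc.Crosses, ColoredArc.mirror]
  omega

theorem ColoredArc.crosses_mirror {a b : ColoredArc} :
    (b.mirror n N).Crosses (a.mirror n N) ↔ a.Crosses b := by
  simp only [ColoredArc.Crosses, ColoredArc.mirror]
  omega

theorem reflectPoint_footVertex (n N : ℕ) (M : Set ColoredArc) (j : ℤ) :
    reflectPoint N (footVertex ε M j) =
      footVertex ε (ColoredArc.mirror n N '' M) (N + 1 - j) := by
  unfold footVertex
  by_cases h : IsYPoint M j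
  · rw [if_pos h, if_pos (isYPoint_mirror.2 h)]
    exact reflectPoint_yVertex N ε j
  · rw [if_neg h, if_neg (isYPoint_mirror.not.2 h)]
    exact reflectPoint_boundaryVertex N j

/-- The stop of the mirror image of the arc `a` that corresponds to the stop `t` of `a`. -/
def mirrorStop (N : ℕ) (a : ColoredArc) (t : ℤ) : ℤ := N + 1 + a.term - a.init - t

theorem mirrorStop_mem {a : ColoredArc} {t : ℤ} (h : t ∈ arcStops M a) :
    mirrorStop N a t ∈ arcStops (ColoredArc.mirror n N '' M) (a.mirror n N) := by
  rcases h with ((h | h) | ⟨b, hb, hc, h⟩) | ⟨b, hb, hc, h⟩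
  · refine Or.inl (Or.inl (Or.inr ?_))
    change N + 1 + a.term - a.init - t = 2 * ((N : ℤ) + 1 - a.init) - (N + 1 - a.term)
    omega
  · refine Or.inl (Or.inl (Or.inl ?_))
    have : t = 2 * a.term - a.init := h
    change N + 1 + a.term - a.init - t = (N : ℤ) + 1 - a.term
    omega
  · refine Or.inr ⟨_, Set.mem_image_of_mem _ hb, hc.mirror, ?_⟩
    change N + 1 + a.term - a.init - t =
      (N : ℤ) + 1 - b.term + ((N : ℤ) + 1 - a.init - (N + 1 - a.term))
    omega
  · refine Or.inl (Or.inr ⟨_, Set.mem_image_of_mem _ hb, hc.mirror, ?_⟩)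
    change N + 1 + a.term - a.init - t = (N : ℤ) + 1 - b.init
    omega

theorem mem_of_mirrorStop_mem {a : ColoredArc} {t : ℤ}
    (h : mirrorStop N a t ∈ arcStops (ColoredArc.mirror n N '' M) (a.mirror n N)) :
    t ∈ arcStops M a := by
  rcases h with ((h | h) | ⟨_, ⟨b, hb, rfl⟩, hc, h⟩) | ⟨_, ⟨b, hb, rfl⟩, hc, h⟩
  · refine Or.inl (Or.inl (Or.inr ?_))
    change N + 1 + a.term - a.init - t = (N : ℤ) + 1 - a.term at h
    change t = 2 * a.term - a.init
    omega
  · refine Or.inl (Or.inl (Or.inl ?_))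
    change N + 1 + a.term - a.init - t = 2 * ((N : ℤ) + 1 - a.init) - (N + 1 - a.term) at h
    omega
  · refine Or.inr ⟨b, hb, ColoredArc.crosses_mirror.1 hc, ?_⟩
    change N + 1 + a.term - a.init - t = (N : ℤ) + 1 - b.init at h
    omega
  · refine Or.inl (Or.inr ⟨b, hb, ColoredArc.crosses_mirror.1 hc, ?_⟩)
    change N + 1 + a.term - a.init - t =
      (N : ℤ) + 1 - b.term + ((N : ℤ) + 1 - a.init - (N + 1 - a.term)) at h
    omega

theorem NextStop.mirror {a : ColoredArc} {p q : ℤ} (h : NextStop M a p q) :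
    NextStop (ColoredArc.mirror n N '' M) (a.mirror n N) (mirrorStop N a q) (mirrorStop N a p) := by
  obtain ⟨h1, h2, h3, h4⟩ := h
  refine ⟨mirrorStop_mem h2, mirrorStop_mem h1, by unfold mirrorStop; omega, fun t ht htpq => ?_⟩
  have hmm : mirrorStop N a (mirrorStop N a t) = t := by unfold mirrorStop; omega
  rw [← hmm] at ht
  refine h4 _ (mem_of_mirrorStop_mem ht) ?_
  unfold mirrorStop at htpq ⊢
  omega

/-- Reflection exchanges the two legs and reverses the walk, so reaching a stop becomes leaving the
mirrored one; upper and lower vertices of dumbbells are kept. -/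
theorem reflectPoint_reachVertex {a : ColoredArc} {t : ℤ}
    (ht : t ∈ arcStops M a) (ha : a.init < a.term) :
    reflectPoint N (reachVertex m ε M a t) =
      leaveVertex m ε (ColoredArc.mirror n N '' M) (a.mirror n N) (mirrorStop N a t) := by
  -- The apex is never a stop, so `t < a.term` fails exactly if the mirrored stop lies on the rising
  -- leg.
  have hne : t ≠ a.term := by
    rcases arcStops_cases ht with h | h | ⟨h1, h2, -⟩ | ⟨h1, h2, -⟩ <;> omega
  change reflectPoint N (if t = 2 * a.term - a.init then _ else if t < a.term then _ else _) =
    if N + 1 + a.term - a.init - t = (N : ℤ) + 1 - a.term then _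
    else if N + 1 + a.term - a.init - t < (N : ℤ) + 1 - a.init then
      dumbbellTop m ε ((N : ℤ) + 1 - a.term) (N + 1 + a.term - a.init - t)
    else dumbbellBot m ε (N + 1 + a.term - a.init - t - ((N : ℤ) + 1 - a.init - (N + 1 - a.term)))
      ((N : ℤ) + 1 - a.init)
  by_cases h1 : t = 2 * a.term - a.init
  · rw [if_pos h1, if_pos (show N + 1 + a.term - a.init - t = _ by omega)]
    exact reflectPoint_footVertex n N M _
  rw [if_neg h1, if_neg (show ¬N + 1 + a.term - a.init - t = _ by omega)]
  by_cases h2 : t < a.term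
  · rw [if_pos h2, if_neg (show ¬N + 1 + a.term - a.init - t < _ by omega),
      reflectPoint_dumbbellBot]
    congr 1; omega
  · rw [if_neg h2, if_pos (show N + 1 + a.term - a.init - t < _ by omega),
      reflectPoint_dumbbellTop]
    congr 1; omega

theorem reflectPoint_leaveVertex {a : ColoredArc} {t : ℤ}
    (ht : t ∈ arcStops M a) (ha : a.init < a.term) :
    reflectPoint N (leaveVertex m ε M a t) =
      reachVertex m ε (ColoredArc.mirror n N '' M) (a.mirror n N) (mirrorStop N a t) := by
  have hne : t ≠ a.term := by
    rcases arcStops_cases ht with h | h | ⟨h1, h2, -⟩ | ⟨h1, h2, -⟩ <;> omega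
  change reflectPoint N (if t = a.init then _ else if t < a.term then _ else _) =
    if N + 1 + a.term - a.init - t = 2 * ((N : ℤ) + 1 - a.init) - (N + 1 - a.term) then _
    else if N + 1 + a.term - a.init - t < (N : ℤ) + 1 - a.init then
      dumbbellBot m ε ((N : ℤ) + 1 - a.term) (N + 1 + a.term - a.init - t)
    else dumbbellTop m ε (N + 1 + a.term - a.init - t - ((N : ℤ) + 1 - a.init - (N + 1 - a.term)))
      ((N : ℤ) + 1 - a.init)
  by_cases h1 : t = a.init
  · rw [if_pos h1, if_pos (show N + 1 + a.term - a.init - t = _ by omega)]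
    exact reflectPoint_footVertex n N M _
  rw [if_neg h1, if_neg (show ¬N + 1 + a.term - a.init - t = _ by omega)]
  by_cases h2 : t < a.term
  · rw [if_pos h2, if_neg (show ¬N + 1 + a.term - a.init - t < _ by omega),
      reflectPoint_dumbbellTop]
    congr 1; omega
  · rw [if_neg h2, if_pos (show N + 1 + a.term - a.init - t < _ by omega),
      reflectPoint_dumbbellBot]
    congr 1; omega

/-- The reflection of an edge from a single arc is an edge from the mirrored arc, flipped. -/
theorem singleArcEdge_mirror {a : ColoredArc} (ha : a.init < a.term) {p q : ℤ}
    (h : NextStop M a p q) :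
    singleArcEdge m ε (ColoredArc.mirror n N '' M) (a.mirror n N) (mirrorStop N a q)
      (mirrorStop N a p) = ((singleArcEdge m ε M a p q).reflect N).flip n := by
  have hl := reflectPoint_leaveVertex (m := m) (ε := ε) (N := N) (n := n) h.1 ha
  have hr := reflectPoint_reachVertex (m := m) (ε := ε) (N := N) (n := n) h.2.1 ha
  have happ : legPoint m (a.mirror n N).init (a.mirror n N).term =
      reflectPoint N (legPoint m a.init a.term) := (reflectPoint_legPoint N m _ _).symm
  refine PlaneEdge.ext ?_ ?_ rfl
  · change (if mirrorStop N a q < (a.mirror n N).term ∧ (a.mirror n N).term < mirrorStop N a p then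
      segment ℝ _ _ ∪ segment ℝ _ _ else segment ℝ _ _) = reflectPoint N ''
      (if p < a.term ∧ a.term < q then segment ℝ _ _ ∪ segment ℝ _ _ else segment ℝ _ _)
    rw [← hl, ← hr, happ]
    by_cases hcond : p < a.term ∧ a.term < q
    · rw [if_pos hcond, if_pos (by simp only [mirrorStop, ColoredArc.mirror]; omega),
        Set.image_union, reflectPoint_image_segment, reflectPoint_image_segment, Set.union_comm,
        segment_symm ℝ (reflectPoint N (legPoint m a.init a.term)),
        segment_symm ℝ (reflectPoint N (reachVertex m ε M a q))]
    · rw [if_neg hcond, if_neg (by simp only [mirrorStop, ColoredArc.mirror]; omega),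
        reflectPoint_image_segment, segment_symm]
  · change EdgeEnds.directed _ _ = EdgeEnds.directed _ _
    rw [← hl, ← hr]

/-- The mirrored arcs exchange rising and falling, and complementing reverses the order of the
colors. The two effects cancel in the direction, and the difference of the colors is unchanged. -/
theorem doubleArcEdge_reflect (N : ℕ) {lo hi : ℝ × ℝ} {x x' : ℕ} (hx : x ≤ n) (hx' : x' ≤ n) :
    (doubleArcEdge lo hi x x').reflect N =
      doubleArcEdge (reflectPoint N lo) (reflectPoint N hi) (n - x') (n - x) := by
  refine PlaneEdge.ext (reflectPoint_image_segment N lo hi) ?_ ?_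
  · change EdgeEnds.map _ (if _ then _ else _) = if _ then _ else _
    by_cases h : x < x'
    · rw [if_pos h, if_pos (by omega)]; rfl
    · rw [if_neg h, if_neg (by omega)]; rfl
  · change (if _ then _ else _) = if _ then _ else _
    by_cases h : x < x'
    · rw [if_pos h, if_pos (by omega)]; omega
    · rw [if_neg h, if_neg (by omega)]; omega

theorem ColoredArc.mirror_mirror {a : ColoredArc} (h : a.color ≤ n) :
    (a.mirror n N).mirror n N = a := by
  ext <;> simp only [ColoredArc.mirror] <;> omega

/-- The properties of arcs that survive reflection. -/
def IsArcSet (n : ℕ) (M : Set ColoredArc) : Prop :=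
  ∀ a ∈ M, a.init < a.term ∧ 1 ≤ a.color ∧ a.color < n

theorem IsArcSet.mirror (hM : IsArcSet n M) : IsArcSet n (ColoredArc.mirror n N '' M) := by
  rintro _ ⟨a, ha, rfl⟩
  have := hM a ha
  simp only [ColoredArc.mirror]
  omega

theorem IsArcSet.mirror_mirror (hM : IsArcSet n M) :
    ColoredArc.mirror n N '' (ColoredArc.mirror n N '' M) = M := by
  rw [Set.image_image]
  conv_rhs => rw [← Set.image_id M]
  exact Set.image_congr fun a ha => ColoredArc.mirror_mirror (hM a ha).2.2.le

/-- Edges from single arcs match only up to a flip, which `PlaneEdge.usual_flip` removes; vertical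
edges match as they are. -/
theorem rawWeb_usual_edge_mirror (hn : n = 3 ∨ n = 4) (hM : IsArcSet n M) {e : PlaneEdge}
    (he : e ∈ (rawWeb m ε N M).edges) :
    ∃ e' ∈ (rawWeb m ε N (ColoredArc.mirror n N '' M)).edges,
      e'.usual n = (e.usual n).reflect N := by
  rcases he with (⟨a, ha, p, q, h, rfl⟩ | ⟨a, ha, b, hb, hab, rfl⟩) | ⟨a, ha, b, hb, hab, rfl⟩
  · obtain ⟨h1, h2, h3⟩ := hM a ha
    refine ⟨_, Or.inl (Or.inl ⟨_, Set.mem_image_of_mem _ ha, _, _, h.mirror, rfl⟩), ?_⟩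
    rw [singleArcEdge_mirror h1 h, PlaneEdge.usual_flip hn h2 h3, PlaneEdge.reflect_usual]
  · refine ⟨_, Or.inl (Or.inr ⟨_, Set.mem_image_of_mem _ hb, _, Set.mem_image_of_mem _ ha, ?_, rfl⟩), ?_⟩
    · simp only [ColoredArc.mirror]; omega
    · rw [PlaneEdge.reflect_usual, doubleArcEdge_reflect N (hM a ha).2.2.le (hM b hb).2.2.le,
        reflectPoint_boundaryVertex, reflectPoint_yVertex, ← hab]
      rfl
  · refine ⟨_, Or.inr ⟨_, Set.mem_image_of_mem _ hb, _, Set.mem_image_of_mem _ ha, hab.mirror, rfl⟩, ?_⟩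
    rw [PlaneEdge.reflect_usual, doubleArcEdge_reflect N (hM a ha).2.2.le (hM b hb).2.2.le,
      reflectPoint_dumbbellBot, reflectPoint_dumbbellTop]
    rfl

theorem rawWeb_boundary_reflect (m ε : ℝ) (N : ℕ) (M M' : Set ColoredArc) :
    reflectPoint N '' (rawWeb m ε N M).boundary = (rawWeb m ε N M').boundary := by
  ext v
  constructor
  · rintro ⟨_, ⟨j, h1, h2, rfl⟩, rfl⟩
    exact ⟨N + 1 - j, by omega, by omega, reflectPoint_boundaryVertex N j⟩
  · rintro ⟨j, h1, h2, rfl⟩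
    refine ⟨_, ⟨N + 1 - j, by omega, by omega, rfl⟩, ?_⟩
    rw [reflectPoint_boundaryVertex, sub_sub_cancel]

theorem rawWeb_interior_mirror {v : ℝ × ℝ} (hv : v ∈ (rawWeb m ε N M).interior) :
    reflectPoint N v ∈ (rawWeb m ε N (ColoredArc.mirror n N '' M)).interior := by
  rcases hv with ⟨j, hj, rfl⟩ | ⟨a, ha, b, hb, hab, h⟩
  · exact Or.inl ⟨N + 1 - j, isYPoint_mirror.2 hj, reflectPoint_yVertex N ε j⟩
  · refine Or.inr ⟨_, Set.mem_image_of_mem _ hb, _, Set.mem_image_of_mem _ ha, hab.mirror, ?_⟩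
    rcases h with rfl | rfl
    · exact Or.inl (reflectPoint_dumbbellTop N m ε _ _)
    · exact Or.inr (reflectPoint_dumbbellBot N m ε _ _)

/-- The usual form of the web of the mirrored matching is the reflection of the usual form. -/
theorem rawWeb_usual_reflect (hn : n = 3 ∨ n = 4) (hM : IsArcSet n M) :
    ((rawWeb m ε N M).usual n).reflect N =
      (rawWeb m ε N (ColoredArc.mirror n N '' M)).usual n := by
  refine PlaneWeb.ext (rawWeb_boundary_reflect m ε N M (ColoredArc.mirror n N '' M)) ?_ ?_
  · refine Set.Subset.antisymm ?_ fun v hv => ?_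
    · rintro _ ⟨v, hv, rfl⟩
      exact rawWeb_interior_mirror hv
    -- Mirroring is an involution on arc sets, so the reverse inclusion is the forward one for the
    -- mirrored matching.
    · have h := rawWeb_interior_mirror (n := n) (N := N) (m := m) (ε := ε) hv
      rw [hM.mirror_mirror] at h
      exact ⟨_, h, reflectPoint_reflectPoint N v⟩
  · change PlaneEdge.reflect N '' (PlaneEdge.usual n '' (rawWeb m ε N M).edges) =
      PlaneEdge.usual n '' (rawWeb m ε N (ColoredArc.mirror n N '' M)).edges
    refine Set.Subset.antisymm ?_ ?_
    · rintro _ ⟨_, ⟨e, he, rfl⟩, rfl⟩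
      exact rawWeb_usual_edge_mirror hn hM he
    · rintro _ ⟨e, he, rfl⟩
      obtain ⟨f, hf, hfe⟩ := rawWeb_usual_edge_mirror hn hM.mirror he
      rw [hM.mirror_mirror] at hf
      exact ⟨_, ⟨f, hf, rfl⟩, by rw [hfe, PlaneEdge.reflect_reflect]⟩

theorem IsTableauMatching.isArcSet (hM : IsTableauMatching n N row M) : IsArcSet n M :=
  fun a ha => ⟨hM.init_lt_term a ha, hM.color_pos ha, hM.color_lt ha⟩

end mirror

/-! ### Uniqueness of the two usual forms and their reflection -/

theorem mainTheorem3 (n k : ℕ) (hn : n = 3 ∨ n = 4) (T : Filling) (hT : IsRectSYT n k T)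
    (m ε : ℝ) (hm : 0 < m) (hε : 0 < ε) (hεm : ε < m / 2) :
    (∃! W : PlaneWeb, IsUsualForm n (tableauWeb m ε n k T) W) ∧
    (∃! W : PlaneWeb, IsUsualForm n (tableauWeb m ε n k (evacuation n k T)) W) ∧
    ∀ W W' : PlaneWeb,
      IsUsualForm n (tableauWeb m ε n k T) W →
      IsUsualForm n (tableauWeb m ε n k (evacuation n k T)) W' →
      W.reflect (n * k) = W' := by
  have h1 : ∀ W, IsUsualForm n (tableauWeb m ε n k T) W ↔ _ :=
    fun W => isUsualForm_iff hn hT.isTableauMatching hε hεm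
  have h2 : ∀ W, IsUsualForm n (tableauWeb m ε n k (evacuation n k T)) W ↔ _ :=
    fun W => isUsualForm_iff hn hT.evacuation.isTableauMatching hε hεm
  refine ⟨⟨_, (h1 _).2 rfl, fun W hW => (h1 W).1 hW⟩, ⟨_, (h2 _).2 rfl, fun W hW => (h2 W).1 hW⟩,
    fun W W' hW hW' => ?_⟩
  rw [(h1 W).1 hW, (h2 W').1 hW', hT.tableauMatching_evacuation]
  exact rawWeb_usual_reflect hn hT.isTableauMatching.isArcSet
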